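/- **Setting.** On Minkowski spacetime $\mathbb{R}^4$ with $\eta = \operatorname{diag}(1,-1,-1,-1)$ (indices $0,\dots,3$, summation convention), let $g_{\mu\nu} = \eta_{\mu\nu} + \varkappa h_{\mu\nu}$ with $\varkappa \in \mathbb{R}$ and a symmetric graviton field $h$ (fields are complexified, so that plane waves are allowed). Let $\Gamma^\tau_{\mu\nu}$ be the Christoffel symbols of $g$, $\mathrm{d}V_g = \sqrt{-\det g}\,\mathrm{d}V_\eta$, let $e^m_\mu$ be the vielbein of $g$ in the symmetric Lorentz gauge, i.e. $g_{\mu\nu} = \eta_{mn}e^m_\mu e^n_\nu$ with $\eta_{mn}e^n_\mu$ symmetric in $m,\mu$ and with all eigenvalues of $(e^m_\mu)$ in the open right half plane (so $e = \sum_k \binom{1/2}{k}(\varkappa\eta h)^k$ for small $\varkappa\eta h$), and let $e^\mu_m = g^{\mu\nu}\eta_{mn}e^n_\nu$, $e^{\mu r} = \eta^{rm}e^\mu_m$. The ten matter-model Lagrange densities, with graviton-free matter tensors ${}_kT$, are $$\begin{aligned} {}_1\mathcal{L} &= {}_1T\,\mathrm{d}V_g, & {}_2\mathcal{L} &= g^{\mu\nu}{}_2T_{\mu\nu}\,\mathrm{d}V_g,\\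 {}_3\mathcal{L} &= g^{\mu\nu}g^{\rho\sigma}{}_3T_{\mu\nu\rho\sigma}\,\mathrm{d}V_g, & {}_4\mathcal{L} &= g^{\mu\nu}\Gamma^\tau_{\mu\nu}{}_4T_\tau\,\mathrm{d}V_g,\\ {}_5\mathcal{L} &= g^{\mu\nu}g^{\rho\sigma}\Gamma^\tau_{\mu\nu}{}_5T_{\rho\sigma\tau}\,\mathrm{d}V_g, & {}_6\mathcal{L} &= g^{\mu\nu}g^{\rho\sigma}\Gamma^\kappa_{\mu\nu}\Gamma^\lambda_{\rho\sigma}{}_6T_{\kappa\lambda}\,\mathrm{d}V_g,\\ {}_7\mathcal{L} &= e^o_0\,{}_7T_o\,\mathrm{d}V_g, & {}_8\mathcal{L} &= e^o_0e^{\rho r}{}_8T_{o\rho r}\,\mathrm{d}V_g,\\ {}_9\mathcal{L} &= e^o_0e^{\rho r}e^{\sigma s}(\partial_\rho e^t_\sigma)\,{}_9T_{orst}\,\mathrm{d}V_g, & {}_{10}\mathcal{L} &= e^o_0e^{\rho r}e^{\sigma s}e^t_\tau\Gamma^\tau_{\rho\sigma}\,{}_{10}T_{orst}\,\mathrm{d}V_g.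 \end{aligned}$$ Let ${}_k\mathcal{L}^n$ be the grade-$n$ part of ${}_k\mathcal{L}$ in $\varkappa$, i.e. $\frac{\varkappa^n}{n!}\frac{\mathrm{d}^n}{\mathrm{d}s^n}\big|_{s=0}$ of ${}_k\mathcal{L}$ for the metric $\eta + sh$. For $n \ge 0$ gravitons with indices $\mu_i\nu_i$ and incoming momenta $p_i \in \mathbb{C}^4$ (physically $p_i\in\mathbb{R}^4$), put $h^{(i)}_{\alpha\beta}(x) = \frac12(\delta_\alpha^{\mu_i}\delta_\beta^{\nu_i}+\delta_\alpha^{\nu_i}\delta_\beta^{\mu_i})e^{\mathrm{i}\eta(x,p_i)}$, and let the matter tensor be ${}_kT = {}_k\widehat T e^{\mathrm{i}\eta(x,q)}$ with $q \in \mathbb{C}^4$. The graviton–matter $n$-point vertex Feynman rule ${}_k\mathfrak{M}_n$ (contracted with ${}_k\widehat T$, in which it is linear) is $\mathrm{i}$ times the symmetrized functional derivative of ${}_k\mathcal{L}^n$ by the $n$ distinguishable gravitons, without the plane wave of the total momentum: identifying ${}_k\mathcal{L}^n$ with its coefficient of $\mathrm{d}V_\eta$, $$\mathrm{i}\,\frac{\partial^n}{\partial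 t_1\cdots\partial t_n}\Big|_{t=0}\,{}_k\mathcal{L}^n\Big[\textstyle\sum_j t_jh^{(j)}\Big](x) = {}_k\mathfrak{M}_n^{\mu_1\nu_1|\cdots|\mu_n\nu_n}(p_1,\dots,p_n)\;e^{\mathrm{i}\eta(x,\,q+p_1+\cdots+p_n)}\qquad\text{for all }x.$$ **Theorem.** For all $\varkappa$, $n$, $\mu_i\nu_i$, $p_i$, $q$, ${}_k\widehat T$ and each $k = 1,\dots,10$: ${}_k\mathcal{L}$ has an expansion in $\varkappa$ (for every smooth symmetric $h$ and every point $x$ its value at $x$ for the metric $\eta+sh$ is analytic in $s$ at $0$), the function ${}_k\mathcal{L}^n[\sum_j t_jh^{(j)}](x)$ is smooth in $t \in \mathbb{R}^n$, the vertex Feynman rule ${}_k\mathfrak{M}_n$ exists, and $${}_k\mathfrak{M}_n^{\mu_1\nu_1|\cdots|\mu_n\nu_n}(p_1,\dots,p_n) = \frac{\mathrm{i}}{2^n}\sum_{\mu_i\leftrightarrow\nu_i}\sum_{s\in S_n}{}_k\mathfrak{m}_n^{\mu_{s(1)}\nu_{s(1)}|\cdots|\mu_{s(n)}\nu_{s(n)}}(p_{s(1)},\dots,p_{s(n)}),$$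 where the first sum is over the $2^n$ ways of interchanging $\mu_i$ and $\nu_i$ for a set of $i$'s. In the following, all sums over $m_1,m_2,\dots$ are over non-negative integers, $M_j := m_1+\cdots+m_j$, and $[a,b]$ stands for the gravitons $a,a+1,\dots,b$ (none if $b<a$), i.e. for the indices $\mu_a\nu_a|\cdots|\mu_b\nu_b$ and the momenta $p_a,\dots,p_b$: $$\begin{aligned} {}_1\mathfrak{m}_n &= {}_1\widehat T\,\mathfrak{v}_n^{[1,n]},\\ {}_2\mathfrak{m}_n &= {}_2\widehat T_{\mu\nu}\sum_{M_2=n}(-1)^{m_1}\mathfrak{h}_{m_1}^{\mu\nu|||[1,m_1]}\,\mathfrak{v}_{m_2}^{[M_1+1,n]},\\ {}_3\mathfrak{m}_n &= {}_3\widehat T_{\mu\nu\rho\sigma}\sum_{M_3=n}(-1)^{M_2}\mathfrak{h}_{m_1}^{\mu\nu|||[1,M_1]}\mathfrak{h}_{m_2}^{\rho\sigma|||[M_1+1,M_2]}\mathfrak{v}_{m_3}^{[M_2+1,n]},\\ {}_4\mathfrak{m}_n &= {}_4\widehat T_\rho\,\boldsymbol\Gamma^{[1]}_{\mu\nu\sigma}\sum_{M_3=n-1}(-1)^{M_2}\mathfrak{h}_{m_1}^{\mu\nu|||[2,M_1+1]}\mathfrak{h}_{m_2}^{\rho\sigma|||[M_1+2,M_2+1]}\mathfrak{v}_{m_3}^{[M_2+2,n]},\\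 {}_5\mathfrak{m}_n &= {}_5\widehat T_{\rho\sigma\kappa}\,\boldsymbol\Gamma^{[1]}_{\mu\nu\lambda}\sum_{M_4=n-1}(-1)^{M_3}\mathfrak{h}_{m_1}^{\mu\nu|||[2,M_1+1]}\mathfrak{h}_{m_2}^{\rho\sigma|||[M_1+2,M_2+1]}\mathfrak{h}_{m_3}^{\kappa\lambda|||[M_2+2,M_3+1]}\mathfrak{v}_{m_4}^{[M_3+2,n]},\\ {}_6\mathfrak{m}_n &= {}_6\widehat T_{\kappa\iota}\,\boldsymbol\Gamma^{[1]}_{\mu\nu\lambda}\boldsymbol\Gamma^{[2]}_{\rho\sigma\tau}\sum_{M_5=n-2}(-1)^{M_4}\mathfrak{h}_{m_1}^{\mu\nu|||[3,M_1+2]}\mathfrak{h}_{m_2}^{\rho\sigma|||[M_1+3,M_2+2]}\mathfrak{h}_{m_3}^{\kappa\lambda|||[M_2+3,M_3+2]}\mathfrak{h}_{m_4}^{\iota\tau|||[M_3+3,M_4+2]}\mathfrak{v}_{m_5}^{[M_4+3,n]},\\ {}_7\mathfrak{m}_n &= {}_7\widehat T_o\sum_{M_2=n}\tbinom{1/2}{m_1}\eta_{0\upsilon}\mathfrak{h}_{m_1}^{\upsilon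 o|||[1,M_1]}\mathfrak{v}_{m_2}^{[M_1+1,n]},\\ {}_8\mathfrak{m}_n &= {}_8\widehat T_{o\rho r}\sum_{M_3=n}\tbinom{1/2}{m_1}\tbinom{-1/2}{m_2}\eta_{0\upsilon}\mathfrak{h}_{m_1}^{\upsilon o|||[1,M_1]}\mathfrak{h}_{m_2}^{\rho r|||[M_1+1,M_2]}\mathfrak{v}_{m_3}^{[M_2+1,n]},\\ {}_9\mathfrak{m}_n &= {}_9\widehat T_{orst}\sum_{M_5=n}\tbinom{1/2}{m_1}\tbinom{-1/2}{m_2}\tbinom{-1/2}{m_3}\tbinom{1/2}{m_4}\,\eta_{0\upsilon}\mathfrak{h}_{m_1}^{\upsilon o|||[1,M_1]}\mathfrak{h}_{m_2}^{\rho r|||[M_1+1,M_2]}\mathfrak{h}_{m_3}^{\sigma s|||[M_2+1,M_3]}\\&\qquad\times\eta_{\sigma\tau}(\mathfrak{h}'_{m_4})_\rho^{\tau t|||[M_3+1,M_4]}\,\mathfrak{v}_{m_5}^{[M_4+1,n]},\\ {}_{10}\mathfrak{m}_n &= {}_{10}\widehat T_{orst}\,\boldsymbol\Gamma^{[1]}_{\rho\sigma\tau}\sum_{M_5=n-1}\tbinom{1/2}{m_1}\tbinom{-1/2}{m_2}\tbinom{-1/2}{m_3}\tbinom{-1/2}{m_4}\,\eta_{0\upsilon}\mathfrak{h}_{m_1}^{\upsilon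 o|||[2,M_1+1]}\mathfrak{h}_{m_2}^{\rho r|||[M_1+2,M_2+1]}\mathfrak{h}_{m_3}^{\sigma s|||[M_2+2,M_3+1]}\\&\qquad\times\mathfrak{h}_{m_4}^{\tau t|||[M_3+2,M_4+1]}\,\mathfrak{v}_{m_5}^{[M_4+2,n]} \end{aligned}$$ (with ${}_k\mathfrak{m}_0=0$ for $k=4,5,6,10$ and ${}_6\mathfrak{m}_1=0$). The building blocks are, with $p_\rho = \eta_{\rho\sigma}p^\sigma$, $$\mathfrak{h}_n^{\mu\nu|||\mu_1\nu_1|\cdots|\mu_n\nu_n} = \varkappa^n\,\eta^{\mu\nu_1}\eta^{\mu_1\nu_2}\cdots\eta^{\mu_{n-1}\nu_n}\eta^{\mu_n\nu}\quad(\mathfrak{h}_0^{\mu\nu}=\eta^{\mu\nu}),$$ $$(\mathfrak{h}'_n)_\rho^{\mu\nu|||\mu_1\nu_1|\cdots|\mu_n\nu_n}(p_1,\dots,p_n) = \mathrm{i}\Big(\sum_{m=1}^np^m_\rho\Big)\mathfrak{h}_n^{\mu\nu|||\mu_1\nu_1|\cdots|\mu_n\nu_n},$$ $$\boldsymbol\Gamma^{\mu_1\nu_1}_{\mu\nu\rho}(p_1)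 = \frac{\mathrm{i}\varkappa}{4}\Big(p^1_\mu(\delta_\rho^{\mu_1}\delta_\nu^{\nu_1}+\delta_\nu^{\mu_1}\delta_\rho^{\nu_1})+p^1_\nu(\delta_\mu^{\mu_1}\delta_\rho^{\nu_1}+\delta_\rho^{\mu_1}\delta_\mu^{\nu_1})-p^1_\rho(\delta_\mu^{\mu_1}\delta_\nu^{\nu_1}+\delta_\nu^{\mu_1}\delta_\mu^{\nu_1})\Big),$$ $$\begin{aligned} \mathfrak{v}_n^{\mu_1\nu_1|\cdots|\mu_n\nu_n} &= \varkappa^n\sum_{\substack{i+j+k+l=n\\i\ge j\ge k\ge l\ge0}}\sum_{p=0}^{j-k}\sum_{q=0}^{k-l}\sum_{r=0}^{q}\sum_{s=0}^{l}\sum_{t=0}^{s}\sum_{u=0}^{t}\sum_{v=0}^{u}\tbinom{1/2}{i}\tbinom ij\tbinom jk\tbinom kl\tbinom{j-k}{p}\tbinom{k-l}{q}\tbinom qr\tbinom ls\tbinom st\tbinom tu\tbinom uv\\ &\times(-1)^{p+q-r+s-t+v}\,2^{-j-2l+r+s+2t-3u+v}\,3^{-k+q-r+s-t+u}\\ &\times\prod_{a=1}^{A}\eta^{\mu_a\nu_a}\prod_{b=A+1}^{A+B}\eta^{\mu_b\mu_{b+B}}\eta^{\nu_b\nu_{b+B}}\prod_{c=A+2B+1}^{A+2B+C}\eta^{\mu_c\nu_{c+C}}\eta^{\mu_{c+C}\nu_{c+2C}}\eta^{\mu_{c+2C}\nu_c}\\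 &\times\prod_{d=A+2B+3C+1}^{A+2B+3C+D}\eta^{\mu_d\nu_{d+D}}\eta^{\mu_{d+D}\nu_{d+2D}}\eta^{\mu_{d+2D}\nu_{d+3D}}\eta^{\mu_{d+3D}\nu_d} \end{aligned}$$ with $A = i+j+k+l-2p-2q-r-2s-t-u$, $B = p+q-r+s-t+2u-2v$, $C = r+t-u$, $D = v$. -/

import Mathlib

open scoped Matrix Nat ContDiff

noncomputable section

namespace GravitonMatter

/-! ### Background Minkowski spacetime -/

/-- Points of Minkowski spacetime in the standard coordinates `x^0, …, x^3`. -/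
abbrev Spacetime := Fin 4 → ℝ

/-- Rank two tensors at a point.  Fields are complexified, so that plane waves are fields. -/
abbrev Tensor2 := Matrix (Fin 4) (Fin 4) ℂ

/-- Fields of rank two tensors (metrics, gravitons). -/
abbrev Field2 := Spacetime → Tensor2

/-- The Minkowski metric of signature `(+,-,-,-)`.  It is its own inverse, so `η μ ν` is both
the tensor with lower and the tensor with upper indices. -/
def η : Tensor2 := Matrix.diagonal ![1, -1, -1, -1]

/-- The Minkowski product `η(x, p)` of a point and a momentum (with upper indices). -/
def mink (x : Spacetime) (p : Fin 4 → ℂ) : ℂ := ∑ α, ∑ β, η α β * (x α : ℂ) * p β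

/-- The covariant components `p_ρ = η_{ρσ} p^σ` of a momentum. -/
def lower (p : Fin 4 → ℂ) (ρ : Fin 4) : ℂ := ∑ σ, η ρ σ * p σ

/-- The partial derivative `∂_ρ f`. -/
def pd (ρ : Fin 4) (f : Spacetime → ℂ) (x : Spacetime) : ℂ := fderiv ℝ f x (Pi.single ρ 1)

/-! ### Geometry of a metric -/

/-- The Christoffel symbol `Γ^τ_{μν}` of the Levi-Civita connection of `g`. -/
def christoffel (g : Field2) (x : Spacetime) (τ μ ν : Fin 4) : ℂ :=
  1 / 2 * ∑ κ, (g x)⁻¹ τ κ *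
    (pd μ (fun y => g y κ ν) x + pd ν (fun y => g y μ κ) x - pd κ (fun y => g y μ ν) x)

/-- The Riemannian volume density `√(-det g)` (principal branch), i.e. `dV_g` with respect to
`dt ∧ dx ∧ dy ∧ dz`. -/
def volDensity (g : Tensor2) : ℂ := (-g.det) ^ (1 / 2 : ℂ)

/-- The matrix `e m μ = e^m_μ` is a vielbein of `g`, i.e. `g_{μν} = η_{mn} e^m_μ e^n_ν`, in the
symmetric Lorentz gauge `e_{mμ} = e_{μm}` and on the principal branch (the eigenvalues of the
endomorphism `e` lie in the open right half plane). -/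
def IsSymmetricVielbein (g e : Tensor2) : Prop :=
  (∀ μ ν, g μ ν = ∑ m, ∑ n, η m n * e m μ * e n ν) ∧ (η * e).IsSymm ∧
    ∀ z ∈ spectrum ℂ e, 0 < z.re

open Classical in
/-- The symmetric vielbein `e^m_μ` of `g`. -/
def vielbein (g : Tensor2) : Tensor2 :=
  if h : ∃ e, IsSymmetricVielbein g e then h.choose else 0

/-- The inverse vielbein `e^μ_m = g^{μν} η_{mn} e^n_ν`. -/
def invVielbein (g : Tensor2) (μ m : Fin 4) : ℂ := ∑ ν, ∑ n, g⁻¹ μ ν * η m n * vielbein g n ν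

/-- The inverse vielbein with raised flat index, `e^{μ r} = η^{rm} e^μ_m`. -/
def invVielbeinUp (g : Tensor2) (μ r : Fin 4) : ℂ := ∑ m, η r m * invVielbein g μ m

/-! ### The ten matter-model Lagrange densities

They are given as coefficients of `dV_η = dt ∧ dx ∧ dy ∧ dz`; `T` is the field of matter
tensors. -/

/-- A Lagrange density as a functional of the metric. -/
abbrev Lagrangian := Field2 → Spacetime → ℂ

def lagrangian1 (T : Spacetime → ℂ) : Lagrangian := fun g x =>
  T x * volDensity (g x)

def lagrangian2 (T : Spacetime → Fin 4 → Fin 4 → ℂ) : Lagrangian := fun g x =>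
  (∑ μ, ∑ ν, (g x)⁻¹ μ ν * T x μ ν) * volDensity (g x)

def lagrangian3 (T : Spacetime → Fin 4 → Fin 4 → Fin 4 → Fin 4 → ℂ) : Lagrangian := fun g x =>
  (∑ μ, ∑ ν, ∑ ρ, ∑ σ, (g x)⁻¹ μ ν * (g x)⁻¹ ρ σ * T x μ ν ρ σ) * volDensity (g x)

def lagrangian4 (T : Spacetime → Fin 4 → ℂ) : Lagrangian := fun g x =>
  (∑ μ, ∑ ν, ∑ τ, (g x)⁻¹ μ ν * christoffel g x τ μ ν * T x τ) * volDensity (g x)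

def lagrangian5 (T : Spacetime → Fin 4 → Fin 4 → Fin 4 → ℂ) : Lagrangian := fun g x =>
  (∑ μ, ∑ ν, ∑ ρ, ∑ σ, ∑ τ, (g x)⁻¹ μ ν * (g x)⁻¹ ρ σ * christoffel g x τ μ ν * T x ρ σ τ) *
    volDensity (g x)

def lagrangian6 (T : Spacetime → Fin 4 → Fin 4 → ℂ) : Lagrangian := fun g x =>
  (∑ μ, ∑ ν, ∑ ρ, ∑ σ, ∑ κ, ∑ l, (g x)⁻¹ μ ν * (g x)⁻¹ ρ σ *
    christoffel g x κ μ ν * christoffel g x l ρ σ * T x κ l) * volDensity (g x)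

def lagrangian7 (T : Spacetime → Fin 4 → ℂ) : Lagrangian := fun g x =>
  (∑ o, vielbein (g x) o 0 * T x o) * volDensity (g x)

def lagrangian8 (T : Spacetime → Fin 4 → Fin 4 → Fin 4 → ℂ) : Lagrangian := fun g x =>
  (∑ o, ∑ ρ, ∑ r, vielbein (g x) o 0 * invVielbeinUp (g x) ρ r * T x o ρ r) * volDensity (g x)

def lagrangian9 (T : Spacetime → Fin 4 → Fin 4 → Fin 4 → Fin 4 → ℂ) : Lagrangian := fun g x =>
  (∑ o, ∑ ρ, ∑ r, ∑ σ, ∑ s, ∑ t, vielbein (g x) o 0 * invVielbeinUp (g x) ρ r *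
    invVielbeinUp (g x) σ s * pd ρ (fun y => vielbein (g y) t σ) x * T x o r s t) *
    volDensity (g x)

def lagrangian10 (T : Spacetime → Fin 4 → Fin 4 → Fin 4 → Fin 4 → ℂ) : Lagrangian := fun g x =>
  (∑ o, ∑ ρ, ∑ r, ∑ σ, ∑ s, ∑ τ, ∑ t, vielbein (g x) o 0 * invVielbeinUp (g x) ρ r *
    invVielbeinUp (g x) σ s * vielbein (g x) t τ * christoffel g x τ ρ σ * T x o r s t) *
    volDensity (g x)

/-! ### Vertex Feynman rules -/

/-- The grade-`m` part in `ϰ`, at the graviton field `h`, of the Lagrange density `L` of the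
metric `g = η + ϰ h`. -/
def gradePart (ϰ : ℝ) (L : Lagrangian) (m : ℕ) (h : Field2) (x : Spacetime) : ℂ :=
  (ϰ : ℂ) ^ m / (m ! : ℂ) * iteratedDeriv m (fun s : ℝ => L (fun y => η + (s : ℂ) • h y) x) 0

/-- An external graviton: its pair of (upper) indices and its incoming momentum `p^σ`. -/
structure Leg where
  μ : Fin 4
  ν : Fin 4
  p : Fin 4 → ℂ

instance : Inhabited Leg := ⟨⟨0, 0, 0⟩⟩

/-- The leg with its two indices interchanged. -/
def Leg.swap (a : Leg) : Leg := ⟨a.ν, a.μ, a.p⟩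

/-- The plane wave with the momentum of the leg and the symmetrized unit polarization.  The
derivative in direction of this field is the symmetrized functional derivative by
`ĥ_{μν}(p)`. -/
def Leg.wave (a : Leg) : Field2 := fun x => Matrix.of fun α β =>
  1 / 2 * ((if α = a.μ ∧ β = a.ν then 1 else 0) + (if α = a.ν ∧ β = a.μ then 1 else 0)) *
    Complex.exp (Complex.I * mink x a.p)

/-- The matter tensor field that is a plane wave with momentum `q` and amplitude `T`. -/
def matterWave {V : Type*} [SMul ℂ V] (q : Fin 4 → ℂ) (T : V) : Spacetime → V :=
  fun x => Complex.exp (Complex.I * mink x q) • T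

/-- The combination `∑ j, t_j h_j` of the plane waves of the `n` gravitons. -/
def superposition {n : ℕ} (leg : Fin n → Leg) (t : Fin n → ℝ) : Field2 :=
  fun y => ∑ j, (t j : ℂ) • (leg j).wave y

/-- `M` is the graviton-matter `n`-point vertex Feynman rule of the Lagrange density `L`,
contracted with the amplitude of the matter tensor in `L` (a plane wave of momentum `q`), for the
gravitons `leg 0, …, leg (n - 1)`: `L` has an expansion in powers of `ϰ`, and `i` times the
functional derivative of its grade-`n` part by the `n` distinguishable gravitons exists and is
`M` times the plane wave of the total momentum. -/
def HasVertexRule (ϰ : ℝ) (L : Lagrangian) {n : ℕ} (leg : Fin n → Leg) (q : Fin 4 → ℂ)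
    (M : ℂ) : Prop :=
  (∀ h : Field2, (∀ y, (h y).IsSymm) → (∀ α β, ContDiff ℝ ∞ fun y => h y α β) →
    ∀ x, AnalyticAt ℝ (fun s : ℝ => L (fun y => η + (s : ℂ) • h y) x) 0) ∧
  ∀ x, ContDiff ℝ ∞ (fun t : Fin n → ℝ => gradePart ϰ L n (superposition leg t) x) ∧
    Complex.I * iteratedFDeriv ℝ n
        (fun t : Fin n → ℝ => gradePart ϰ L n (superposition leg t) x) 0
        (fun j => Pi.single j 1) =
      M * Complex.exp (Complex.I * mink x (q + ∑ j, (leg j).p))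

/-! ### Building blocks

A sequence `a : ℕ → Leg` lists the gravitons, `a 0` being the first one, `a 1` the second one,
and so on.  Each block uses only a stretch at the beginning of its sequence. -/

/-- The sequence without its first `k` members. -/
def skip (k : ℕ) (a : ℕ → Leg) : ℕ → Leg := fun i => a (k + i)

/-- `𝔥_n^{μν ⫴ μ₁ν₁ | ⋯ | μₙνₙ} = ϰ^n η^{μ ν₁} η^{μ₁ ν₂} ⋯ η^{μₙ ν}`. -/
def hBlock (ϰ : ℝ) (n : ℕ) (μ ν : Fin 4) (a : ℕ → Leg) : ℂ :=
  (ϰ : ℂ) ^ n * ∏ i ∈ Finset.range (n + 1),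
    η (if i = 0 then μ else (a (i - 1)).μ) (if i = n then ν else (a i).ν)

/-- `(𝔥'_n)_ρ^{μν ⫴ μ₁ν₁ | ⋯ | μₙνₙ}(p₁, …, pₙ) = i (p₁ + ⋯ + pₙ)_ρ 𝔥_n^{μν ⫴ μ₁ν₁ | ⋯ | μₙνₙ}`. -/
def hBlock' (ϰ : ℝ) (n : ℕ) (ρ μ ν : Fin 4) (a : ℕ → Leg) : ℂ :=
  Complex.I * (∑ m ∈ Finset.range n, lower (a m).p ρ) * hBlock ϰ n μ ν a

/-- The Kronecker symbol. -/
def δ (α β : Fin 4) : ℂ := if α = β then 1 else 0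

/-- `𝚪^{μ₁ν₁}_{μνρ}(p₁)`, the Feynman rule of `Γ_{μνρ} = g_{ρσ} Γ^σ_{μν}`. -/
def ΓBlock (ϰ : ℝ) (μ ν ρ : Fin 4) (a : Leg) : ℂ :=
  Complex.I * (ϰ : ℂ) / 4 *
    (lower a.p μ * (δ ρ a.μ * δ ν a.ν + δ ν a.μ * δ ρ a.ν)
      + lower a.p ν * (δ μ a.μ * δ ρ a.ν + δ ρ a.μ * δ μ a.ν)
      - lower a.p ρ * (δ μ a.μ * δ ν a.ν + δ ν a.μ * δ μ a.ν))

/-- The product of `A` one-cycles, `B` two-cycles, `C` three-cycles and `D` four-cycles of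
Minkowski metrics that occurs in `𝔳_n`. -/
def cycles (A B C D : ℕ) (l : ℕ → Leg) : ℂ :=
  (∏ a ∈ Finset.range A, η (l a).μ (l a).ν) *
  (∏ b ∈ Finset.Ico A (A + B), η (l b).μ (l (b + B)).μ * η (l b).ν (l (b + B)).ν) *
  (∏ c ∈ Finset.Ico (A + 2 * B) (A + 2 * B + C),
    η (l c).μ (l (c + C)).ν * η (l (c + C)).μ (l (c + 2 * C)).ν * η (l (c + 2 * C)).μ (l c).ν) *
  (∏ d ∈ Finset.Ico (A + 2 * B + 3 * C) (A + 2 * B + 3 * C + D),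
    η (l d).μ (l (d + D)).ν * η (l (d + D)).μ (l (d + 2 * D)).ν *
      η (l (d + 2 * D)).μ (l (d + 3 * D)).ν * η (l (d + 3 * D)).μ (l d).ν)

/-- `𝔳_n^{μ₁ν₁ | ⋯ | μₙνₙ}`, the unsymmetrized Feynman rule of `√(-det g)`.  In the ranges of
summation none of the differences of natural numbers is truncated. -/
def vBlock (ϰ : ℝ) (n : ℕ) (a : ℕ → Leg) : ℂ :=
  (ϰ : ℂ) ^ n *
    ∑ w ∈ (Finset.Nat.antidiagonalTuple 4 n).filter (fun w => w 1 ≤ w 0 ∧ w 2 ≤ w 1 ∧ w 3 ≤ w 2),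
      (fun i j k l : ℕ =>
        ∑ p ∈ Finset.range (j - k + 1), ∑ q ∈ Finset.range (k - l + 1),
        ∑ r ∈ Finset.range (q + 1), ∑ s ∈ Finset.range (l + 1), ∑ t ∈ Finset.range (s + 1),
        ∑ u ∈ Finset.range (t + 1), ∑ v ∈ Finset.range (u + 1),
          Ring.choose (1 / 2 : ℂ) i * (i.choose j : ℂ) * (j.choose k : ℂ) * (k.choose l : ℂ) *
            ((j - k).choose p : ℂ) * ((k - l).choose q : ℂ) * (q.choose r : ℂ) *
            (l.choose s : ℂ) * (s.choose t : ℂ) * (t.choose u : ℂ) * (u.choose v : ℂ) *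
          (-1 : ℂ) ^ ((p : ℤ) + q - r + s - t + v) *
          (2 : ℂ) ^ (-(j : ℤ) - 2 * l + r + s + 2 * t - 3 * u + v) *
          (3 : ℂ) ^ (-(k : ℤ) + q - r + s - t + u) *
          cycles (i + j + k + l - 2 * p - 2 * q - r - 2 * s - t - u)
            (p + q - r + s - t + 2 * u - 2 * v) (r + t - u) v a)
        (w 0) (w 1) (w 2) (w 3)

/-! ### The unsymmetrized vertex Feynman rules of the ten types -/

open Finset.Nat (antidiagonalTuple)

def rule1 (ϰ : ℝ) (T : ℂ) (n : ℕ) (a : ℕ → Leg) : ℂ := T * vBlock ϰ n a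

def rule2 (ϰ : ℝ) (T : Fin 4 → Fin 4 → ℂ) (n : ℕ) (a : ℕ → Leg) : ℂ :=
  ∑ μ, ∑ ν, T μ ν * ∑ m ∈ antidiagonalTuple 2 n,
    (-1) ^ m 0 * hBlock ϰ (m 0) μ ν a * vBlock ϰ (m 1) (skip (m 0) a)

def rule3 (ϰ : ℝ) (T : Fin 4 → Fin 4 → Fin 4 → Fin 4 → ℂ) (n : ℕ) (a : ℕ → Leg) : ℂ :=
  ∑ μ, ∑ ν, ∑ ρ, ∑ σ, T μ ν ρ σ * ∑ m ∈ antidiagonalTuple 3 n,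
    (-1) ^ (m 0 + m 1) * hBlock ϰ (m 0) μ ν a * hBlock ϰ (m 1) ρ σ (skip (m 0) a) *
      vBlock ϰ (m 2) (skip (m 0 + m 1) a)

/-- The Christoffel symbol takes the first graviton; there is no rule without gravitons. -/
def rule4 (ϰ : ℝ) (T : Fin 4 → ℂ) : ℕ → (ℕ → Leg) → ℂ
  | 0, _ => 0
  | n + 1, a => ∑ μ, ∑ ν, ∑ ρ, ∑ σ, T ρ * ΓBlock ϰ μ ν σ (a 0) *
      ∑ m ∈ antidiagonalTuple 3 n,
        (-1) ^ (m 0 + m 1) * hBlock ϰ (m 0) μ ν (skip 1 a) *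
          hBlock ϰ (m 1) ρ σ (skip (m 0 + 1) a) * vBlock ϰ (m 2) (skip (m 0 + m 1 + 1) a)

def rule5 (ϰ : ℝ) (T : Fin 4 → Fin 4 → Fin 4 → ℂ) : ℕ → (ℕ → Leg) → ℂ
  | 0, _ => 0
  | n + 1, a => ∑ μ, ∑ ν, ∑ ρ, ∑ σ, ∑ κ, ∑ l, T ρ σ κ * ΓBlock ϰ μ ν l (a 0) *
      ∑ m ∈ antidiagonalTuple 4 n,
        (-1) ^ (m 0 + m 1 + m 2) * hBlock ϰ (m 0) μ ν (skip 1 a) *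
          hBlock ϰ (m 1) ρ σ (skip (m 0 + 1) a) *
          hBlock ϰ (m 2) κ l (skip (m 0 + m 1 + 1) a) *
          vBlock ϰ (m 3) (skip (m 0 + m 1 + m 2 + 1) a)

/-- The two Christoffel symbols take the first two gravitons. -/
def rule6 (ϰ : ℝ) (T : Fin 4 → Fin 4 → ℂ) : ℕ → (ℕ → Leg) → ℂ
  | 0, _ => 0
  | 1, _ => 0
  | n + 2, a => ∑ μ, ∑ ν, ∑ l, ∑ ρ, ∑ σ, ∑ τ, ∑ κ, ∑ ι,
      T κ ι * ΓBlock ϰ μ ν l (a 0) * ΓBlock ϰ ρ σ τ (a 1) *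
      ∑ m ∈ antidiagonalTuple 5 n,
        (-1) ^ (m 0 + m 1 + m 2 + m 3) * hBlock ϰ (m 0) μ ν (skip 2 a) *
          hBlock ϰ (m 1) ρ σ (skip (m 0 + 2) a) *
          hBlock ϰ (m 2) κ l (skip (m 0 + m 1 + 2) a) *
          hBlock ϰ (m 3) ι τ (skip (m 0 + m 1 + m 2 + 2) a) *
          vBlock ϰ (m 4) (skip (m 0 + m 1 + m 2 + m 3 + 2) a)

def rule7 (ϰ : ℝ) (T : Fin 4 → ℂ) (n : ℕ) (a : ℕ → Leg) : ℂ :=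
  ∑ o, ∑ υ, T o * ∑ m ∈ antidiagonalTuple 2 n,
    Ring.choose (1 / 2 : ℂ) (m 0) * (η 0 υ * hBlock ϰ (m 0) υ o a) *
      vBlock ϰ (m 1) (skip (m 0) a)

def rule8 (ϰ : ℝ) (T : Fin 4 → Fin 4 → Fin 4 → ℂ) (n : ℕ) (a : ℕ → Leg) : ℂ :=
  ∑ o, ∑ ρ, ∑ r, ∑ υ, T o ρ r * ∑ m ∈ antidiagonalTuple 3 n,
    Ring.choose (1 / 2 : ℂ) (m 0) * Ring.choose (-1 / 2 : ℂ) (m 1) *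
      (η 0 υ * hBlock ϰ (m 0) υ o a) * hBlock ϰ (m 1) ρ r (skip (m 0) a) *
      vBlock ϰ (m 2) (skip (m 0 + m 1) a)

def rule9 (ϰ : ℝ) (T : Fin 4 → Fin 4 → Fin 4 → Fin 4 → ℂ) (n : ℕ) (a : ℕ → Leg) : ℂ :=
  ∑ o, ∑ r, ∑ s, ∑ t, ∑ υ, ∑ ρ, ∑ σ, ∑ τ, T o r s t * ∑ m ∈ antidiagonalTuple 5 n,
    Ring.choose (1 / 2 : ℂ) (m 0) * Ring.choose (-1 / 2 : ℂ) (m 1) *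
      Ring.choose (-1 / 2 : ℂ) (m 2) * Ring.choose (1 / 2 : ℂ) (m 3) *
      (η 0 υ * hBlock ϰ (m 0) υ o a) * hBlock ϰ (m 1) ρ r (skip (m 0) a) *
      hBlock ϰ (m 2) σ s (skip (m 0 + m 1) a) *
      (η σ τ * hBlock' ϰ (m 3) ρ τ t (skip (m 0 + m 1 + m 2) a)) *
      vBlock ϰ (m 4) (skip (m 0 + m 1 + m 2 + m 3) a)

def rule10 (ϰ : ℝ) (T : Fin 4 → Fin 4 → Fin 4 → Fin 4 → ℂ) : ℕ → (ℕ → Leg) → ℂ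
  | 0, _ => 0
  | n + 1, a => ∑ o, ∑ r, ∑ s, ∑ t, ∑ υ, ∑ ρ, ∑ σ, ∑ τ,
      T o r s t * ΓBlock ϰ ρ σ τ (a 0) * ∑ m ∈ antidiagonalTuple 5 n,
        Ring.choose (1 / 2 : ℂ) (m 0) * Ring.choose (-1 / 2 : ℂ) (m 1) *
          Ring.choose (-1 / 2 : ℂ) (m 2) * Ring.choose (-1 / 2 : ℂ) (m 3) *
          (η 0 υ * hBlock ϰ (m 0) υ o (skip 1 a)) * hBlock ϰ (m 1) ρ r (skip (m 0 + 1) a) *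
          hBlock ϰ (m 2) σ s (skip (m 0 + m 1 + 1) a) *
          hBlock ϰ (m 3) τ t (skip (m 0 + m 1 + m 2 + 1) a) *
          vBlock ϰ (m 4) (skip (m 0 + m 1 + m 2 + m 3 + 1) a)

/-! ### Symmetrization -/

/-- The gravitons in the order `s`, those in `S` with their two indices interchanged.  Members
of the sequence beyond the `n`-th one are irrelevant. -/
def arrange {n : ℕ} (leg : Fin n → Leg) (S : Finset (Fin n)) (s : Equiv.Perm (Fin n)) : ℕ → Leg :=
  fun i => if h : i < n then
    (if s ⟨i, h⟩ ∈ S then (leg (s ⟨i, h⟩)).swap else leg (s ⟨i, h⟩)) else default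

/-- `i / 2^n ∑_{μᵢ ↔ νᵢ} ∑_{s ∈ Sₙ}` of an unsymmetrized Feynman rule. -/
def symmetrized (rule : ℕ → (ℕ → Leg) → ℂ) {n : ℕ} (leg : Fin n → Leg) : ℂ :=
  Complex.I / 2 ^ n * ∑ S : Finset (Fin n), ∑ s : Equiv.Perm (Fin n), rule n (arrange leg S s)

end GravitonMatter

end

open GravitonMatter

/-! Both sides of each rule are coefficients of power series, and the proof shows that these series
agree before any functional derivative is taken.

On the side of the Lagrange density, fix a symmetric `h` and follow each factor along the line `η +
s h`. With `Y = η h`, the inverse metric is `(1 + sY)⁻¹ η`, the vielbein is `(1 + sY)^{1/2}`, the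
inverse vielbein with raised index is `(1 + sY)^{-1/2} η`, the volume density is `√det(1 + sY)`, and
a Christoffel symbol is the inverse metric times `s` times a linear expression in `∂h`. Analyticity
gives each of them some Taylor series; an algebraic equation then determines it: a series with
constant term `1` is fixed by its square (`series_eq_of_sq_eq`), and the derivative of the vielbein
by the linearized equation (`hasTaylor_fderiv_sqrt`). The vielbein, defined by choice, is the
analytic root near `η` because a root with spectrum in the right half plane is unique
(`eq_of_sq_eq_of_re_pos`). The coefficients of the volume density come from Newton's identities and
repeated binomial expansions (`det_one_add`, `coeff_volSeries`).

On the side of the Feynman rules, an unsymmetrized rule is a function on words whose letters are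
gravitons. Its sum over all words of length `n`, weighted by plane waves, is the `n`-th coefficient
of a generating series. Concatenation of rules becomes multiplication of series
(`genSeries_concat`), summing over a letter contracts with the graviton field, and a derivative
multiplies a word by `i` times its total momentum (`pd_wordSum`). Hence each building block
generates the Taylor series of its geometric factor, rescaled by `ϰ`.

Consequently the grade-`n` part at a superposition of plane waves is the diagonal of a multilinear
form in the coefficients `t`. Its `n`-th derivative is the sum of the form over all permutations of
its arguments, and taking every graviton with both index orders at weight `1/2` gives the sum over
index interchanges with its factor `2^{-n}` (`hasVertexRule_of_taylor`). -/

namespace GravitonMatter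

open PowerSeries Filter Topology

/-! ### Taylor expansions at the origin -/

/-- `f` is analytic at `0`, and `c` is its Taylor series there. -/
structure HasTaylor {A : Type*} [NormedRing A] [NormedAlgebra ℝ A] (f : ℝ → A) (c : A⟦X⟧) :
    Prop where
  analytic : AnalyticAt ℝ f 0
  deriv_eq : ∀ n, iteratedDeriv n f 0 = (n ! : ℝ) • coeff n c

namespace HasTaylor

variable {A : Type*} [NormedRing A] [NormedAlgebra ℝ A] {f g : ℝ → A} {c d : A⟦X⟧}

/-- Together with `unique` this splits the later computations: analyticity supplies some series, and
an equation between functions becomes an equation that identifies it. -/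
theorem exists_of_analyticAt (hf : AnalyticAt ℝ f 0) : ∃ c, HasTaylor f c :=
  ⟨PowerSeries.mk fun n => (n ! : ℝ)⁻¹ • iteratedDeriv n f 0, hf, fun n => by
    rw [coeff_mk, smul_inv_smul₀ (by exact_mod_cast n.factorial_ne_zero)]⟩

theorem unique (h : HasTaylor f c) (h' : HasTaylor f d) : c = d := by
  ext n
  have := (h.deriv_eq n).symm.trans (h'.deriv_eq n)
  exact smul_right_injective A (show (n ! : ℝ) ≠ 0 by exact_mod_cast n.factorial_ne_zero) this

theorem congr (h : HasTaylor f c) (hfg : f =ᶠ[𝓝 0] g) : HasTaylor g c :=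
  ⟨h.analytic.congr hfg, fun n => by rw [← hfg.iteratedDeriv_eq, h.deriv_eq]⟩

theorem const (a : A) : HasTaylor (fun _ => a) (C a) :=
  ⟨analyticAt_const, fun n => by
    rw [iteratedDeriv_const, coeff_C]
    split_ifs with h <;> simp [h]⟩

theorem zero : HasTaylor (fun _ => (0 : A)) 0 := by
  simpa using const (0 : A)

theorem zero_eq (h : HasTaylor f c) : coeff 0 c = f 0 := by
  simpa using (h.deriv_eq 0).symm

theorem smul_const (a : A) : HasTaylor (fun s : ℝ => s • a) (X * C a) := by
  refine ⟨analyticAt_id.smul analyticAt_const, fun n => ?_⟩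
  obtain _ | n := n
  · simp
  have h : deriv (fun s : ℝ => s • a) = fun _ => a := by
    funext s
    simpa using ((hasDerivAt_id s).smul_const a).deriv
  rw [iteratedDeriv_succ', h, iteratedDeriv_const, coeff_succ_X_mul, coeff_C]
  split_ifs with hn <;> simp [hn]

variable [CompleteSpace A]

theorem contDiffAt (h : HasTaylor f c) {n : ℕ∞ω} : ContDiffAt ℝ n f 0 :=
  h.analytic.contDiffAt

theorem add (hf : HasTaylor f c) (hg : HasTaylor g d) :
    HasTaylor (fun s => f s + g s) (c + d) :=
  ⟨hf.analytic.fun_add hg.analytic, fun n => by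
    rw [iteratedDeriv_fun_add hf.contDiffAt hg.contDiffAt, hf.deriv_eq, hg.deriv_eq, map_add,
      smul_add]⟩

/-- The binomial coefficients of the Leibniz rule turn `i! j!` into `n!`. The order of the factors
is kept, since the ring will be a matrix ring. -/
theorem mul (hf : HasTaylor f c) (hg : HasTaylor g d) :
    HasTaylor (fun s => f s * g s) (c * d) :=
  ⟨hf.analytic.fun_mul hg.analytic, fun n => by
    rw [iteratedDeriv_fun_mul hf.contDiffAt hg.contDiffAt, coeff_mul, Finset.smul_sum,
      Finset.Nat.sum_antidiagonal_eq_sum_range_succ_mk]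
    refine Finset.sum_congr rfl fun i hi => ?_
    have hin : i ≤ n := Nat.lt_succ_iff.mp (Finset.mem_range.mp hi)
    rw [hf.deriv_eq, hg.deriv_eq, ← nsmul_eq_mul, smul_mul_assoc, smul_mul_assoc, mul_smul_comm,
      ← Nat.choose_mul_factorial_mul_factorial hin, ← Nat.cast_smul_eq_nsmul ℝ, smul_smul,
      smul_smul]
    push_cast
    ring_nf⟩

theorem sum {ι : Type*} (I : Finset ι) {f : ι → ℝ → A} {c : ι → A⟦X⟧}
    (h : ∀ i ∈ I, HasTaylor (f i) (c i)) :
    HasTaylor (fun s => ∑ i ∈ I, f i s) (∑ i ∈ I, c i) := by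
  classical
  induction I using Finset.induction_on with
  | empty => simpa using zero
  | insert a I ha ih =>
    simp only [Finset.sum_insert ha]
    exact (h a (by simp)).add (ih fun i hi => h i (by simp [hi]))

theorem clm {B : Type*} [NormedRing B] [NormedAlgebra ℝ B]
    (L : A →L[ℝ] B) (hf : HasTaylor f c) :
    HasTaylor (fun s => L (f s)) (PowerSeries.mk fun n => L (coeff n c)) :=
  ⟨L.analyticAt _ |>.comp hf.analytic, fun n => by
    have := L.iteratedFDeriv_comp_left (hf.contDiffAt (n := n)) le_rfl
    rw [coeff_mk, ← map_smul, ← hf.deriv_eq, iteratedDeriv, iteratedDeriv]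
    exact congrArg (fun m => m fun _ => 1) this⟩

end HasTaylor

/-- A power series of matrices as a matrix of power series. -/
noncomputable def matSeries (c : ℕ → Tensor2) (i j : Fin 4) : ℂ⟦X⟧ :=
  PowerSeries.mk fun n => c n i j

attribute [local instance] Matrix.linftyOpNormedRing Matrix.linftyOpNormedAlgebra

/-- The matrix entries as continuous linear maps. -/
noncomputable def entryCLM (i j : Fin 4) : Tensor2 →L[ℝ] ℂ :=
  LinearMap.toContinuousLinearMap (Matrix.entryLinearMap ℝ ℂ i j)

theorem analyticAt_matrix {E : Type*} [NormedAddCommGroup E] [NormedSpace ℝ E] {f : E → Tensor2}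
    {x : E} (h : ∀ i j, AnalyticAt ℝ (fun y => f y i j) x) : AnalyticAt ℝ f x := by
  have : f = fun y => ∑ i, ∑ j, (f y i j) • (Matrix.single i j (1 : ℂ)) := by
    funext y
    conv_lhs => rw [Matrix.matrix_eq_sum_single (f y)]
    simp [Matrix.smul_single]
  rw [this]
  exact Finset.analyticAt_fun_sum _ fun i _ => Finset.analyticAt_fun_sum _ fun j _ =>
    (h i j).smul analyticAt_const

theorem HasTaylor.entry {f : ℝ → Tensor2} {c : Tensor2⟦X⟧} (h : HasTaylor f c) (i j : Fin 4) :
    HasTaylor (fun s => f s i j) (matSeries (fun n => coeff n c) i j) :=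
  h.clm (entryCLM i j)

end GravitonMatter

namespace GravitonMatter

open PowerSeries Filter Topology

attribute [local instance] Matrix.linftyOpNormedRing Matrix.linftyOpNormedAlgebra

/-! ### Principal square roots of matrices -/

/-- Sylvester's theorem: `A X + X B = 0` has only the trivial solution if the spectra of `A` and
`-B` are disjoint. -/
theorem eq_zero_of_sylvester {n : Type*} [Fintype n] [Nonempty n] [DecidableEq n]
    {A B D : Matrix n n ℂ}
    (hAB : ∀ z ∈ spectrum ℂ A, -z ∉ spectrum ℂ B) (h : A * D + D * B = 0) : D = 0 := by
  have hAD : A * D = D * (-B) := by rw [mul_neg]; exact eq_neg_of_add_eq_zero_left h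
  -- `D` intertwines `A` and `-B`, hence all polynomials in them. For the characteristic polynomial
  -- of `-B` the right side vanishes by Cayley–Hamilton, while on the left the factor is invertible
  -- because no eigenvalue of `A` is a root.
  have hp : ∀ p : Polynomial ℂ, Polynomial.aeval A p * D = D * Polynomial.aeval (-B) p := by
    intro p
    induction p using Polynomial.induction_on with
    | C a => simp [Algebra.algebraMap_eq_smul_one]
    | add p q hp hq => simp [add_mul, mul_add, hp, hq]
    | monomial k a ih =>
      have e : ∀ M : Matrix n n ℂ, Polynomial.aeval M (Polynomial.C a * Polynomial.X ^ (k + 1)) =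
          Polynomial.aeval M (Polynomial.C a * Polynomial.X ^ k) * M := fun M => by
        rw [pow_succ, ← mul_assoc, map_mul, Polynomial.aeval_X]
      rw [e, e, mul_assoc, hAD, ← mul_assoc, ih, mul_assoc]
  have h0 : Polynomial.aeval A (-B).charpoly * D = 0 := by
    rw [hp, Matrix.aeval_self_charpoly, mul_zero]
  have hu : IsUnit (Polynomial.aeval A (-B).charpoly) := by
    rw [← spectrum.zero_notMem_iff ℂ, spectrum.map_polynomial_aeval_of_degree_pos]
    · rintro ⟨z, hz, hz0⟩
      refine hAB z hz ?_
      have hz' : z ∈ spectrum ℂ (-B) := Matrix.mem_spectrum_iff_isRoot_charpoly.mpr hz0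
      rw [← spectrum.neg_eq] at hz'
      simpa using hz'
    · rw [Matrix.charpoly_degree_eq_dim]
      exact_mod_cast Fintype.card_pos
  exact hu.mul_right_eq_zero.mp h0

/-- Even without commutativity, `A(A - B) + (A - B)B = A² - B²`. This is a Sylvester equation for `A
- B`, and the half-plane conditions separate the spectra of `A` and `-B`. -/
theorem eq_of_sq_eq_of_re_pos {n : Type*} [Fintype n] [Nonempty n] [DecidableEq n]
    {A B : Matrix n n ℂ}
    (hA : ∀ z ∈ spectrum ℂ A, 0 < z.re) (hB : ∀ z ∈ spectrum ℂ B, 0 < z.re)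
    (h : A * A = B * B) : A = B := by
  refine sub_eq_zero.mp (eq_zero_of_sylvester (A := A) (B := B) (fun z hz hz' => ?_) ?_)
  · have h1 := hA z hz
    have h2 := hB _ hz'
    rw [Complex.neg_re] at h2
    linarith
  · rw [mul_sub, sub_mul, h]
    abel

/-- The square root near the identity is analytic. -/
theorem exists_analytic_sqrt : ∃ S : Tensor2 → Tensor2, AnalyticAt ℝ S 1 ∧ S 1 = 1 ∧
    ∀ᶠ Y in 𝓝 (1 : Tensor2), S Y * S Y = Y := by
  let L : Tensor2 ≃L[ℝ] Tensor2 :=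
    ContinuousLinearEquiv.smulLeft (Units.mk0 (2 : ℝ) two_ne_zero)
  have hf : ContDiffAt ℝ ω (fun e : Tensor2 => e * e) 1 := by fun_prop
  -- At the identity the differential of squaring is multiplication by `2`, so the analytic inverse
  -- function theorem applies.
  have hf' : HasFDerivAt (fun e : Tensor2 => e * e) (L : Tensor2 →L[ℝ] Tensor2) 1 := by
    refine ((hasFDerivAt_id (𝕜 := ℝ) (1 : Tensor2)).mul' (hasFDerivAt_id _)).congr_fderiv ?_
    ext1 V
    change (1 : Tensor2) * V + V * 1 = (2 : ℝ) • V
    rw [one_mul, mul_one, two_smul]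
  have h1 : (1 : Tensor2) * 1 = 1 := mul_one 1
  have hn : (ω : ℕ∞ω) ≠ 0 := by simp
  refine ⟨hf.localInverse hf' hn, ?_, ?_, ?_⟩
  · have := (hf.to_localInverse hf' hn).analyticAt
    simpa [h1] using this
  · simpa [h1] using hf.localInverse_apply_image hf' hn
  · have := (hf.hasStrictFDerivAt' hf' hn).eventually_right_inverse
    rwa [h1] at this

/-- An analytic square root near the identity. -/
noncomputable def sqrtMat : Tensor2 → Tensor2 := exists_analytic_sqrt.choose

theorem analyticAt_sqrtMat : AnalyticAt ℝ sqrtMat 1 := exists_analytic_sqrt.choose_spec.1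

@[simp] theorem sqrtMat_one : sqrtMat 1 = 1 := exists_analytic_sqrt.choose_spec.2.1

theorem sqrtMat_mul_self : ∀ᶠ Y in 𝓝 (1 : Tensor2), sqrtMat Y * sqrtMat Y = Y :=
  exists_analytic_sqrt.choose_spec.2.2

/-- The eigenvalues of `e - 1` are bounded by its norm, so those of `e` lie in the open unit disc
around `1`. -/
theorem re_pos_of_norm_sub_one_lt {e : Tensor2} (he : ‖e - 1‖ < 1) :
    ∀ z ∈ spectrum ℂ e, 0 < z.re := by
  intro z hz
  have h1 : z - 1 ∈ spectrum ℂ (e - 1) := by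
    have := spectrum.sub_singleton_eq e (1 : ℂ)
    rw [map_one] at this
    rw [← this]
    exact Set.sub_mem_sub hz rfl
  have h2 : ‖z - 1‖ < 1 := by
    have := spectrum.norm_le_norm_mul_of_mem h1
    simp at this
    exact this.trans_lt he
  have h3 := (Complex.abs_re_le_norm (z - 1)).trans_lt h2
  rw [Complex.sub_re, Complex.one_re, abs_lt] at h3
  linarith

theorem eventually_re_pos : ∀ᶠ M in 𝓝 (1 : Tensor2), ∀ z ∈ spectrum ℂ M, 0 < z.re := by
  filter_upwards [Metric.ball_mem_nhds (1 : Tensor2) one_pos] with M hM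
  exact re_pos_of_norm_sub_one_lt (by rwa [← dist_eq_norm])

theorem tendsto_sqrtMat : Tendsto sqrtMat (𝓝 1) (𝓝 1) := by
  have h : Tendsto sqrtMat (𝓝 1) (𝓝 (sqrtMat 1)) := analyticAt_sqrtMat.continuousAt
  rwa [sqrtMat_one] at h

@[simp] theorem η_mul_η : η * η = 1 := by
  rw [η, Matrix.diagonal_mul_diagonal, ← Matrix.diagonal_one]
  congr 1
  funext i
  fin_cases i <;> simp

@[simp] theorem η_transpose : ηᵀ = η := Matrix.diagonal_transpose _

@[simp] theorem η_mul_η_assoc (M : Tensor2) : η * (η * M) = M := by rw [← mul_assoc, η_mul_η, one_mul]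

/-- The symmetric gauge says `eᵀ = η e η`, which turns the quadratic form equation `g = eᵀ η e` into
a square root problem for `η g`. -/
theorem isSymmetricVielbein_iff {g e : Tensor2} : IsSymmetricVielbein g e ↔
    e * e = η * g ∧ (η * e).IsSymm ∧ ∀ z ∈ spectrum ℂ e, 0 < z.re := by
  have h1 : (∀ μ ν, g μ ν = ∑ m, ∑ n, η m n * e m μ * e n ν) ↔ g = eᵀ * (η * e) := by
    rw [← Matrix.ext_iff]
    refine forall₂_congr fun μ ν => ?_
    have : (eᵀ * (η * e)) μ ν = ∑ m, ∑ n, η m n * e m μ * e n ν := by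
      simp only [Matrix.mul_apply, Matrix.transpose_apply, Finset.mul_sum]
      exact Finset.sum_congr rfl fun m _ => Finset.sum_congr rfl fun n _ => by ring
    rw [this]
  rw [IsSymmetricVielbein, h1]
  refine and_congr_left fun ⟨hs, _⟩ => ?_
  rw [Matrix.IsSymm, Matrix.transpose_mul, η_transpose] at hs
  have h2 : eᵀ = η * e * η := by rw [← hs, mul_assoc, η_mul_η, mul_one]
  rw [h2, mul_assoc, mul_assoc, η_mul_η_assoc]
  exact ⟨fun h => by rw [h, η_mul_η_assoc], fun h => by rw [h, η_mul_η_assoc]⟩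

/-- Near the Minkowski metric the symmetric vielbein is the analytic square root of `η g`. -/
theorem vielbein_eq_sqrtMat : ∀ᶠ g in 𝓝 η, g.IsSymm →
    IsSymmetricVielbein g (sqrtMat (η * g)) ∧ vielbein g = sqrtMat (η * g) := by
  have hc : Tendsto (fun g : Tensor2 => η * g) (𝓝 η) (𝓝 1) := by
    rw [← η_mul_η]
    exact (continuous_const.mul continuous_id).tendsto η
  -- For symmetric `g`, the matrix `η Sᵀ η` is another square root of `η g`. Being close to `1`, it
  -- too has spectrum in the right half plane, so it equals `S`; this is the gauge condition.
  have hc' : Tendsto (fun Y : Tensor2 => η * (sqrtMat Y)ᵀ * η) (𝓝 1) (𝓝 1) := by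
    have h2 : Continuous fun M : Tensor2 => η * Mᵀ * η :=
      (continuous_const.mul continuous_id.matrix_transpose).mul continuous_const
    have h3 := (h2.tendsto 1).comp tendsto_sqrtMat
    rwa [Matrix.transpose_one, mul_one, η_mul_η] at h3
  filter_upwards [hc.eventually sqrtMat_mul_self,
    hc.eventually (tendsto_sqrtMat.eventually eventually_re_pos),
    hc.eventually (hc'.eventually eventually_re_pos)] with g h1 h2 h3 hg
  have key : IsSymmetricVielbein g (sqrtMat (η * g)) := by
    rw [isSymmetricVielbein_iff]
    refine ⟨h1, ?_, h2⟩
    have := eq_of_sq_eq_of_re_pos h2 h3 (by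
      have ht := congrArg Matrix.transpose h1
      rw [Matrix.transpose_mul, Matrix.transpose_mul, η_transpose, hg.eq] at ht
      simp only [h1, mul_assoc, η_mul_η_assoc]
      rw [← mul_assoc (sqrtMat (η * g))ᵀ, ht, mul_assoc, η_mul_η, mul_one])
    rw [Matrix.IsSymm, Matrix.transpose_mul, η_transpose]
    conv_rhs => rw [this]
    rw [mul_assoc, η_mul_η_assoc]
  refine ⟨key, ?_⟩
  have hex : ∃ e, IsSymmetricVielbein g e := ⟨_, key⟩
  rw [vielbein, dif_pos hex]
  -- Whatever vielbein is chosen, it is a square root of `η g` in the half plane, and that root is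
  -- unique.
  have hch := isSymmetricVielbein_iff.mp hex.choose_spec
  exact eq_of_sq_eq_of_re_pos hch.2.2 h2 (by rw [hch.1, h1])

end GravitonMatter

namespace GravitonMatter

open PowerSeries Filter Topology

attribute [local instance] Matrix.linftyOpNormedRing Matrix.linftyOpNormedAlgebra

/-! ### Expansions of the geometric quantities -/

/-- A power series Sylvester equation with constant coefficients `1` has only the trivial
solution. -/
theorem series_eq_zero_of_sylvester {R : Type*} [Ring R] [Algebra ℂ R] {A B D : R⟦X⟧}
    (hA : coeff 0 A = 1) (hB : coeff 0 B = 1) (h : A * D + D * B = 0) : D = 0 := by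
  ext n
  induction n using Nat.strong_induction_on with
  | _ n ih =>
    -- With the lower coefficients of `D` already zero, only the constant terms of `A` and `B`
    -- contribute in degree `n`, and the equation becomes `2 dₙ = 0`.
    have h1 : coeff n (A * D) = coeff n D := by
      rw [coeff_mul, Finset.sum_eq_single (0, n), hA, one_mul]
      · rintro ⟨i, j⟩ hij hne
        rw [Finset.HasAntidiagonal.mem_antidiagonal] at hij
        rw [ih j (by grind), map_zero, mul_zero]
      · simp
    have h2 : coeff n (D * B) = coeff n D := by
      rw [coeff_mul, Finset.sum_eq_single (n, 0), hB, mul_one]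
      · rintro ⟨i, j⟩ hij hne
        rw [Finset.HasAntidiagonal.mem_antidiagonal] at hij
        rw [ih i (by grind), map_zero, zero_mul]
      · simp
    have h3 := congrArg (coeff n) h
    rw [map_add, h1, h2, map_zero, ← two_smul ℂ] at h3
    rw [map_zero]
    exact (two_ne_zero (α := ℂ)).isUnit.smul_eq_zero.mp h3

theorem series_eq_of_sq_eq {R : Type*} [Ring R] [Algebra ℂ R] {A B : R⟦X⟧}
    (hA : coeff 0 A = 1) (hB : coeff 0 B = 1) (h : A * A = B * B) : A = B := by
  refine sub_eq_zero.mp (series_eq_zero_of_sylvester hA hB ?_)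
  rw [mul_sub, sub_mul, h]
  abel

/-- The power series `∑ n, c n Y^n X^n`. -/
noncomputable def powSeries (c : ℕ → ℂ) (Y : Tensor2) : Tensor2⟦X⟧ :=
  PowerSeries.mk fun n => c n • Y ^ n

@[simp] theorem coeff_powSeries (c : ℕ → ℂ) (Y : Tensor2) (n : ℕ) :
    coeff n (powSeries c Y) = c n • Y ^ n := coeff_mk _ _

/-- Powers of a single `Y` commute, so this is the Vandermonde convolution, that is `(1 + XY)^a (1 +
XY)^b = (1 + XY)^{a+b}`. -/
theorem powSeries_mul (a b : ℂ) (Y : Tensor2) :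
    powSeries (Ring.choose a) Y * powSeries (Ring.choose b) Y = powSeries (Ring.choose (a + b)) Y := by
  ext1 n
  rw [coeff_mul, coeff_powSeries, Ring.add_choose_eq n (Commute.all a b), Finset.sum_smul]
  refine Finset.sum_congr rfl fun p hp => ?_
  rw [coeff_powSeries, coeff_powSeries, smul_mul_smul_comm, ← pow_add,
    Finset.HasAntidiagonal.mem_antidiagonal.mp hp]

theorem powSeries_choose_zero (Y : Tensor2) : powSeries (Ring.choose 0) Y = 1 := by
  ext1 n
  rw [coeff_powSeries, Ring.choose_zero_ite, coeff_one]
  split_ifs with h <;> simp [h]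

theorem powSeries_choose_one (Y : Tensor2) : powSeries (Ring.choose 1) Y = 1 + X * C Y := by
  ext1 n
  have h1 : (1 : ℂ) = ((1 : ℕ) : ℂ) := by simp
  rw [coeff_powSeries, h1, Ring.choose_natCast]
  obtain _ | _ | n := n
  · simp
  · simp [coeff_one]
  · rw [map_add, coeff_succ_X_mul, coeff_one, coeff_C,
      Nat.choose_eq_zero_of_lt (by omega)]
    simp

theorem choose_neg_one (n : ℕ) : Ring.choose (-1 : ℂ) n = (-1) ^ n := by
  induction n with
  | zero => simp
  | succ n ih =>
    have := Ring.choose_succ_succ (-1 : ℂ) n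
    rw [neg_add_cancel, Ring.choose_zero_succ, ih] at this
    rw [pow_succ]
    linear_combination -this

/-- For square matrices a left inverse is also a right inverse. The unknown series of `f` is
therefore a right inverse of `d`, and it coincides with the left inverse `c`. -/
theorem HasTaylor.left_inv_unique {f g : ℝ → Tensor2} {c d : Tensor2⟦X⟧}
    (hf : AnalyticAt ℝ f 0) (hg : HasTaylor g d) (hfg : ∀ᶠ s in 𝓝 0, f s * g s = 1)
    (hcd : c * d = 1) : HasTaylor f c := by
  obtain ⟨c', hc'⟩ := HasTaylor.exists_of_analyticAt hf
  have h1 : d * c' = 1 := by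
    have h := (hg.mul hc').congr (g := fun _ => 1) (hfg.mono fun s hs => by
      exact mul_eq_one_comm.mp hs)
    have h' : HasTaylor (fun _ : ℝ => (1 : Tensor2)) (C 1) := HasTaylor.const 1
    rw [map_one] at h'
    exact h.unique h'
  rwa [left_inv_eq_right_inv hcd h1]

theorem hasTaylor_line (M N : Tensor2) :
    HasTaylor (fun s : ℝ => M + (s : ℂ) • N) (C M + X * C N) := by
  have h : (fun s : ℝ => M + (s : ℂ) • N) = fun s : ℝ => M + s • N := by
    funext s
    rw [Complex.coe_smul]
  rw [h]
  exact (HasTaylor.const M).add (HasTaylor.smul_const N)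

theorem tendsto_line (M N : Tensor2) :
    Tendsto (fun s : ℝ => M + (s : ℂ) • N) (𝓝 0) (𝓝 M) := by
  have h := (hasTaylor_line M N).analytic.continuousAt.tendsto
  rw [Complex.ofReal_zero, zero_smul, add_zero] at h
  exact h

theorem η_mul_line (H : Tensor2) (s : ℝ) : η * (η + (s : ℂ) • H) = 1 + (s : ℂ) • (η * H) := by
  rw [mul_add, η_mul_η, mul_smul_comm]

theorem isUnit_η : IsUnit η := IsUnit.of_mul_eq_one η η_mul_η

theorem eventually_isUnit_line (H : Tensor2) : ∀ᶠ s : ℝ in 𝓝 0, IsUnit (η + (s : ℂ) • H) :=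
  (tendsto_line η H).eventually (Units.nhds isUnit_η.unit)

theorem analyticAt_inv_line (H : Tensor2) :
    AnalyticAt ℝ (fun s : ℝ => (η + (s : ℂ) • H)⁻¹) 0 := by
  simp only [Matrix.nonsing_inv_eq_ringInverse]
  exact (analyticAt_inverse (𝕜 := ℝ) isUnit_η.unit).fun_comp_of_eq (hasTaylor_line η H).analytic
    (by simp)

/-- Neumann series: `η + sH = η(1 + s ηH)`, so the inverse is `(1 + s ηH)⁻¹ η`. -/
theorem hasTaylor_inv (H : Tensor2) : HasTaylor (fun s : ℝ => (η + (s : ℂ) • H)⁻¹)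
    (powSeries (fun n => (-1) ^ n) (η * H) * C η) := by
  refine HasTaylor.left_inv_unique (analyticAt_inv_line H) (hasTaylor_line η H) ?_ ?_
  · filter_upwards [eventually_isUnit_line H] with s hs
    exact Matrix.nonsing_inv_mul _ ((Matrix.isUnit_iff_isUnit_det _).mp hs)
  · have h : C η * (C η + X * C H) = (1 + X * C (η * H) : Tensor2⟦X⟧) := by
      rw [mul_add, ← map_mul, η_mul_η, map_one, ← mul_assoc, ← X_mul, mul_assoc, ← map_mul]
    rw [mul_assoc, h, ← powSeries_choose_one]
    have h2 : (fun n => (-1) ^ n) = Ring.choose (-1 : ℂ) := by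
      funext n
      rw [choose_neg_one]
    rw [h2, powSeries_mul, neg_add_cancel, powSeries_choose_zero]

/-- The Taylor series of the analytic root and the binomial series have the same square `1 + XY` and
the same constant term `1`. -/
theorem hasTaylor_sqrtMat (Y : Tensor2) : HasTaylor (fun s : ℝ => sqrtMat (1 + (s : ℂ) • Y))
    (powSeries (Ring.choose (1 / 2)) Y) := by
  have ha : AnalyticAt ℝ (fun s : ℝ => sqrtMat (1 + (s : ℂ) • Y)) 0 := by
    exact analyticAt_sqrtMat.fun_comp_of_eq (hasTaylor_line 1 Y).analytic (by simp)
  obtain ⟨c, hc⟩ := HasTaylor.exists_of_analyticAt ha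
  have h1 : c * c = 1 + X * C Y := by
    refine ((hc.mul hc).congr ?_).unique (by simpa using hasTaylor_line 1 Y)
    exact (tendsto_line 1 Y).eventually sqrtMat_mul_self
  have h2 : c = powSeries (Ring.choose (1 / 2)) Y := by
    refine series_eq_of_sq_eq ?_ (by simp) ?_
    · rw [hc.zero_eq]
      simp
    · rw [h1, powSeries_mul, ← powSeries_choose_one]
      norm_num
  rwa [← h2]

theorem isSymm_line {H : Tensor2} (hH : H.IsSymm) (s : ℝ) : (η + (s : ℂ) • H).IsSymm := by
  rw [Matrix.IsSymm, Matrix.transpose_add, Matrix.transpose_smul, hH.eq, η_transpose]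

theorem eventually_vielbein_line {H : Tensor2} (hH : H.IsSymm) : ∀ᶠ s : ℝ in 𝓝 0,
    IsSymmetricVielbein (η + (s : ℂ) • H) (vielbein (η + (s : ℂ) • H)) ∧
      vielbein (η + (s : ℂ) • H) = sqrtMat (1 + (s : ℂ) • (η * H)) := by
  filter_upwards [(tendsto_line η H).eventually vielbein_eq_sqrtMat] with s hs
  obtain ⟨h1, h2⟩ := hs (isSymm_line hH s)
  rw [η_mul_line] at h1 h2
  exact ⟨h2 ▸ h1, h2⟩

theorem hasTaylor_vielbein {H : Tensor2} (hH : H.IsSymm) :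
    HasTaylor (fun s : ℝ => vielbein (η + (s : ℂ) • H))
      (powSeries (Ring.choose (1 / 2)) (η * H)) :=
  (hasTaylor_sqrtMat (η * H)).congr
    ((eventually_vielbein_line hH).mono fun _ hs => hs.2.symm)

theorem invVielbeinUp_eq (g : Tensor2) :
    Matrix.of (invVielbeinUp g) = g⁻¹ * (vielbein g)ᵀ := by
  have h : Matrix.of (invVielbeinUp g) = g⁻¹ * (η * (η * vielbein g))ᵀ := by
    ext μ r
    simp only [Matrix.of_apply, invVielbeinUp, invVielbein, Matrix.mul_apply,
      Matrix.transpose_apply, Finset.mul_sum]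
    rw [Finset.sum_comm]
    exact Finset.sum_congr rfl fun _ _ => Finset.sum_congr rfl fun _ _ =>
      Finset.sum_congr rfl fun _ _ => by ring
  rw [h, η_mul_η_assoc]

/-- For the tenth density: flattening the upper index of a Christoffel symbol merges the vielbein
with the inverse metric. This is why that rule has a single factor with exponent `-1/2` in place of
two blocks. -/
theorem vielbein_mul_inv {g : Tensor2} (hg : g.IsSymm) (t κ : Fin 4) :
    ∑ τ, vielbein g t τ * g⁻¹ τ κ = invVielbeinUp g κ t := by
  have h := congrFun₂ (invVielbeinUp_eq g) κ t
  rw [Matrix.of_apply] at h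
  rw [h, ← Matrix.transpose_apply (g⁻¹ * _), Matrix.transpose_mul, Matrix.transpose_transpose,
    Matrix.transpose_nonsing_inv, hg.eq, Matrix.mul_apply]

/-- In the symmetric gauge `eᵀ η e = g`, so `g⁻¹ eᵀ` is a left inverse of `η e`, whose series `η (1
+ XY)^{1/2}` is inverted by `(1 + XY)^{-1/2} η`. -/
theorem hasTaylor_invVielbeinUp {H : Tensor2} (hH : H.IsSymm) :
    HasTaylor (fun s : ℝ => (Matrix.of (invVielbeinUp (η + (s : ℂ) • H)) : Tensor2))
      (powSeries (Ring.choose (-1 / 2)) (η * H) * C η) := by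
  have ht : AnalyticAt ℝ (fun s : ℝ => (vielbein (η + (s : ℂ) • H))ᵀ) 0 :=
    analyticAt_matrix fun i j => ((hasTaylor_vielbein hH).entry j i).analytic
  refine HasTaylor.left_inv_unique (g := fun s : ℝ => η * vielbein (η + (s : ℂ) • H))
    (d := C η * powSeries (Ring.choose (1 / 2)) (η * H)) ?_ ?_ ?_ ?_
  · simp only [invVielbeinUp_eq]
    exact (analyticAt_inv_line H).fun_mul ht
  · exact (HasTaylor.const η).mul (hasTaylor_vielbein hH)
  · filter_upwards [eventually_isUnit_line H, eventually_vielbein_line hH] with s hs hv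
    obtain ⟨h1, h2, -⟩ := isSymmetricVielbein_iff.mp hv.1
    rw [Matrix.IsSymm, Matrix.transpose_mul, η_transpose] at h2
    rw [invVielbeinUp_eq, mul_assoc, ← mul_assoc (vielbein _)ᵀ, h2, mul_assoc, h1, η_mul_η_assoc]
    exact Matrix.nonsing_inv_mul _ ((Matrix.isUnit_iff_isUnit_det _).mp hs)
  · rw [mul_assoc, ← mul_assoc (C η), ← map_mul, η_mul_η, map_one, one_mul, powSeries_mul,
      ← powSeries_choose_zero (η * H)]
    norm_num

end GravitonMatter

namespace GravitonMatter

open PowerSeries Filter Topology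

/-! ### The derivative of the vielbein -/

section SqrtDerivative

variable {A : Type*} [NormedRing A] [NormedAlgebra ℝ A] {E : Type*}
  [NormedAddCommGroup E] [NormedSpace ℝ E] {S : A → A} {F : E → A} {x : E}

theorem tendsto_one_add_smul (Y : A) : Tendsto (fun s : ℝ => 1 + s • Y) (𝓝 0) (𝓝 1) := by
  have h : Continuous fun s : ℝ => 1 + s • Y := by fun_prop
  simpa using h.tendsto 0

/-- `F` need not commute with its derivative, so `∂(Fⁿ)` has no closed form. This splitting is all
that is needed to convolve the series of `∂(Fⁿ)` with that of `Fⁿ`. -/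
theorem fderiv_pow_add (hF : DifferentiableAt ℝ F x) (v : E) (i j : ℕ) :
    fderiv ℝ (fun y => F y ^ (i + j)) x v =
      fderiv ℝ (fun y => F y ^ i) x v * F x ^ j + F x ^ i * fderiv ℝ (fun y => F y ^ j) x v := by
  simp only [pow_add]
  rw [fderiv_fun_mul' (hF.fun_pow i) (hF.fun_pow j), add_comm]
  rfl

theorem fderiv_clm_pow (hF : DifferentiableAt ℝ F x) (v : E) (n : ℕ)
    {B : Type*} [NormedAddCommGroup B] [NormedSpace ℝ B] (L : A →L[ℝ] B) :
    fderiv ℝ (fun y => L (F y ^ n)) x v = L (fderiv ℝ (fun y => F y ^ n) x v) :=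
  congrArg (fun L => L v) (L.hasFDerivAt.comp x (hF.fun_pow n).hasFDerivAt).fderiv

variable [CompleteSpace A]

/-- The `s`-expansion of the directional derivative of `S (1 + s F)`, where `S` is a square
root. -/
theorem hasTaylor_fderiv_sqrt [Algebra ℂ A] (hS : AnalyticAt ℝ S 1)
    (hmul : ∀ᶠ Y in 𝓝 1, S Y * S Y = Y) (hF : DifferentiableAt ℝ F x) (v : E)
    (hT : HasTaylor (fun s : ℝ => S (1 + s • F x))
      (PowerSeries.mk fun n => Ring.choose (1 / 2 : ℂ) n • F x ^ n)) :
    HasTaylor (fun s : ℝ => fderiv ℝ S (1 + s • F x) (s • fderiv ℝ F x v))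
      (PowerSeries.mk fun n => Ring.choose (1 / 2 : ℂ) n • fderiv ℝ (fun y => F y ^ n) x v) := by
  set V := fderiv ℝ F x v with hV
  set Q := PowerSeries.mk fun n => Ring.choose (1 / 2 : ℂ) n • F x ^ n with hQ
  have hQ0 : coeff 0 Q = 1 := by simp [hQ]
  have ha : AnalyticAt ℝ (fun s : ℝ => fderiv ℝ S (1 + s • F x) (s • V)) 0 := by
    have h1 : AnalyticAt ℝ (fun s : ℝ => fderiv ℝ S (1 + s • F x)) 0 :=
      hS.fderiv.fun_comp_of_eq (by fun_prop) (by simp)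
    exact (h1.contDiffAt.clm_apply (f := fun s => fderiv ℝ S (1 + s • F x)) (n := ω)
      (by fun_prop : ContDiffAt ℝ ω (fun s : ℝ => s • V) 0)).analyticAt
  obtain ⟨c, hc⟩ := HasTaylor.exists_of_analyticAt ha
  -- Differentiating `S · S = id` near `1 + sF` gives a Sylvester equation for the unknown series,
  -- whose coefficients `Q` have constant term `1`.
  have key : c * Q + Q * c = X * C V := by
    refine (((hc.mul hT).add (hT.mul hc)).congr ?_).unique (HasTaylor.smul_const V)
    have h1 := (tendsto_one_add_smul (F x)).eventually (eventually_eventually_nhds.mpr hmul)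
    have h2 := (tendsto_one_add_smul (F x)).eventually hS.eventually_analyticAt
    filter_upwards [h1, h2] with s hs1 hs2
    have hd := hs2.differentiableAt
    have h3 : fderiv ℝ (fun Z => S Z * S Z) (1 + s • F x) = fderiv ℝ (fun Z => Z) (1 + s • F x) :=
      Filter.EventuallyEq.fderiv_eq hs1
    rw [fderiv_fun_mul' hd hd, fderiv_fun_id] at h3
    rw [add_comm]
    exact congrArg (fun L => L (s • V)) h3
  have hone : ∀ n, coeff n (X * C V) =
      Ring.choose (1 : ℂ) n • fderiv ℝ (fun y => F y ^ n) x v := by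
    intro n
    have h1 : (1 : ℂ) = ((1 : ℕ) : ℂ) := by simp
    rw [h1, Ring.choose_natCast]
    obtain _ | _ | n := n
    · simp
    · simp [hV]
    · rw [coeff_succ_X_mul, coeff_C, Nat.choose_eq_zero_of_lt (by omega)]
      simp
  set D := PowerSeries.mk fun n => Ring.choose (1 / 2 : ℂ) n • fderiv ℝ (fun y => F y ^ n) x v
    with hD
  -- The candidate solves the same equation: by the Leibniz splitting and Vandermonde with `1/2 +
  -- 1/2 = 1`, the coefficients of the left side are `(1 choose n) ∂(Fⁿ)`, which vanish except for
  -- `n = 1`.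
  have hDQ : D * Q + Q * D = X * C V := by
    ext1 n
    have h2 : (1 : ℂ) = 1 / 2 + 1 / 2 := by norm_num
    rw [hone, map_add, coeff_mul, coeff_mul, ← Finset.sum_add_distrib, h2,
      Ring.add_choose_eq n (Commute.all _ _), Finset.sum_smul]
    refine Finset.sum_congr rfl fun p hp => ?_
    rw [hD, hQ, coeff_mk, coeff_mk, coeff_mk, coeff_mk, smul_mul_smul_comm, smul_mul_smul_comm,
      ← smul_add, ← fderiv_pow_add hF, Finset.HasAntidiagonal.mem_antidiagonal.mp hp]
  have : c = D := by
    refine sub_eq_zero.mp (series_eq_zero_of_sylvester hQ0 hQ0 ?_)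
    rw [sub_mul, mul_sub, add_comm, sub_add_sub_comm, key, hDQ, sub_self]
  rwa [← this]

theorem eventually_fderiv_sqrt (hS : AnalyticAt ℝ S 1) (hF : DifferentiableAt ℝ F x) (v : E)
    {B : Type*} [NormedAddCommGroup B] [NormedSpace ℝ B] (L : A →L[ℝ] B) :
    ∀ᶠ s : ℝ in 𝓝 0, fderiv ℝ (fun y => L (S (1 + s • F y))) x v =
      L (fderiv ℝ S (1 + s • F x) (s • fderiv ℝ F x v)) := by
  filter_upwards [(tendsto_one_add_smul (F x)).eventually hS.eventually_analyticAt] with s hs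
  have hl : HasFDerivAt (fun y => 1 + s • F y) (s • fderiv ℝ F x) x :=
    (hF.hasFDerivAt.fun_const_smul s).const_add 1
  have hc := L.hasFDerivAt.comp x (hs.differentiableAt.hasFDerivAt.comp x hl)
  exact congrArg (fun L => L v) hc.fderiv

end SqrtDerivative

/-- Smooth symmetric fields of rank two tensors. -/
structure IsGraviton (h : Field2) : Prop where
  symm : ∀ y, (h y).IsSymm
  smooth : ∀ α β, ContDiff ℝ ∞ fun y => h y α β

/-- The combination `∂_μ h_{κν} + ∂_ν h_{μκ} - ∂_κ h_{μν}`. -/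
noncomputable def lowerChristoffel (h : Field2) (x : Spacetime) (κ μ ν : Fin 4) : ℂ :=
  pd μ (fun y => h y κ ν) x + pd ν (fun y => h y μ κ) x - pd κ (fun y => h y μ ν) x

namespace IsGraviton

variable {h : Field2}

theorem pd_line (hh : IsGraviton h) (x : Spacetime) (s : ℝ) (ρ i j : Fin 4) :
    pd ρ (fun y => (η + (s : ℂ) • h y) i j) x = s * pd ρ (fun y => h y i j) x := by
  have h1 : DifferentiableAt ℝ (fun y => h y i j) x :=
    ((hh.smooth i j).differentiable (by simp)).differentiableAt
  have h2 := ((h1.hasFDerivAt.const_mul (s : ℂ)).const_add (η i j)).fderiv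
  exact congrArg (fun L => L (Pi.single ρ 1)) h2

/-- The Minkowski metric is constant, so only `h` is differentiated; apart from the inverse metric
the symbol is exactly linear in `s`. -/
theorem christoffel_line (hh : IsGraviton h) (x : Spacetime) (s : ℝ) (τ μ ν : Fin 4) :
    christoffel (fun y => η + (s : ℂ) • h y) x τ μ ν =
      ∑ κ, (η + (s : ℂ) • h x)⁻¹ τ κ * (s * (1 / 2 * lowerChristoffel h x κ μ ν)) := by
  simp only [christoffel, hh.pd_line, lowerChristoffel, Finset.mul_sum]
  exact Finset.sum_congr rfl fun κ _ => by ring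

attribute [local instance] Matrix.linftyOpNormedRing Matrix.linftyOpNormedAlgebra

theorem differentiableAt (hh : IsGraviton h) (x : Spacetime) : DifferentiableAt ℝ h x :=
  differentiableAt_pi.mpr fun i => differentiableAt_pi.mpr fun j =>
    ((hh.smooth i j).differentiable (by simp)).differentiableAt

theorem differentiableAt_endo (hh : IsGraviton h) (x : Spacetime) :
    DifferentiableAt ℝ (fun y => η * h y) x :=
  (differentiableAt_const η).mul (hh.differentiableAt x)

theorem hasTaylor_pd_vielbein (hh : IsGraviton h) (x : Spacetime) (ρ t σ : Fin 4) :
    HasTaylor (fun s : ℝ => pd ρ (fun y => vielbein (η + (s : ℂ) • h y) t σ) x)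
      (PowerSeries.mk fun n =>
        Ring.choose (1 / 2 : ℂ) n * pd ρ (fun y => ((η * h y) ^ n) t σ) x) := by
  have hF := hh.differentiableAt_endo x
  have hT : HasTaylor (fun s : ℝ => sqrtMat (1 + s • (η * h x)))
      (PowerSeries.mk fun n => Ring.choose (1 / 2 : ℂ) n • (η * h x) ^ n) := by
    simpa only [Complex.coe_smul] using! hasTaylor_sqrtMat (η * h x)
  have h1 := (hasTaylor_fderiv_sqrt (F := fun y => η * h y) analyticAt_sqrtMat sqrtMat_mul_self hF
    (Pi.single ρ 1) hT).clm (entryCLM t σ)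
  have h2 : (PowerSeries.mk fun n =>
        Ring.choose (1 / 2 : ℂ) n * pd ρ (fun y => ((η * h y) ^ n) t σ) x) =
      PowerSeries.mk fun n => entryCLM t σ (coeff n (PowerSeries.mk fun n =>
        Ring.choose (1 / 2 : ℂ) n • fderiv ℝ (fun y => (η * h y) ^ n) x (Pi.single ρ 1))) := by
    ext n
    have h3 := fderiv_clm_pow (F := fun y => η * h y) hF (Pi.single ρ 1) n (entryCLM t σ)
    rw [coeff_mk, coeff_mk, coeff_mk]
    exact congrArg (Ring.choose (1 / 2 : ℂ) n * ·) h3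
  rw [h2]
  refine h1.congr ?_
  -- To differentiate in spacetime, the vielbein must agree with the analytic root on a
  -- neighbourhood of `x`. The identity is therefore required near `η + s h(x)`, and continuity of
  -- `h` carries it to the points near `x`.
  filter_upwards [eventually_fderiv_sqrt (F := fun y => η * h y) analyticAt_sqrtMat hF
      (Pi.single ρ 1) (entryCLM t σ),
    (tendsto_line η (h x)).eventually (eventually_eventually_nhds.mpr vielbein_eq_sqrtMat)]
    with s hs1 hs2
  rw [← hs1, pd]
  have hcont : Tendsto (fun y => η + (s : ℂ) • h y) (𝓝 x) (𝓝 (η + (s : ℂ) • h x)) := by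
    have h3 : ContinuousAt (fun y => η + (s : ℂ) • h y) x :=
      continuousAt_const.add ((hh.differentiableAt x).continuousAt.fun_const_smul _)
    exact h3
  refine congrArg (fun L : Spacetime →L[ℝ] ℂ => L (Pi.single ρ 1))
    (Filter.EventuallyEq.fderiv_eq (𝕜 := ℝ) ?_).symm
  filter_upwards [hcont.eventually hs2] with y hy
  rw [(hy (isSymm_line (hh.symm y) s)).2, η_mul_line, Complex.coe_smul]
  rfl

end IsGraviton

end GravitonMatter

namespace GravitonMatter

open PowerSeries Filter Topology

/-! ### The volume density -/

/-- The second elementary symmetric polynomial in terms of power sums. -/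
noncomputable def esymm2 (t₁ t₂ : ℂ) : ℂ := (t₁ ^ 2 - t₂) / 2

/-- The third elementary symmetric polynomial in terms of power sums. -/
noncomputable def esymm3 (t₁ t₂ t₃ : ℂ) : ℂ := (t₁ ^ 3 - 3 * t₁ * t₂ + 2 * t₃) / 6

/-- The fourth elementary symmetric polynomial in terms of power sums. -/
noncomputable def esymm4 (t₁ t₂ t₃ t₄ : ℂ) : ℂ :=
  (t₁ ^ 4 - 6 * t₁ ^ 2 * t₂ + 3 * t₂ ^ 2 + 8 * t₁ * t₃ - 6 * t₄) / 24

/-- The determinant is the sum of the elementary symmetric polynomials of the eigenvalues, and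
Newton's identities write these through the power sums `tr Yᵏ`. For size four it is checked as a
polynomial identity in the entries. -/
theorem det_one_add (Y : Tensor2) : (1 + Y).det =
    1 + Y.trace + esymm2 Y.trace (Y ^ 2).trace + esymm3 Y.trace (Y ^ 2).trace (Y ^ 3).trace +
      esymm4 Y.trace (Y ^ 2).trace (Y ^ 3).trace (Y ^ 4).trace := by
  have h4 : (Y ^ 4).trace = ((Y ^ 2) * (Y ^ 2)).trace := by rw [← pow_add]
  have h3 : (Y ^ 3).trace = ((Y ^ 2) * Y).trace := by rw [← pow_succ]
  rw [h4, h3, pow_two]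
  simp only [Matrix.det_succ_row_zero, Matrix.trace, Matrix.diag, Matrix.mul_apply,
    Fin.sum_univ_succ, Matrix.submatrix_apply, esymm2, esymm3, esymm4]
  simp [Fin.succAbove, Matrix.one_apply]
  ring

end GravitonMatter

/-! ### Powers of the elementary symmetric polynomials and the sevenfold sum in `𝔳_n` -/

namespace GravitonMatter

open PowerSeries Filter Topology

/-- The sum over `p, …, v` in `𝔳_n`, with general terms in place of the products of cycles. -/
noncomputable def cycleSum (Φ : ℕ → ℕ → ℕ → ℕ → ℂ) (i j k l : ℕ) : ℂ :=
  ∑ p ∈ Finset.range (j - k + 1), ∑ q ∈ Finset.range (k - l + 1),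
  ∑ r ∈ Finset.range (q + 1), ∑ s ∈ Finset.range (l + 1), ∑ t ∈ Finset.range (s + 1),
  ∑ u ∈ Finset.range (t + 1), ∑ v ∈ Finset.range (u + 1),
    Ring.choose (1 / 2 : ℂ) i * (i.choose j : ℂ) * (j.choose k : ℂ) * (k.choose l : ℂ) *
      ((j - k).choose p : ℂ) * ((k - l).choose q : ℂ) * (q.choose r : ℂ) *
      (l.choose s : ℂ) * (s.choose t : ℂ) * (t.choose u : ℂ) * (u.choose v : ℂ) *
    (-1 : ℂ) ^ ((p : ℤ) + q - r + s - t + v) *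
    (2 : ℂ) ^ (-(j : ℤ) - 2 * l + r + s + 2 * t - 3 * u + v) *
    (3 : ℂ) ^ (-(k : ℤ) + q - r + s - t + u) *
    Φ (i + j + k + l - 2 * p - 2 * q - r - 2 * s - t - u)
      (p + q - r + s - t + 2 * u - 2 * v) (r + t - u) v

/-- The index tuples `(i, j, k, l)` of `𝔳_n`. -/
def volIndex (n : ℕ) : Finset (Fin 4 → ℕ) :=
  (Finset.Nat.antidiagonalTuple 4 n).filter (fun w => w 1 ≤ w 0 ∧ w 2 ≤ w 1 ∧ w 3 ≤ w 2)

theorem vBlock_eq (ϰ : ℝ) (n : ℕ) (a : ℕ → Leg) : vBlock ϰ n a = (ϰ : ℂ) ^ n *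
    ∑ w ∈ volIndex n, cycleSum (fun A B C D => cycles A B C D a) (w 0) (w 1) (w 2) (w 3) :=
  rfl

theorem esymm2_pow (t₁ t₂ : ℂ) (m : ℕ) : esymm2 t₁ t₂ ^ m =
    ∑ p ∈ Finset.range (m + 1), (m.choose p : ℂ) * (-1) ^ p * (2 ^ m)⁻¹ * t₁ ^ (2 * (m - p)) *
      t₂ ^ p := by
  rw [esymm2, div_pow, sub_eq_neg_add, add_pow, Finset.sum_div]
  refine Finset.sum_congr rfl fun p _ => ?_
  rw [neg_pow, ← pow_mul]
  ring

theorem esymm3_pow (t₁ t₂ t₃ : ℂ) (m : ℕ) : esymm3 t₁ t₂ t₃ ^ m =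
    ∑ q ∈ Finset.range (m + 1), ∑ r ∈ Finset.range (q + 1),
      (m.choose q : ℂ) * (q.choose r : ℂ) * (-1) ^ (q - r) * (6 ^ m)⁻¹ * 3 ^ (q - r) * 2 ^ r *
        t₁ ^ (3 * (m - q) + (q - r)) * t₂ ^ (q - r) * t₃ ^ r := by
  have h : esymm3 t₁ t₂ t₃ = ((2 * t₃ + -1 * 3 * t₁ * t₂) + t₁ ^ 3) / 6 := by rw [esymm3]; ring
  rw [h, div_pow, add_pow, Finset.sum_div]
  refine Finset.sum_congr rfl fun q _ => ?_
  rw [add_pow, Finset.sum_mul, Finset.sum_mul, Finset.sum_div]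
  refine Finset.sum_congr rfl fun r _ => ?_
  rw [mul_pow, mul_pow, mul_pow, mul_pow, ← pow_mul, pow_add]
  ring

/-- The five monomials are split off by nested binomial expansions in the order `t₁⁴`, `t₁² t₂`, `t₁
t₃`, `t₂²`, `t₄`. The index `s` counts the factors other than `t₁⁴`, `t` and `u` those left after
the next two, and `v` the factors `t₄`. -/
theorem esymm4_pow (t₁ t₂ t₃ t₄ : ℂ) (m : ℕ) : esymm4 t₁ t₂ t₃ t₄ ^ m =
    ∑ s ∈ Finset.range (m + 1), ∑ t ∈ Finset.range (s + 1), ∑ u ∈ Finset.range (t + 1),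
      ∑ v ∈ Finset.range (u + 1),
      (m.choose s : ℂ) * (s.choose t : ℂ) * (t.choose u : ℂ) * (u.choose v : ℂ) *
        (-1) ^ (s - t + v) * (24 ^ m)⁻¹ * 6 ^ (s - t + v) * 8 ^ (t - u) * 3 ^ (u - v) *
        t₁ ^ (4 * (m - s) + 2 * (s - t) + (t - u)) * t₂ ^ (s - t + 2 * (u - v)) * t₃ ^ (t - u) *
        t₄ ^ v := by
  have h : esymm4 t₁ t₂ t₃ t₄ = ((((-1 * 6 * t₄ + 3 * t₂ ^ 2) + 8 * t₁ * t₃) +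
      -1 * 6 * t₁ ^ 2 * t₂) + t₁ ^ 4) / 24 := by rw [esymm4]; ring
  rw [h, div_pow, add_pow, Finset.sum_div]
  refine Finset.sum_congr rfl fun s _ => ?_
  rw [add_pow, Finset.sum_mul, Finset.sum_mul, Finset.sum_div]
  refine Finset.sum_congr rfl fun t _ => ?_
  rw [add_pow, Finset.sum_mul, Finset.sum_mul, Finset.sum_mul, Finset.sum_mul, Finset.sum_div]
  refine Finset.sum_congr rfl fun u _ => ?_
  rw [add_pow]
  simp only [Finset.sum_mul, Finset.sum_div]
  refine Finset.sum_congr rfl fun v _ => ?_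
  simp only [mul_pow, ← pow_mul, pow_add]
  ring

theorem sign_exponent {p q r s t v : ℕ} (hr : r ≤ q) (ht : t ≤ s) :
    (-1 : ℂ) ^ ((p : ℤ) + q - r + s - t + v) =
      (-1) ^ p * (-1) ^ (q - r) * (-1) ^ (s - t + v) := by
  obtain ⟨q, rfl⟩ := Nat.exists_eq_add_of_le hr
  obtain ⟨s, rfl⟩ := Nat.exists_eq_add_of_le ht
  rw [← pow_add, ← pow_add, ← zpow_natCast]
  congr 1
  push_cast
  simp
  ring

/-- On the right stand the denominators `2`, `6`, `24` of `esymm2`, `esymm3`, `esymm4` and the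
integer coefficients of their monomials; the left collects them by the primes `2` and `3`. The
inequalities make every natural number difference a genuine one. -/
theorem factor_exponent {j k l q r s t u v : ℕ} (hjk : k ≤ j) (hkl : l ≤ k) (hr : r ≤ q)
    (ht : t ≤ s) (hu : u ≤ t) (hv : v ≤ u) :
    (2 : ℂ) ^ (-(j : ℤ) - 2 * l + r + s + 2 * t - 3 * u + v) *
      (3 : ℂ) ^ (-(k : ℤ) + q - r + s - t + u) =
    (2 ^ (j - k))⁻¹ * ((6 ^ (k - l))⁻¹ * 3 ^ (q - r) * 2 ^ r) *
      ((24 ^ l)⁻¹ * 6 ^ (s - t + v) * 8 ^ (t - u) * 3 ^ (u - v)) := by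
  obtain ⟨k, rfl⟩ := Nat.exists_eq_add_of_le hkl
  obtain ⟨j, rfl⟩ := Nat.exists_eq_add_of_le hjk
  obtain ⟨q, rfl⟩ := Nat.exists_eq_add_of_le hr
  obtain ⟨u, rfl⟩ := Nat.exists_eq_add_of_le hv
  obtain ⟨t, rfl⟩ := Nat.exists_eq_add_of_le hu
  obtain ⟨s, rfl⟩ := Nat.exists_eq_add_of_le ht
  have h6 : (6 : ℂ) = 2 * 3 := by norm_num
  have h8 : (8 : ℂ) = 2 ^ 3 := by norm_num
  have h24 : (24 : ℂ) = 2 ^ 3 * 3 := by norm_num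
  have e2 : (-((l + k + j : ℕ) : ℤ) - 2 * l + r + ((v + u + t + s : ℕ) : ℤ) +
      2 * ((v + u + t : ℕ) : ℤ) - 3 * ((v + u : ℕ) : ℤ) + v) =
      -(j : ℤ) + -(k : ℤ) + -((3 * l : ℕ) : ℤ) + r + s + ((3 * t : ℕ) : ℤ) + v := by
    push_cast; ring
  have e3 : (-((l + k : ℕ) : ℤ) + ((r + q : ℕ) : ℤ) - r + ((v + u + t + s : ℕ) : ℤ) -
      ((v + u + t : ℕ) : ℤ) + ((v + u : ℕ) : ℤ)) = -(k : ℤ) + -(l : ℤ) + q + s + u + v := by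
    push_cast; ring
  rw [e2, e3]
  simp only [zpow_add₀ (two_ne_zero' ℂ), zpow_add₀ (three_ne_zero' ℂ), zpow_neg, zpow_natCast,
    h6, h8, h24, mul_pow, Nat.add_sub_cancel_left, mul_inv, pow_add, ← pow_mul]
  ring

/-- If each `k`-cycle counts as the power sum `t_k`, the sums over `p`, over `q, r` and over `s, t,
u, v` become independent expansions of powers of `esymm2`, `esymm3` and `esymm4`. -/
theorem cycleSum_pow (t₁ t₂ t₃ t₄ : ℂ) {i j k l : ℕ} (hij : j ≤ i) (hjk : k ≤ j) (hkl : l ≤ k) :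
    cycleSum (fun A B C D => t₁ ^ A * t₂ ^ B * t₃ ^ C * t₄ ^ D) i j k l =
      esymm2 t₁ t₂ ^ (j - k) * (esymm3 t₁ t₂ t₃ ^ (k - l) * (esymm4 t₁ t₂ t₃ t₄ ^ l *
        (Ring.choose (1 / 2 : ℂ) i * (i.choose j : ℂ) * (j.choose k : ℂ) * (k.choose l : ℂ) *
          t₁ ^ (i - j)))) := by
  rw [cycleSum, esymm2_pow, Finset.sum_mul]
  refine Finset.sum_congr rfl fun p hp => ?_
  rw [esymm3_pow, Finset.sum_mul, Finset.mul_sum]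
  refine Finset.sum_congr rfl fun q hq => ?_
  rw [Finset.sum_mul, Finset.mul_sum]
  refine Finset.sum_congr rfl fun r hr => ?_
  rw [esymm4_pow]
  simp only [Finset.sum_mul, Finset.mul_sum]
  refine Finset.sum_congr rfl fun s hs => Finset.sum_congr rfl fun t ht =>
    Finset.sum_congr rfl fun u hu => Finset.sum_congr rfl fun v hv => ?_
  simp only [Finset.mem_range, Nat.lt_succ_iff] at hp hq hr hs ht hu hv
  -- The exponents are sorted by origin: the factor `t₁^{i-j}`, then the contributions of the
  -- second, third and fourth elementary symmetric polynomial.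
  have hA : i + j + k + l - 2 * p - 2 * q - r - 2 * s - t - u = (i - j) + 2 * (j - k - p) +
      (3 * (k - l - q) + (q - r)) + (4 * (l - s) + 2 * (s - t) + (t - u)) := by omega
  have hB : p + q - r + s - t + 2 * u - 2 * v = p + (q - r) + (s - t + 2 * (u - v)) := by omega
  have hC : r + t - u = r + (t - u) := by omega
  rw [hA, hB, hC, sign_exponent hr ht, mul_assoc (_ * (_ * _ * _)), factor_exponent hjk hkl hr ht hu hv]
  simp only [pow_add t₁ (i - j + _ + _), pow_add t₁ (i - j + _), pow_add t₁ (i - j),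
    pow_add t₂ (p + _), pow_add t₂ p, pow_add t₃ r]
  ring

end GravitonMatter

/-! ### The power series of the volume density -/

namespace GravitonMatter

open PowerSeries Filter Topology

/-- The power series `det (1 + X Y) - 1` for a matrix `Y` whose powers have the traces `tᵢ`. -/
noncomputable def detPoly (t₁ t₂ t₃ t₄ : ℂ) : ℂ⟦X⟧ :=
  C (esymm4 t₁ t₂ t₃ t₄) * X ^ 4 + C (esymm3 t₁ t₂ t₃) * X ^ 3 + C (esymm2 t₁ t₂) * X ^ 2 +
    C t₁ * X ^ 1

/-- The power series `√(det (1 + X Y))`. -/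
noncomputable def volSeries (t₁ t₂ t₃ t₄ : ℂ) : ℂ⟦X⟧ :=
  (PowerSeries.binomialSeries ℂ (1 / 2 : ℂ)).subst (detPoly t₁ t₂ t₃ t₄)

theorem hasSubst_detPoly (t₁ t₂ t₃ t₄ : ℂ) : HasSubst (detPoly t₁ t₂ t₃ t₄) :=
  HasSubst.of_constantCoeff_zero' (by simp [detPoly])

/-- Substitution is a ring homomorphism, and the binomial series of exponent `1/2` squares to `1 +
X`. -/
theorem volSeries_mul_self (t₁ t₂ t₃ t₄ : ℂ) :
    volSeries t₁ t₂ t₃ t₄ * volSeries t₁ t₂ t₃ t₄ = 1 + detPoly t₁ t₂ t₃ t₄ := by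
  have h := hasSubst_detPoly t₁ t₂ t₃ t₄
  have h1 : PowerSeries.binomialSeries ℂ (1 : ℂ) = (1 + X : ℂ⟦X⟧) := by
    simpa using PowerSeries.binomialSeries_nat (R := ℂ) (A := ℂ) 1
  rw [volSeries, ← subst_mul h, ← PowerSeries.binomialSeries_add, add_halves, h1, subst_add h, subst_X h,
    ← coe_substAlgHom h, map_one]

theorem coeff_zero_volSeries (t₁ t₂ t₃ t₄ : ℂ) : coeff 0 (volSeries t₁ t₂ t₃ t₄) = 1 := by
  rw [volSeries, coeff_subst' (hasSubst_detPoly t₁ t₂ t₃ t₄), finsum_eq_single _ 0]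
  · simp
  · intro n hn
    simp [detPoly, hn]

/-- In the `i`-th power, `i - j`, `j - k`, `k - l` and `l` factors contribute the terms of degree
`1`, `2`, `3` and `4`, so the total degree is `i + j + k + l`. -/
theorem coeff_detPoly_pow (t₁ t₂ t₃ t₄ : ℂ) (n i : ℕ) :
    Ring.choose (1 / 2 : ℂ) i * coeff n (detPoly t₁ t₂ t₃ t₄ ^ i) =
      ∑ j ∈ Finset.range (i + 1), ∑ k ∈ Finset.range (j + 1), ∑ l ∈ Finset.range (k + 1),
        if n = i + j + k + l then
          cycleSum (fun A B C D => t₁ ^ A * t₂ ^ B * t₃ ^ C * t₄ ^ D) i j k l else 0 := by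
  rw [detPoly, add_pow, map_sum, Finset.mul_sum]
  refine Finset.sum_congr rfl fun j hj => ?_
  rw [add_pow, Finset.sum_mul, Finset.sum_mul, map_sum, Finset.mul_sum]
  refine Finset.sum_congr rfl fun k hk => ?_
  rw [add_pow]
  simp only [Finset.sum_mul]
  rw [map_sum, Finset.mul_sum]
  refine Finset.sum_congr rfl fun l hl => ?_
  simp only [Finset.mem_range, Nat.lt_succ_iff] at hj hk hl
  have hn : 4 * l + 3 * (k - l) + 2 * (j - k) + 1 * (i - j) = i + j + k + l := by omega
  rw [cycleSum_pow t₁ t₂ t₃ t₄ hj hk hl]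
  have h : (C (esymm4 t₁ t₂ t₃ t₄) * X ^ 4) ^ l * (C (esymm3 t₁ t₂ t₃) * X ^ 3) ^ (k - l) *
      (k.choose l : ℂ⟦X⟧) * (C (esymm2 t₁ t₂) * X ^ 2) ^ (j - k) * (j.choose k : ℂ⟦X⟧) *
      (C t₁ * X ^ 1) ^ (i - j) * (i.choose j : ℂ⟦X⟧) =
      C (esymm4 t₁ t₂ t₃ t₄ ^ l * esymm3 t₁ t₂ t₃ ^ (k - l) * k.choose l *
        esymm2 t₁ t₂ ^ (j - k) * j.choose k * t₁ ^ (i - j) * i.choose j) *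
        X ^ (i + j + k + l) := by
    rw [← hn]
    simp only [map_mul, map_pow, map_natCast, mul_pow, ← pow_mul, pow_add]
    ring
  rw [h, coeff_C_mul, coeff_X_pow]
  split_ifs
  · ring
  · simp

theorem coeff_volSeries (t₁ t₂ t₃ t₄ : ℂ) (n : ℕ) : coeff n (volSeries t₁ t₂ t₃ t₄) =
    ∑ w ∈ volIndex n, cycleSum (fun A B C D => t₁ ^ A * t₂ ^ B * t₃ ^ C * t₄ ^ D)
      (w 0) (w 1) (w 2) (w 3) := by
  rw [volSeries, coeff_subst' (hasSubst_detPoly t₁ t₂ t₃ t₄)]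
  simp only [PowerSeries.binomialSeries_coeff, smul_eq_mul, mul_one, coeff_detPoly_pow]
  -- Powers beyond the `n`-th contribute nothing, since `i + j + k + l = n` forces `i ≤ n`.
  rw [finsum_eq_sum_of_support_subset (s := Finset.range (n + 1))]
  · simp only [Finset.sum_sigma']
    rw [← Finset.sum_filter]
    refine Finset.sum_nbij' (fun z => ![z.1, z.2.1, z.2.2.1, z.2.2.2])
      (fun w => ⟨w 0, w 1, w 2, w 3⟩) ?_ ?_ ?_ ?_ ?_
    · rintro ⟨i, j, k, l⟩ h
      simp [volIndex, Finset.Nat.mem_antidiagonalTuple, Fin.sum_univ_succ] at h ⊢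
      omega
    · intro w h
      simp [volIndex, Finset.Nat.mem_antidiagonalTuple, Fin.sum_univ_succ] at h ⊢
      omega
    · rintro ⟨i, j, k, l⟩ h
      rfl
    · intro w h
      funext i
      fin_cases i <;> rfl
    · rintro ⟨i, j, k, l⟩ h
      rfl
  · intro i hi
    by_contra h
    refine hi (Finset.sum_eq_zero fun j _ => Finset.sum_eq_zero fun k _ =>
      Finset.sum_eq_zero fun l _ => if_neg ?_)
    simp only [Finset.coe_range, Set.mem_Iio, not_lt] at h
    omega

/-- The expansion of `√(-det g)` at the Minkowski metric, in terms of `Y = η h`. -/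
noncomputable def volSeriesMat (Y : Tensor2) : ℂ⟦X⟧ :=
  volSeries Y.trace (Y ^ 2).trace (Y ^ 3).trace (Y ^ 4).trace

theorem det_η : η.det = -1 := by
  simp [η, Matrix.det_diagonal, Fin.prod_univ_succ]

theorem neg_det_line (H : Tensor2) (s : ℝ) :
    -(η + (s : ℂ) • H).det = (1 + (s : ℂ) • (η * H)).det := by
  rw [← η_mul_line, Matrix.det_mul, det_η, neg_one_mul]

theorem hasTaylor_ofReal : HasTaylor (fun s : ℝ => (s : ℂ)) X := by
  have h := HasTaylor.smul_const (1 : ℂ)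
  simpa using h

theorem HasTaylor.pow {A : Type*} [NormedRing A] [NormedAlgebra ℝ A] [CompleteSpace A]
    {f : ℝ → A} {c : A⟦X⟧} (h : HasTaylor f c) (n : ℕ) :
    HasTaylor (fun s => f s ^ n) (c ^ n) := by
  induction n with
  | zero => simpa using HasTaylor.const (1 : A)
  | succ n ih => simpa only [pow_succ] using ih.mul h

theorem hasTaylor_det (Y : Tensor2) : HasTaylor (fun s : ℝ => (1 + (s : ℂ) • Y).det)
    (1 + detPoly Y.trace (Y ^ 2).trace (Y ^ 3).trace (Y ^ 4).trace) := by
  have h : ∀ (a : ℂ) (n : ℕ), HasTaylor (fun s : ℝ => a * (s : ℂ) ^ n) (C a * X ^ n) := fun a n =>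
    (HasTaylor.const a).mul (hasTaylor_ofReal.pow n)
  have h1 : HasTaylor (fun _ : ℝ => (1 : ℂ)) 1 := by simpa using HasTaylor.const (1 : ℂ)
  refine (h1.add ((((h (esymm4 Y.trace (Y ^ 2).trace (Y ^ 3).trace (Y ^ 4).trace) 4).add
    (h (esymm3 Y.trace (Y ^ 2).trace (Y ^ 3).trace) 3)).add (h (esymm2 Y.trace (Y ^ 2).trace) 2)).add
    (h Y.trace 1))).congr (Eventually.of_forall fun s => ?_)
  simp only [det_one_add, smul_pow, Matrix.trace_smul, esymm2, esymm3, esymm4, smul_eq_mul]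
  ring

/-- As `det η = -1`, the radicand is `det(1 + s ηH)`. It equals `1` at `s = 0`, where the principal
power is analytic; the series is then determined by its square and its constant term. -/
theorem hasTaylor_volDensity (H : Tensor2) :
    HasTaylor (fun s : ℝ => volDensity (η + (s : ℂ) • H)) (volSeriesMat (η * H)) := by
  have hd := hasTaylor_det (η * H)
  have ha : AnalyticAt ℝ (fun s : ℝ => (1 + (s : ℂ) • (η * H)).det ^ (1 / 2 : ℂ)) 0 := by
    have h1 : AnalyticAt ℂ (fun z : ℂ => z ^ (1 / 2 : ℂ)) 1 :=
      analyticAt_id.cpow analyticAt_const (by simp)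
    exact h1.restrictScalars.fun_comp_of_eq hd.analytic (by simp)
  simp only [volDensity, neg_det_line]
  obtain ⟨c, hc⟩ := HasTaylor.exists_of_analyticAt ha
  have h1 : c * c = 1 + detPoly (η * H).trace ((η * H) ^ 2).trace ((η * H) ^ 3).trace
      ((η * H) ^ 4).trace := by
    refine ((hc.mul hc).congr (Eventually.of_forall fun s => ?_)).unique hd
    simp only
    rw [← sq, ← Complex.cpow_nat_mul]
    norm_num
  have h2 : c = volSeriesMat (η * H) := by
    refine series_eq_of_sq_eq ?_ (coeff_zero_volSeries _ _ _ _) ?_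
    · rw [hc.zero_eq]
      simp
    · rw [h1, volSeriesMat, volSeries_mul_self]
  rwa [← h2]

end GravitonMatter

namespace GravitonMatter

open PowerSeries

/-! ### Sums over words of gravitons -/

/-- `R` depends on the first `n` members of its sequence only. -/
def DependsOnFirst (n : ℕ) (R : (ℕ → Leg) → ℂ) : Prop :=
  ∀ a b : ℕ → Leg, (∀ i < n, a i = b i) → R a = R b

section Words

variable {ι : Type*} (leg : ι → Leg)

/-- The sequence of gravitons that begins with the letters of a word. -/
def wordSeq {n : ℕ} (f : Fin n → ι) : ℕ → Leg :=
  fun i => if h : i < n then leg (f ⟨i, h⟩) else default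

theorem wordSeq_append_of_lt {m k i : ℕ} (f : Fin m → ι) (g : Fin k → ι) (hi : i < m) :
    wordSeq leg (Fin.append f g) i = wordSeq leg f i := by
  have h : (⟨i, by omega⟩ : Fin (m + k)) = Fin.castAdd k ⟨i, hi⟩ := rfl
  rw [wordSeq, wordSeq, dif_pos (by omega), dif_pos hi, h, Fin.append_left]

theorem wordSeq_append_add {m k : ℕ} (f : Fin m → ι) (g : Fin k → ι) (i : ℕ) :
    wordSeq leg (Fin.append f g) (m + i) = wordSeq leg g i := by
  by_cases hi : i < k
  · have h : (⟨m + i, by omega⟩ : Fin (m + k)) = Fin.natAdd m ⟨i, hi⟩ := rfl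
    rw [wordSeq, wordSeq, dif_pos (by omega), dif_pos hi, h, Fin.append_right]
  · rw [wordSeq, wordSeq, dif_neg (by omega), dif_neg hi]

variable [Fintype ι] (w : ι → ℂ)

/-- The weighted sum of `R` over all words of `n` gravitons. -/
def wordSum (n : ℕ) (R : (ℕ → Leg) → ℂ) : ℂ :=
  ∑ f : Fin n → ι, (∏ i, w (f i)) * R (wordSeq leg f)

theorem wordSum_add_length (m k : ℕ) (R : (ℕ → Leg) → ℂ) : wordSum leg w (m + k) R =
    ∑ f : Fin m → ι, (∏ i, w (f i)) * ∑ g : Fin k → ι, (∏ i, w (g i)) *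
      R (wordSeq leg (Fin.append f g)) := by
  rw [wordSum, ← (Fin.appendEquiv m k).sum_comp, Fintype.sum_prod_type]
  refine Finset.sum_congr rfl fun f _ => ?_
  rw [Finset.mul_sum]
  refine Finset.sum_congr rfl fun g _ => ?_
  simp only [Fin.appendEquiv, Equiv.coe_fn_mk]
  rw [Fin.prod_univ_add]
  simp only [Fin.append_left, Fin.append_right, mul_assoc]

/-- The first factor reads only the first `m` letters and the second only the remaining `k`, while
the weights are multiplicative, so the sum over words factorizes. -/
theorem wordSum_mul {m : ℕ} {R₁ : (ℕ → Leg) → ℂ} (h₁ : DependsOnFirst m R₁) (k : ℕ)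
    (R₂ : (ℕ → Leg) → ℂ) : wordSum leg w (m + k) (fun a => R₁ a * R₂ (skip m a)) =
      wordSum leg w m R₁ * wordSum leg w k R₂ := by
  conv_rhs => rw [wordSum, Finset.sum_mul]
  rw [wordSum_add_length]
  refine Finset.sum_congr rfl fun f _ => ?_
  rw [mul_assoc]
  congr 1
  rw [wordSum, Finset.mul_sum]
  refine Finset.sum_congr rfl fun g _ => ?_
  have e1 : R₁ (wordSeq leg (Fin.append f g)) = R₁ (wordSeq leg f) :=
    h₁ _ _ fun i hi => wordSeq_append_of_lt leg f g hi
  have e2 : skip m (wordSeq leg (Fin.append f g)) = wordSeq leg g :=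
    funext fun i => wordSeq_append_add leg f g i
  rw [e1, e2]
  ring

theorem wordSum_sum {κ : Type*} (I : Finset κ) (n : ℕ) (R : κ → (ℕ → Leg) → ℂ) :
    wordSum leg w n (fun a => ∑ i ∈ I, R i a) = ∑ i ∈ I, wordSum leg w n (R i) := by
  simp only [wordSum, Finset.mul_sum]
  exact Finset.sum_comm

theorem wordSum_const_mul (n : ℕ) (c : ℂ) (R : (ℕ → Leg) → ℂ) :
    wordSum leg w n (fun a => c * R a) = c * wordSum leg w n R := by
  simp only [wordSum, Finset.mul_sum]
  exact Finset.sum_congr rfl fun f _ => by ring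

theorem wordSum_zero_length (R : (ℕ → Leg) → ℂ) :
    wordSum leg w 0 R = R fun _ => default := by
  have h : ∀ f : Fin 0 → ι, wordSeq leg f = fun _ => default := fun f => by
    funext i
    simp [wordSeq]
  simp [wordSum, h]

theorem wordSum_one (R : (ℕ → Leg) → ℂ) (F : Leg → ℂ) (hR : ∀ a, R a = F (a 0)) :
    wordSum leg w 1 R = ∑ x, w x * F (leg x) := by
  rw [wordSum, ← (Equiv.funUnique (Fin 1) ι).symm.sum_comp]
  refine Finset.sum_congr rfl fun x _ => ?_
  rw [hR]
  simp [wordSeq]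

/-- Summation over the last `B` letters, if each of them occurs in one factor only. -/
theorem wordSum_prod (m B : ℕ) (F : ℕ → (ℕ → Leg) → Leg → ℂ)
    (hF : ∀ b < B, ∀ x, DependsOnFirst m fun a => F b a x) :
    wordSum leg w (m + B) (fun a => ∏ b ∈ Finset.range B, F b a (a (m + b))) =
      wordSum leg w m (fun a => ∏ b ∈ Finset.range B, ∑ x, w x * F b a (leg x)) := by
  classical
  rw [wordSum_add_length, wordSum]
  refine Finset.sum_congr rfl fun f _ => ?_
  congr 1
  rw [Finset.prod_range, Finset.prod_univ_sum, Fintype.piFinset_univ]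
  refine Finset.sum_congr rfl fun g _ => ?_
  rw [Finset.prod_range, ← Finset.prod_mul_distrib]
  refine Finset.prod_congr rfl fun b _ => ?_
  have e : wordSeq leg g b = leg (g b) := by rw [wordSeq, dif_pos b.2]
  rw [wordSeq_append_add, e]
  exact congrArg _ (hF b b.2 _ _ _ fun i hi => wordSeq_append_of_lt leg f g hi)

/-- The generating series of a family of functions of words. -/
def genSeries (R : ℕ → (ℕ → Leg) → ℂ) : ℂ⟦X⟧ := PowerSeries.mk fun n => wordSum leg w n (R n)

/-- The concatenation product. -/
def concat (R₁ R₂ : ℕ → (ℕ → Leg) → ℂ) (n : ℕ) (a : ℕ → Leg) : ℂ :=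
  ∑ p ∈ Finset.HasAntidiagonal.antidiagonal n, R₁ p.1 a * R₂ p.2 (skip p.1 a)

/-- The bridge between the rules and the Lagrange densities: distributing consecutive stretches of
gravitons among the blocks corresponds to multiplying the expansions of the fields. -/
theorem genSeries_concat {R₁ : ℕ → (ℕ → Leg) → ℂ} (h₁ : ∀ n, DependsOnFirst n (R₁ n))
    (R₂ : ℕ → (ℕ → Leg) → ℂ) :
    genSeries leg w (concat R₁ R₂) = genSeries leg w R₁ * genSeries leg w R₂ := by
  ext n
  have h : ∀ p ∈ Finset.HasAntidiagonal.antidiagonal n,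
      wordSum leg w n (fun a => R₁ p.1 a * R₂ p.2 (skip p.1 a)) =
        coeff p.1 (genSeries leg w R₁) * coeff p.2 (genSeries leg w R₂) := by
    intro p hp
    obtain rfl := Finset.HasAntidiagonal.mem_antidiagonal.mp hp
    rw [genSeries, genSeries, coeff_mk, coeff_mk]
    exact wordSum_mul leg w (h₁ p.1) p.2 (R₂ p.2)
  rw [coeff_mul, ← Finset.sum_congr rfl h, ← wordSum_sum, genSeries, coeff_mk]
  rfl

theorem genSeries_sum {κ : Type*} (I : Finset κ) (R : κ → ℕ → (ℕ → Leg) → ℂ) :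
    genSeries leg w (fun n a => ∑ i ∈ I, R i n a) = ∑ i ∈ I, genSeries leg w (R i) := by
  ext n
  simp only [map_sum, genSeries, coeff_mk]
  exact wordSum_sum leg w I n fun i => R i n

theorem genSeries_const_mul (c : ℂ) (R : ℕ → (ℕ → Leg) → ℂ) :
    genSeries leg w (fun n a => c * R n a) = C c * genSeries leg w R := by
  ext n
  simp only [coeff_C_mul, genSeries, coeff_mk]
  exact wordSum_const_mul leg w n c (R n)

/-! ### The building blocks -/

/-- The polarization tensor `∑ w P`. -/
def polarization : Tensor2 := Matrix.of fun α β =>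
  ∑ x, w x * (if (leg x).μ = α ∧ (leg x).ν = β then 1 else 0)

/-- Summing over one letter replaces its index pair by a contraction with the weighted polarization
tensor. -/
theorem sum_polarization (M : Fin 4 → Fin 4 → ℂ) : ∑ x, w x * M (leg x).μ (leg x).ν =
    ∑ α, ∑ β, polarization leg w α β * M α β := by
  have h : ∀ x, w x * M (leg x).μ (leg x).ν = ∑ α, ∑ β, w x *
      (if (leg x).μ = α ∧ (leg x).ν = β then 1 else 0) * M α β := by
    intro x
    simp [ite_and]
  simp only [h, polarization, Matrix.of_apply, Finset.sum_mul]
  rw [Finset.sum_comm]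
  exact Finset.sum_congr rfl fun _ _ => Finset.sum_comm

theorem sum_polarization_trace (M : Tensor2) : ∑ x, w x * M (leg x).μ (leg x).ν =
    (M * (polarization leg w)ᵀ).trace := by
  rw [sum_polarization leg w fun α β => M α β]
  simp only [Matrix.trace, Matrix.diag, Matrix.mul_apply, Matrix.transpose_apply]
  exact Finset.sum_congr rfl fun _ _ => Finset.sum_congr rfl fun _ _ => mul_comm _ _

theorem sum_polarization_mul (M : Tensor2) (α β : Fin 4) :
    ∑ x, w x * (η α (leg x).ν * M (leg x).μ β) = (η * (polarization leg w)ᵀ * M) α β := by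
  rw [sum_polarization leg w fun γ δ => η α δ * M γ β]
  simp only [Matrix.mul_apply, Matrix.transpose_apply, Finset.sum_mul]
  exact Finset.sum_congr rfl fun _ _ => Finset.sum_congr rfl fun _ _ => by ring

theorem dependsOnFirst_hBlock (ϰ : ℝ) (n : ℕ) (μ ν : Fin 4) :
    DependsOnFirst n (hBlock ϰ n μ ν) := by
  intro a b h
  rw [hBlock, hBlock]
  congr 1
  refine Finset.prod_congr rfl fun i hi => ?_
  rw [Finset.mem_range] at hi
  split_ifs with h1 h2 h2
  · rfl
  · rw [h i (by omega)]
  · rw [h (i - 1) (by omega)]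
  · rw [h i (by omega), h (i - 1) (by omega)]

theorem hBlock_succ (ϰ : ℝ) (n : ℕ) (μ ν : Fin 4) (a : ℕ → Leg) :
    hBlock ϰ (n + 1) μ ν a = ϰ * (η μ (a 0).ν * hBlock ϰ n (a 0).μ ν (skip 1 a)) := by
  rw [hBlock, hBlock, Finset.prod_range_succ']
  have h : ∀ i ∈ Finset.range (n + 1),
      η (if i + 1 = 0 then μ else (a (i + 1 - 1)).μ) (if i + 1 = n + 1 then ν else (a (i + 1)).ν) =
      η (if i = 0 then (a 0).μ else (skip 1 a (i - 1)).μ)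
        (if i = n then ν else (skip 1 a i).ν) := by
    intro i _
    have e : ∀ i, skip 1 a i = a (i + 1) := fun i => by rw [skip, add_comm]
    obtain _ | i := i <;> simp [e, eq_comm]
  rw [Finset.prod_congr rfl h, if_pos rfl, if_neg (by omega)]
  ring

/-- Summing out the first letter puts a factor `η Pᵀ` in front, `P` being the polarization. The
transpose appears because the chain enters a graviton at its second index and leaves at its first.
-/
theorem wordSum_hBlock (ϰ : ℝ) (n : ℕ) (μ ν : Fin 4) : wordSum leg w n (hBlock ϰ n μ ν) =
    (ϰ : ℂ) ^ n * ((η * (polarization leg w)ᵀ) ^ n * η) μ ν := by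
  induction n generalizing μ with
  | zero => rw [wordSum_zero_length]; simp [hBlock]
  | succ n ih =>
    have h : wordSum leg w (n + 1) (hBlock ϰ (n + 1) μ ν) =
        ∑ x, w x * (η μ (leg x).ν * (ϰ * wordSum leg w n (hBlock ϰ n (leg x).μ ν))) := by
      have hl : wordSum leg w (n + 1) (hBlock ϰ (n + 1) μ ν) =
          wordSum leg w (1 + n) (hBlock ϰ (n + 1) μ ν) := by rw [add_comm n 1]
      rw [hl, wordSum_add_length, ← (Equiv.funUnique (Fin 1) ι).symm.sum_comp]
      refine Finset.sum_congr rfl fun x _ => ?_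
      rw [wordSum]
      simp only [Finset.univ_unique, Finset.prod_singleton, Finset.mul_sum]
      refine Finset.sum_congr rfl fun g _ => ?_
      have e : skip 1 (wordSeq leg (Fin.append ((Equiv.funUnique (Fin 1) ι).symm x) g)) =
          wordSeq leg g := funext fun i => wordSeq_append_add leg _ g i
      have e0 : wordSeq leg (Fin.append ((Equiv.funUnique (Fin 1) ι).symm x) g) 0 = leg x := by
        rw [wordSeq_append_of_lt leg _ g one_pos]
        simp [wordSeq]
      rw [hBlock_succ, e, e0]
      simp only [Equiv.funUnique_symm_apply, uniqueElim_const]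
      ring
    simp only [h, ih]
    have hp : (η * (polarization leg w)ᵀ) ^ (n + 1) * η =
        η * (polarization leg w)ᵀ * ((η * (polarization leg w)ᵀ) ^ n * η) := by
      rw [pow_succ', mul_assoc]
    rw [hp, ← sum_polarization_mul, Finset.mul_sum]
    exact Finset.sum_congr rfl fun x _ => by ring

/-- The series `∑ n, c n (Y^n η)^{ij} X^n`. -/
noncomputable def blockSeries (c : ℕ → ℂ) (Y : Tensor2) (i j : Fin 4) : ℂ⟦X⟧ :=
  PowerSeries.mk fun n => c n * (Y ^ n * η) i j

theorem genSeries_hBlock {H : Tensor2} (hH : (polarization leg w)ᵀ = H) (ϰ : ℝ)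
    (c : ℕ → ℂ) (μ ν : Fin 4) :
    genSeries leg w (fun n a => c n * hBlock ϰ n μ ν a) =
      rescale (ϰ : ℂ) (blockSeries c (η * H) μ ν) := by
  ext n
  rw [coeff_rescale, genSeries, coeff_mk, wordSum_const_mul, wordSum_hBlock, blockSeries, coeff_mk,
    hH]
  ring

/-- The generating series of a function of one graviton. -/
theorem genSeries_single (F : Leg → ℂ) :
    genSeries leg w (fun n a => if n = 1 then F (a 0) else 0) =
      C (∑ x, w x * F (leg x)) * X := by
  ext n
  rw [genSeries, coeff_mk, coeff_C_mul, coeff_X]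
  by_cases hn : n = 1
  · subst hn
    simp only [if_true, mul_one]
    exact wordSum_one leg w _ F fun _ => rfl
  · simp [hn, wordSum]

end Words

end GravitonMatter

/-! ### Cycles of Minkowski metrics and the block `𝔳_n` -/

namespace GravitonMatter

open PowerSeries

section Words

variable {ι : Type*} [Fintype ι] (leg : ι → Leg) (w : ι → ℂ)

/-- `B` cycles through one graviton each. -/
def oneCycles (M : Tensor2) (B : ℕ) (a : ℕ → Leg) : ℂ :=
  ∏ b ∈ Finset.range B, M (a b).μ (a b).ν

/-- `B` cycles through two gravitons each. -/
def twoCycles (B : ℕ) (a : ℕ → Leg) : ℂ :=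
  ∏ b ∈ Finset.range B, η (a b).μ (a (B + b)).μ * η (a b).ν (a (B + b)).ν

/-- `B` paths of `M` and `η` through two gravitons each. -/
def closedPaths (M : Tensor2) (B : ℕ) (a : ℕ → Leg) : ℂ :=
  ∏ b ∈ Finset.range B, η (a b).μ (a (B + b)).ν * M (a (B + b)).μ (a b).ν

/-- `B` cycles through three gravitons each. -/
def threeCycles (M : Tensor2) (B : ℕ) (a : ℕ → Leg) : ℂ :=
  ∏ b ∈ Finset.range B, η (a b).μ (a (B + b)).ν * (η (a (B + b)).μ (a (B + B + b)).ν *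
    M (a (B + B + b)).μ (a b).ν)

/-- `B` cycles through four gravitons each. -/
def fourCycles (B : ℕ) (a : ℕ → Leg) : ℂ :=
  ∏ b ∈ Finset.range B, η (a b).μ (a (B + b)).ν * (η (a (B + b)).μ (a (B + B + b)).ν *
    (η (a (B + B + b)).μ (a (B + B + B + b)).ν * η (a (B + B + B + b)).μ (a b).ν))

/-- The cycles of each length occupy a consecutive stretch of gravitons, so the product is a
concatenation. Within a stretch the members of one cycle stand a fixed stride apart. -/
theorem cycles_eq (A B C D : ℕ) (a : ℕ → Leg) : cycles A B C D a =
    oneCycles η A a * (twoCycles B (skip A a) * (threeCycles η C (skip (B + B) (skip A a)) *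
      fourCycles D (skip (C + C + C) (skip (B + B) (skip A a))))) := by
  simp only [cycles, oneCycles, twoCycles, threeCycles, fourCycles,
    Finset.prod_Ico_eq_prod_range, Nat.add_sub_cancel_left, mul_assoc]
  congr 1
  congr 1
  · refine Finset.prod_congr rfl fun b _ => ?_
    simp only [skip]
    rw [show A + b + B = A + (B + b) by ring]
  congr 1
  · refine Finset.prod_congr rfl fun b _ => ?_
    simp only [skip]
    rw [show A + (B + B + b) = A + 2 * B + b by ring,
      show A + (B + B + (C + b)) = A + 2 * B + b + C by ring,
      show A + (B + B + (C + C + b)) = A + 2 * B + b + 2 * C by ring]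
  · refine Finset.prod_congr rfl fun b _ => ?_
    simp only [skip]
    rw [show A + (B + B + (C + C + C + b)) = A + 2 * B + 3 * C + b by ring,
      show A + (B + B + (C + C + C + (D + b))) = A + 2 * B + 3 * C + b + D by ring,
      show A + (B + B + (C + C + C + (D + D + b))) = A + 2 * B + 3 * C + b + 2 * D by ring,
      show A + (B + B + (C + C + C + (D + D + D + b))) = A + 2 * B + 3 * C + b + 3 * D by ring]

theorem dependsOnFirst_oneCycles (M : Tensor2) (B : ℕ) : DependsOnFirst B (oneCycles M B) := by
  intro a b h
  refine Finset.prod_congr rfl fun i hi => ?_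
  rw [Finset.mem_range] at hi
  rw [h i hi]

theorem dependsOnFirst_twoCycles (B : ℕ) : DependsOnFirst (B + B) (twoCycles B) := by
  intro a b h
  refine Finset.prod_congr rfl fun i hi => ?_
  rw [Finset.mem_range] at hi
  rw [h i (by omega), h (B + i) (by omega)]

theorem dependsOnFirst_threeCycles (M : Tensor2) (B : ℕ) :
    DependsOnFirst (B + B + B) (threeCycles M B) := by
  intro a b h
  refine Finset.prod_congr rfl fun i hi => ?_
  rw [Finset.mem_range] at hi
  rw [h i (by omega), h (B + i) (by omega), h (B + B + i) (by omega)]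

theorem wordSum_oneCycles (M : Tensor2) (B : ℕ) : wordSum leg w B (oneCycles M B) =
    (M * (polarization leg w)ᵀ).trace ^ B := by
  have h := wordSum_prod leg w 0 B (fun _ _ x => M x.μ x.ν) fun _ _ _ _ _ _ => rfl
  simp only [zero_add, wordSum_zero_length, sum_polarization_trace, Finset.prod_const,
    Finset.card_range] at h
  exact h

/-- These cycles pair first index with first and second with second, so one untransposed
polarization appears; for a symmetric field this makes no difference. -/
theorem wordSum_twoCycles (B : ℕ) : wordSum leg w (B + B) (twoCycles B) =
    (η * polarization leg w * (η * (polarization leg w)ᵀ)).trace ^ B := by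
  have h := wordSum_prod leg w B B (fun b a x => η (a b).μ x.μ * η (a b).ν x.ν)
    fun b hb x a a' haa' => by simp only [haa' b hb]
  have e : ∀ α β, ∑ x, w x * (η α (leg x).μ * η β (leg x).ν) =
      (η * polarization leg w * η) α β := by
    intro α β
    rw [sum_polarization leg w fun γ δ => η α γ * η β δ]
    simp only [Matrix.mul_apply, Finset.sum_mul]
    rw [Finset.sum_comm]
    refine Finset.sum_congr rfl fun γ _ => Finset.sum_congr rfl fun δ _ => ?_
    rw [← Matrix.transpose_apply η γ β, η_transpose]
    ring
  simp only [e] at h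
  rw [← mul_assoc, ← wordSum_oneCycles]
  exact h

theorem wordSum_closedPaths (M : Tensor2) (B : ℕ) : wordSum leg w (B + B) (closedPaths M B) =
    (η * (polarization leg w)ᵀ * M * (polarization leg w)ᵀ).trace ^ B := by
  have h := wordSum_prod leg w B B (fun b a x => η (a b).μ x.ν * M x.μ (a b).ν)
    fun b hb x a a' haa' => by simp only [haa' b hb]
  simp only [sum_polarization_mul] at h
  rw [← wordSum_oneCycles]
  exact h

/-- Summing out the last letter of every cycle leaves shorter cycles closed by `η Pᵀ M`. The matrix
parameter `M` in the shorter cycles serves this reduction. -/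
theorem wordSum_threeCycles (M : Tensor2) (B : ℕ) :
    wordSum leg w (B + B + B) (threeCycles M B) =
    (η * (polarization leg w)ᵀ * (η * (polarization leg w)ᵀ * M) *
      (polarization leg w)ᵀ).trace ^ B := by
  have h := wordSum_prod leg w (B + B) B (fun b a x => η (a b).μ (a (B + b)).ν *
    (η (a (B + b)).μ x.ν * M x.μ (a b).ν))
    fun b hb x a a' haa' => by simp only [haa' b (by omega), haa' (B + b) (by omega)]
  have e : ∀ (c : ℂ) (α β : Fin 4), ∑ x, w x * (c * (η α (leg x).ν * M (leg x).μ β)) =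
      c * (η * (polarization leg w)ᵀ * M) α β := fun c α β => by
    rw [← sum_polarization_mul, Finset.mul_sum]
    exact Finset.sum_congr rfl fun _ _ => by ring
  simp only [e] at h
  rw [← wordSum_closedPaths]
  exact h

theorem wordSum_fourCycles (B : ℕ) :
    wordSum leg w (B + B + B + B) (fourCycles B) =
    (η * (polarization leg w)ᵀ * (η * (polarization leg w)ᵀ *
      (η * (polarization leg w)ᵀ * η)) * (polarization leg w)ᵀ).trace ^ B := by
  have h := wordSum_prod leg w (B + B + B) B (fun b a x => η (a b).μ (a (B + b)).ν *
    (η (a (B + b)).μ (a (B + B + b)).ν * (η (a (B + B + b)).μ x.ν * η x.μ (a b).ν)))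
    fun b hb x a a' haa' => by
      simp only [haa' b (by omega), haa' (B + b) (by omega), haa' (B + B + b) (by omega)]
  have e : ∀ (c d : ℂ) (α β : Fin 4),
      ∑ x, w x * (c * (d * (η α (leg x).ν * η (leg x).μ β))) =
      c * (d * (η * (polarization leg w)ᵀ * η) α β) := fun c d α β => by
    rw [← sum_polarization_mul, Finset.mul_sum, Finset.mul_sum]
    exact Finset.sum_congr rfl fun _ _ => by ring
  simp only [e] at h
  rw [← wordSum_threeCycles]
  exact h

theorem wordSum_cycles {H : Tensor2} (hH : polarization leg w = H) (hs : H.IsSymm)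
    {A B C D n : ℕ} (hn : A + 2 * B + 3 * C + 4 * D = n) :
    wordSum leg w n (cycles A B C D) = (η * H).trace ^ A * ((η * H) ^ 2).trace ^ B *
      ((η * H) ^ 3).trace ^ C * ((η * H) ^ 4).trace ^ D := by
  have hl : n = A + ((B + B) + ((C + C + C) + (D + D + D + D))) := by omega
  rw [hl, funext (cycles_eq A B C D),
    wordSum_mul leg w (dependsOnFirst_oneCycles η A) _ fun a => twoCycles B a *
      (threeCycles η C (skip (B + B) a) * fourCycles D (skip (C + C + C) (skip (B + B) a))),
    wordSum_mul leg w (dependsOnFirst_twoCycles B) _ fun a =>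
      threeCycles η C a * fourCycles D (skip (C + C + C) a),
    wordSum_mul leg w (dependsOnFirst_threeCycles η C), wordSum_oneCycles, wordSum_twoCycles,
    wordSum_threeCycles, wordSum_fourCycles, hH, hs.eq]
  simp only [pow_succ, pow_zero, one_mul, mul_assoc]

theorem wordSum_vBlock {H : Tensor2} (hH : polarization leg w = H) (hs : H.IsSymm) (ϰ : ℝ)
    (n : ℕ) : wordSum leg w n (vBlock ϰ n) = (ϰ : ℂ) ^ n * coeff n (volSeriesMat (η * H)) := by
  rw [funext (vBlock_eq ϰ n), wordSum_const_mul, wordSum_sum, volSeriesMat, coeff_volSeries]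
  congr 1
  refine Finset.sum_congr rfl fun x hx => ?_
  simp only [volIndex, Finset.mem_filter, Finset.Nat.mem_antidiagonalTuple, Fin.sum_univ_four]
    at hx
  obtain ⟨hn, hij, hjk, hkl⟩ := hx
  simp only [cycleSum, wordSum_sum, wordSum_const_mul]
  refine Finset.sum_congr rfl fun p hp => Finset.sum_congr rfl fun q hq =>
    Finset.sum_congr rfl fun r hr => Finset.sum_congr rfl fun s hs' =>
    Finset.sum_congr rfl fun t ht => Finset.sum_congr rfl fun u hu =>
    Finset.sum_congr rfl fun v hv => ?_
  simp only [Finset.mem_range, Nat.lt_succ_iff] at hp hq hr hs' ht hu hv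
  congr 1
  -- The cycles use up all letters: `A + 2B + 3C + 4D = i + j + k + l`, and no subtraction is
  -- truncated in the ranges of summation.
  exact wordSum_cycles leg w hH hs (by omega)

theorem genSeries_vBlock {H : Tensor2} (hH : polarization leg w = H) (hs : H.IsSymm) (ϰ : ℝ) :
    genSeries leg w (vBlock ϰ) = rescale (ϰ : ℂ) (volSeriesMat (η * H)) := by
  ext n
  rw [genSeries, coeff_mk, coeff_rescale, wordSum_vBlock leg w hH hs]

end Words

/-! ### Blocks with derivatives -/

/-- The differential of `mink · p`. -/
noncomputable def minkCLM (p : Fin 4 → ℂ) : Spacetime →L[ℝ] ℂ :=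
  ∑ α, (ContinuousLinearMap.proj α : Spacetime →L[ℝ] ℝ).smulRight (lower p α)

theorem minkCLM_apply (p : Fin 4 → ℂ) (y : Spacetime) : minkCLM p y = mink y p := by
  simp only [mink, lower, minkCLM, sum_apply, ContinuousLinearMap.smulRight_apply,
    ContinuousLinearMap.proj_apply, Complex.real_smul, Finset.mul_sum]
  exact Finset.sum_congr rfl fun _ _ => Finset.sum_congr rfl fun _ _ => by ring

theorem minkCLM_single (p : Fin 4 → ℂ) (ρ : Fin 4) : minkCLM p (Pi.single ρ 1) = lower p ρ := by
  simp [minkCLM, Pi.single_apply]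

theorem mink_add (y : Spacetime) (p q : Fin 4 → ℂ) : mink y (p + q) = mink y p + mink y q := by
  simp only [mink, Pi.add_apply, mul_add, Finset.sum_add_distrib]

theorem mink_sum {κ : Type*} (I : Finset κ) (y : Spacetime) (p : κ → Fin 4 → ℂ) :
    mink y (∑ i ∈ I, p i) = ∑ i ∈ I, mink y (p i) := by
  classical
  induction I using Finset.induction_on with
  | empty => simp [mink]
  | insert a I ha ih => rw [Finset.sum_insert ha, Finset.sum_insert ha, mink_add, ih]

theorem lower_sum {κ : Type*} (I : Finset κ) (p : κ → Fin 4 → ℂ) (ρ : Fin 4) :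
    lower (∑ i ∈ I, p i) ρ = ∑ i ∈ I, lower (p i) ρ := by
  simp only [lower, Finset.sum_apply, Finset.mul_sum]
  exact Finset.sum_comm

theorem hasFDerivAt_exp_mink (p : Fin 4 → ℂ) (y : Spacetime) :
    HasFDerivAt (fun y => Complex.exp (Complex.I * mink y p))
      (Complex.exp (Complex.I * mink y p) • (Complex.I • minkCLM p)) y := by
  have h : HasFDerivAt (fun y => Complex.I * mink y p) (Complex.I • minkCLM p) y := by
    simp only [← minkCLM_apply]
    exact (minkCLM p).hasFDerivAt.const_mul Complex.I
  exact h.cexp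

theorem contDiff_exp_mink (p : Fin 4 → ℂ) :
    ContDiff ℝ ∞ fun y : Spacetime => Complex.exp (Complex.I * mink y p) := by
  simp only [← minkCLM_apply]
  exact (contDiff_const.mul (minkCLM p).contDiff).cexp

theorem pd_sum {κ : Type*} (I : Finset κ) (ρ : Fin 4) (f : κ → Spacetime → ℂ) (x : Spacetime)
    (hf : ∀ i ∈ I, DifferentiableAt ℝ (f i) x) :
    pd ρ (fun y => ∑ i ∈ I, f i y) x = ∑ i ∈ I, pd ρ (f i) x := by
  rw [pd, fderiv_fun_sum hf, sum_apply]
  rfl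

theorem pd_exp_mink (ρ : Fin 4) (c : ℂ) (p : Fin 4 → ℂ) (x : Spacetime) :
    pd ρ (fun y => c * Complex.exp (Complex.I * mink y p)) x =
      Complex.I * lower p ρ * (c * Complex.exp (Complex.I * mink x p)) := by
  rw [pd, ((hasFDerivAt_exp_mink p x).const_mul c).fderiv]
  simp only [smul_apply, minkCLM_single, smul_eq_mul]
  ring

section PlaneWaves

variable {ι : Type*} (leg : ι → Leg) (τ : ι → ℂ)

/-- The plane waves with the momenta of the gravitons and amplitudes `τ`. -/
noncomputable def waveWeight (y : Spacetime) (x : ι) : ℂ :=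
  τ x * Complex.exp (Complex.I * mink y (leg x).p)

theorem prod_waveWeight (y : Spacetime) {n : ℕ} (f : Fin n → ι) :
    ∏ i, waveWeight leg τ y (f i) =
      (∏ i, τ (f i)) * Complex.exp (Complex.I * mink y (∑ i, (leg (f i)).p)) := by
  simp only [waveWeight]
  rw [Finset.prod_mul_distrib, ← Complex.exp_sum, mink_sum, Finset.mul_sum]

variable [Fintype ι]

/-- As a function of the point, the weight of a word is a plane wave with the total momentum of its
letters. Differentiation multiplies each word by `i` times that momentum, which is the factor in
`𝔥'_n`. -/
theorem pd_wordSum (ρ : Fin 4) (x : Spacetime) (n : ℕ) (R : (ℕ → Leg) → ℂ) :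
    pd ρ (fun y => wordSum leg (waveWeight leg τ y) n R) x =
      wordSum leg (waveWeight leg τ x) n
        (fun a => Complex.I * (∑ m ∈ Finset.range n, lower (a m).p ρ) * R a) := by
  have h : ∀ f : Fin n → ι, (fun y => (∏ i, waveWeight leg τ y (f i)) * R (wordSeq leg f)) =
      fun y => (R (wordSeq leg f) * ∏ i, τ (f i)) *
        Complex.exp (Complex.I * mink y (∑ i, (leg (f i)).p)) := by
    intro f
    funext y
    rw [prod_waveWeight]
    ring
  have h' : (fun y => wordSum leg (waveWeight leg τ y) n R) = fun y => ∑ f : Fin n → ι,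
      (R (wordSeq leg f) * ∏ i, τ (f i)) *
        Complex.exp (Complex.I * mink y (∑ i, (leg (f i)).p)) := by
    funext y
    exact Finset.sum_congr rfl fun f _ => congrFun (h f) y
  rw [h', pd_sum _ _ _ _ fun f _ =>
    ((hasFDerivAt_exp_mink _ x).const_mul _).differentiableAt, wordSum]
  refine Finset.sum_congr rfl fun f _ => ?_
  have e : ∑ m ∈ Finset.range n, lower (wordSeq leg f m).p ρ = ∑ i, lower (leg (f i)).p ρ := by
    rw [Finset.sum_range]
    exact Finset.sum_congr rfl fun i _ => by rw [wordSeq, dif_pos i.2]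
  rw [pd_exp_mink, lower_sum, prod_waveWeight, e]
  ring

/-- The superposition of unsymmetrized plane waves. -/
noncomputable def waveField : Field2 := fun y => polarization leg (waveWeight leg τ y)

theorem pd_waveField (ρ α β : Fin 4) (x : Spacetime) :
    pd ρ (fun y => waveField leg τ y α β) x = ∑ i, waveWeight leg τ x i *
      (Complex.I * lower (leg i).p ρ *
        (if (leg i).μ = α ∧ (leg i).ν = β then 1 else 0)) := by
  have h : (fun y => waveField leg τ y α β) = fun y => ∑ i,
      (τ i * (if (leg i).μ = α ∧ (leg i).ν = β then 1 else 0)) *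
        Complex.exp (Complex.I * mink y (leg i).p) := by
    funext y
    exact Finset.sum_congr rfl fun i _ => by rw [waveWeight]; ring
  rw [h, pd_sum _ _ _ _ fun f _ =>
    ((hasFDerivAt_exp_mink _ x).const_mul _).differentiableAt]
  refine Finset.sum_congr rfl fun i _ => ?_
  rw [pd_exp_mink, waveWeight]
  ring

variable {leg τ} in
theorem isGraviton_waveField (hs : ∀ y, (waveField leg τ y).IsSymm) :
    IsGraviton (waveField leg τ) := by
  refine ⟨hs, fun α β => ?_⟩
  have h : (fun y => waveField leg τ y α β) = fun y => ∑ i,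
      (τ i * (if (leg i).μ = α ∧ (leg i).ν = β then 1 else 0)) *
        Complex.exp (Complex.I * mink y (leg i).p) := by
    funext y
    exact Finset.sum_congr rfl fun i _ => by rw [waveWeight]; ring
  rw [h]
  exact ContDiff.sum fun i _ => contDiff_const.mul (contDiff_exp_mink _)

variable {leg τ} in
-- The single letters are not symmetric, but their superposition is, so its derivative may be
-- averaged over the two index orders. This yields the symmetrized Kronecker symbols of `𝚪`.
theorem pd_waveField_symm (hs : ∀ y, (waveField leg τ y).IsSymm) (ρ α β : Fin 4)
    (x : Spacetime) : pd ρ (fun y => waveField leg τ y α β) x =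
      1 / 2 * ∑ i, waveWeight leg τ x i * (Complex.I * lower (leg i).p ρ *
        (δ α (leg i).μ * δ β (leg i).ν + δ β (leg i).μ * δ α (leg i).ν)) := by
  have h1 : (fun y => waveField leg τ y α β) = fun y => waveField leg τ y β α :=
    funext fun y => (hs y).apply β α
  have h2 : pd ρ (fun y => waveField leg τ y α β) x = 1 / 2 *
      (pd ρ (fun y => waveField leg τ y α β) x + pd ρ (fun y => waveField leg τ y β α) x) := by
    rw [← h1]
    ring
  rw [h2, pd_waveField, pd_waveField, ← Finset.sum_add_distrib]
  congr 1
  refine Finset.sum_congr rfl fun i _ => ?_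
  simp only [ite_and, δ, eq_comm (b := (leg i).μ), eq_comm (b := (leg i).ν)]
  split_ifs <;> ring

variable {leg τ} in
theorem genSeries_ΓBlock (hs : ∀ y, (waveField leg τ y).IsSymm) (ϰ : ℝ) (x : Spacetime)
    (μ ν κ : Fin 4) :
    genSeries leg (waveWeight leg τ x) (fun n a => if n = 1 then ΓBlock ϰ μ ν κ (a 0) else 0) =
      rescale (ϰ : ℂ) (X * C (1 / 2 * lowerChristoffel (waveField leg τ) x κ μ ν)) := by
  have h : ∑ i, waveWeight leg τ x i * ΓBlock ϰ μ ν κ (leg i) =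
      ϰ * (1 / 2 * lowerChristoffel (waveField leg τ) x κ μ ν) := by
    simp only [lowerChristoffel, pd_waveField_symm hs, ΓBlock]
    rw [← mul_add, ← mul_sub, ← Finset.sum_add_distrib, ← Finset.sum_sub_distrib]
    simp only [Finset.mul_sum]
    exact Finset.sum_congr rfl fun i _ => by ring
  rw [genSeries_single leg (waveWeight leg τ x) (ΓBlock ϰ μ ν κ), h]
  ext n
  rw [coeff_rescale, mul_comm X, coeff_C_mul, coeff_C_mul, coeff_X]
  split_ifs with hn
  · rw [hn]
    ring
  · simp

variable {leg τ} in
theorem genSeries_hBlock' (hs : ∀ y, (waveField leg τ y).IsSymm) (ϰ : ℝ) (x : Spacetime)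
    (c : ℕ → ℂ) (ρ μ ν : Fin 4) :
    genSeries leg (waveWeight leg τ x) (fun n a => c n * hBlock' ϰ n ρ μ ν a) =
      rescale (ϰ : ℂ) (PowerSeries.mk fun n =>
        c n * pd ρ (fun y => ((η * waveField leg τ y) ^ n * η) μ ν) x) := by
  ext n
  have h : pd ρ (fun y => wordSum leg (waveWeight leg τ y) n (hBlock ϰ n μ ν)) x =
      (ϰ : ℂ) ^ n * pd ρ (fun y => ((η * waveField leg τ y) ^ n * η) μ ν) x := by
    simp only [wordSum_hBlock]
    have e : ∀ y, (polarization leg (waveWeight leg τ y))ᵀ = waveField leg τ y := fun y => hs y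
    simp only [e]
    exact congrArg (fun L : Spacetime → Spacetime →L[ℝ] ℂ => L x (Pi.single ρ 1))
      (fderiv_const_smul_field (𝕜 := ℝ) ((ϰ : ℂ) ^ n))
  rw [coeff_rescale, genSeries, coeff_mk, coeff_mk, wordSum_const_mul, mul_left_comm, ← h,
    pd_wordSum]
  rfl

end PlaneWaves

end GravitonMatter

namespace GravitonMatter

open PowerSeries

/-! ### Polarization -/

section Polarize

variable {n : ℕ} (leg : Fin n → Leg)

/-- The gravitons with both orders of their indices. -/
def bothOrders (j : Fin n × Bool) : Leg := if j.2 then (leg j.1).swap else leg j.1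

theorem bothOrders_p (j : Fin n × Bool) : (bothOrders leg j).p = (leg j.1).p := by
  rw [bothOrders]
  split_ifs <;> rfl

/-- The symmetrized polarization is obtained by doubling the alphabet: each graviton occurs with
both orders of its indices, at weight `1/2` each. -/
theorem superposition_eq (t : Fin n → ℝ) :
    superposition leg t = waveField (bothOrders leg) fun j => (t j.1 : ℂ) * (1 / 2) := by
  funext y
  ext α β
  simp only [superposition, waveField, polarization, waveWeight, Matrix.sum_apply,
    Matrix.smul_apply, Matrix.of_apply, Leg.wave, Fintype.sum_prod_type, Fintype.sum_bool,
    bothOrders_p, smul_eq_mul]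
  refine Finset.sum_congr rfl fun j _ => ?_
  simp only [bothOrders, Leg.swap, if_true, Bool.false_eq_true, if_false, eq_comm (a := α),
    eq_comm (a := β)]
  ring

theorem superposition_symm (t : Fin n → ℝ) (y : Spacetime) : (superposition leg t y).IsSymm := by
  ext α β
  simp only [superposition, Matrix.transpose_apply, Matrix.sum_apply, Matrix.smul_apply, Leg.wave,
    Matrix.of_apply]
  refine Finset.sum_congr rfl fun j _ => ?_
  rw [add_comm (ite (α = (leg j).μ ∧ _) _ _)]
  simp only [and_comm]

/-- The multilinear form whose diagonal is a word sum. -/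
noncomputable def wordForm {ι : Type*} [Fintype ι] (n : ℕ) (pos : ι → Fin n)
    (K : (Fin n → ι) → ℂ) : ContinuousMultilinearMap ℝ (fun _ : Fin n => Fin n → ℝ) ℂ :=
  ∑ f : Fin n → ι, ((ContinuousMultilinearMap.mkPiAlgebra ℝ (Fin n) ℝ).compContinuousLinearMap
    fun i => ContinuousLinearMap.proj (pos (f i))).smulRight (K f)

theorem wordForm_apply {ι : Type*} [Fintype ι] (n : ℕ) (pos : ι → Fin n) (K : (Fin n → ι) → ℂ)
    (v : Fin n → Fin n → ℝ) :
    wordForm n pos K v = ∑ f : Fin n → ι, ((∏ i, v i (pos (f i)) : ℝ) : ℂ) * K f := by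
  simp [wordForm]

/-- On the unit vectors permuted by `σ`, only words that list the gravitons in the order `σ`
survive. What remains free is the index order of each letter. -/
theorem sum_perm_wordForm (K : (Fin n → Fin n × Bool) → ℂ) :
    ∑ σ : Equiv.Perm (Fin n), wordForm n Prod.fst K (fun i => Pi.single (σ i) 1) =
      ∑ S : Finset (Fin n), ∑ σ : Equiv.Perm (Fin n), K fun i => (σ i, decide (σ i ∈ S)) := by
  rw [Finset.sum_comm]
  refine Finset.sum_congr rfl fun σ _ => ?_
  rw [wordForm_apply,
    ← (Equiv.arrowProdEquivProdArrow (Fin n) (fun _ => Fin n) (fun _ => Bool)).symm.sum_comp,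
    Fintype.sum_prod_type, Finset.sum_eq_single (σ : Fin n → Fin n)]
  -- `S` is a set of gravitons while `b` is indexed by positions in the word, hence the inverse
  -- permutation.
  · refine Finset.sum_nbij' (fun b => Finset.univ.filter fun j => b (σ.symm j) = true)
      (fun S i => decide (σ i ∈ S)) ?_ ?_ ?_ ?_ ?_
    · simp
    · simp
    · intro b _
      funext i
      simp
    · intro S _
      ext j
      simp
    · intro b _
      simp [Equiv.arrowProdEquivProdArrow]
  · intro f _ hf
    obtain ⟨i, hi⟩ := Function.ne_iff.mp hf
    refine Finset.sum_eq_zero fun b _ => ?_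
    rw [Finset.prod_eq_zero (Finset.mem_univ i)]
    · simp
    · exact Pi.single_eq_of_ne hi 1
  · simp

/-- The vertex Feynman rule of a Lagrange density with the expansion `c`, if `c` is generated by
the unsymmetrized rules. -/
theorem hasVertexRule_of_taylor {ϰ : ℝ} {L : Lagrangian} {q : Fin 4 → ℂ}
    {rule : ℕ → (ℕ → Leg) → ℂ} (c : Field2 → Spacetime → ℂ⟦X⟧)
    (hL : ∀ h, IsGraviton h → ∀ x, HasTaylor (fun s : ℝ => L (fun y => η + (s : ℂ) • h y) x)
      (C (Complex.exp (Complex.I * mink x q)) * c h x))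
    (hrule : ∀ (ι : Type) [Fintype ι] (l : ι → Leg) (τ : ι → ℂ),
      (∀ y, (waveField l τ y).IsSymm) → ∀ x,
        genSeries l (waveWeight l τ x) rule = rescale (ϰ : ℂ) (c (waveField l τ) x)) :
    HasVertexRule ϰ L leg q (symmetrized rule leg) := by
  refine ⟨fun h hs hc x => (hL h ⟨hs, hc⟩ x).analytic, fun x => ?_⟩
  -- The kernel of the form: one factor `1/2` per letter, the wave of the total momentum including
  -- that of the matter, and the rule of the word.
  set K : (Fin n → Fin n × Bool) → ℂ := fun f => (1 / 2) ^ n *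
    Complex.exp (Complex.I * mink x (q + ∑ i, (leg (f i).1).p)) *
      rule n (wordSeq (bothOrders leg) f) with hK
  have key : (fun t : Fin n → ℝ => gradePart ϰ L n (superposition leg t) x) =
      fun t => wordForm n Prod.fst K fun _ => t := by
    funext t
    have hsymm : ∀ y, (waveField (bothOrders leg) (fun j => (t j.1 : ℂ) * (1 / 2)) y).IsSymm := by
      rw [← superposition_eq]
      exact superposition_symm leg t
    have h1 := hL _ (isGraviton_waveField hsymm) x
    have h2 := congrArg (coeff n) (hrule _ _ _ hsymm x)
    rw [coeff_rescale, genSeries, coeff_mk] at h2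
    have hf : (n ! : ℂ) ≠ 0 := by exact_mod_cast n.factorial_ne_zero
    -- The `n!` of the Taylor coefficient cancels that of the grade part, and `ϰⁿ` is absorbed by
    -- the rescaling.
    rw [gradePart, superposition_eq, h1.deriv_eq, coeff_C_mul, Complex.real_smul,
      Complex.ofReal_natCast, div_mul_eq_mul_div, mul_div_assoc, mul_div_cancel_left₀ _ hf,
      mul_left_comm, ← h2, wordForm_apply, wordSum, Finset.mul_sum]
    refine Finset.sum_congr rfl fun f _ => ?_
    rw [prod_waveWeight, hK]
    simp only [bothOrders_p, mink_add, mul_add, Complex.exp_add, Finset.prod_mul_distrib,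
      Finset.prod_const, Finset.card_univ, Fintype.card_fin, Complex.ofReal_prod]
    ring
  rw [key]
  refine ⟨?_, ?_⟩
  · exact (wordForm n Prod.fst K).contDiff.comp (contDiff_pi.mpr fun _ => contDiff_id)
  -- Polarization: the `n`-th derivative of the diagonal is the sum of the form over all orders of
  -- its arguments, without a factor `1/n!`.
  · rw [ContinuousMultilinearMap.iteratedFDeriv_comp_diagonal, sum_perm_wordForm, symmetrized]
    simp only [Finset.mul_sum, Finset.sum_mul]
    refine Finset.sum_congr rfl fun S _ => Finset.sum_congr rfl fun σ _ => ?_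
    have e1 : ∑ i, (leg (σ i)).p = ∑ i, (leg i).p := Equiv.sum_comp σ fun i => (leg i).p
    have e2 : wordSeq (bothOrders leg) (fun i => (σ i, decide (σ i ∈ S))) = arrange leg S σ := by
      funext i
      simp [wordSeq, arrange, bothOrders]
    rw [hK]
    simp only [e1, e2, one_div, inv_pow]
    ring

end Polarize

end GravitonMatter

namespace GravitonMatter

open PowerSeries

open Finset.Nat (antidiagonalTuple)

/-! ### The rules as concatenation products -/

theorem sum_antidiagonalTuple_succ {M : Type*} [AddCommMonoid M] (k n : ℕ)
    (F : (Fin (k + 1) → ℕ) → M) : ∑ m ∈ antidiagonalTuple (k + 1) n, F m =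
      ∑ p ∈ Finset.HasAntidiagonal.antidiagonal n, ∑ m ∈ antidiagonalTuple k p.2,
        F (Fin.cons p.1 m) := by
  rw [Finset.sum_sigma']
  refine Finset.sum_nbij' (fun m => ⟨(m 0, ∑ i, Fin.tail m i), Fin.tail m⟩)
    (fun z => Fin.cons z.1.1 z.2) ?_ ?_ ?_ ?_ ?_
  · intro m hm
    rw [Finset.Nat.mem_antidiagonalTuple, Fin.sum_univ_succ] at hm
    simp only [Finset.mem_sigma, Finset.HasAntidiagonal.mem_antidiagonal,
      Finset.Nat.mem_antidiagonalTuple, and_true]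
    exact hm
  · rintro ⟨⟨i, j⟩, m⟩ h
    simp only [Finset.mem_sigma, Finset.HasAntidiagonal.mem_antidiagonal,
      Finset.Nat.mem_antidiagonalTuple] at h
    simp only [Finset.Nat.mem_antidiagonalTuple, Fin.sum_univ_succ, Fin.cons_zero, Fin.cons_succ,
      h.2, h.1]
  · intro m _
    simp
  · rintro ⟨⟨i, j⟩, m⟩ h
    simp only [Finset.mem_sigma, Finset.HasAntidiagonal.mem_antidiagonal,
      Finset.Nat.mem_antidiagonalTuple] at h
    obtain ⟨-, rfl⟩ := h
    simp
  · intro m _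
    simp

theorem skip_skip (j k : ℕ) (a : ℕ → Leg) : skip k (skip j a) = skip (j + k) a := by
  funext i
  simp only [skip, add_assoc]

variable (R₁ R₂ R₃ R₄ R₅ : ℕ → (ℕ → Leg) → ℂ) (n : ℕ) (a : ℕ → Leg)

theorem concat_two : concat R₁ R₂ n a = ∑ m ∈ antidiagonalTuple 2 n,
    R₁ (m 0) a * R₂ (m 1) (skip (m 0) a) := by
  rw [sum_antidiagonalTuple_succ]
  refine Finset.sum_congr rfl fun p _ => ?_
  rw [Finset.Nat.antidiagonalTuple_one, Finset.sum_singleton]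
  rfl

theorem concat_three : concat R₁ (concat R₂ R₃) n a = ∑ m ∈ antidiagonalTuple 3 n,
    R₁ (m 0) a * R₂ (m 1) (skip (m 0) a) * R₃ (m 2) (skip (m 0 + m 1) a) := by
  rw [sum_antidiagonalTuple_succ]
  refine Finset.sum_congr rfl fun p _ => ?_
  rw [concat_two, Finset.mul_sum]
  refine Finset.sum_congr rfl fun m _ => ?_
  rw [skip_skip, ← mul_assoc]
  rfl

theorem concat_four : concat R₁ (concat R₂ (concat R₃ R₄)) n a = ∑ m ∈ antidiagonalTuple 4 n,
    R₁ (m 0) a * R₂ (m 1) (skip (m 0) a) * R₃ (m 2) (skip (m 0 + m 1) a) *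
      R₄ (m 3) (skip (m 0 + m 1 + m 2) a) := by
  rw [sum_antidiagonalTuple_succ]
  refine Finset.sum_congr rfl fun p _ => ?_
  rw [concat_three, Finset.mul_sum]
  refine Finset.sum_congr rfl fun m _ => ?_
  simp only [skip_skip, ← mul_assoc, ← add_assoc]
  rfl

theorem concat_five : concat R₁ (concat R₂ (concat R₃ (concat R₄ R₅))) n a =
    ∑ m ∈ antidiagonalTuple 5 n, R₁ (m 0) a * R₂ (m 1) (skip (m 0) a) *
      R₃ (m 2) (skip (m 0 + m 1) a) * R₄ (m 3) (skip (m 0 + m 1 + m 2) a) *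
      R₅ (m 4) (skip (m 0 + m 1 + m 2 + m 3) a) := by
  rw [sum_antidiagonalTuple_succ]
  refine Finset.sum_congr rfl fun p _ => ?_
  rw [concat_four, Finset.mul_sum]
  refine Finset.sum_congr rfl fun m _ => ?_
  simp only [skip_skip, ← mul_assoc, ← add_assoc]
  rfl

/-- A function of one graviton as a function of words. -/
def letter (F : Leg → ℂ) (n : ℕ) (a : ℕ → Leg) : ℂ := if n = 1 then F (a 0) else 0

theorem concat_letter_zero (F : Leg → ℂ) : concat (letter F) R₂ 0 a = 0 := by
  simp [concat, letter]

/-- A one-letter factor is nonzero only on a stretch of length one, so it takes exactly the first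
graviton. This accounts for the shift of the later stretches and the vanishing of the rules with too
few gravitons. -/
theorem concat_letter_succ (F : Leg → ℂ) :
    concat (letter F) R₂ (n + 1) a = F (a 0) * R₂ n (skip 1 a) := by
  rw [concat, Finset.sum_eq_single (1, n)]
  · simp [letter]
  · rintro ⟨i, j⟩ hij hne
    rw [Finset.HasAntidiagonal.mem_antidiagonal] at hij
    have : i ≠ 1 := by
      rintro rfl
      exact hne (by simp at hij ⊢; omega)
    simp [letter, this]
  · simp [add_comm]

/-- The blocks `𝔥_n` with coefficients. -/
def hWord (ϰ : ℝ) (c : ℕ → ℂ) (μ ν : Fin 4) (n : ℕ) (a : ℕ → Leg) : ℂ := c n * hBlock ϰ n μ ν a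

/-- The blocks `𝔥'_n` with coefficients. -/
def hWord' (ϰ : ℝ) (c : ℕ → ℂ) (ρ μ ν : Fin 4) (n : ℕ) (a : ℕ → Leg) : ℂ :=
  c n * hBlock' ϰ n ρ μ ν a

theorem dependsOnFirst_hWord (ϰ : ℝ) (c : ℕ → ℂ) (μ ν : Fin 4) (n : ℕ) :
    DependsOnFirst n (hWord ϰ c μ ν n) := fun a b h => by
  rw [hWord, hWord, dependsOnFirst_hBlock ϰ n μ ν a b h]

theorem dependsOnFirst_hWord' (ϰ : ℝ) (c : ℕ → ℂ) (ρ μ ν : Fin 4) (n : ℕ) :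
    DependsOnFirst n (hWord' ϰ c ρ μ ν n) := fun a b h => by
  rw [hWord', hWord', hBlock', hBlock', dependsOnFirst_hBlock ϰ n μ ν a b h,
    Finset.sum_congr rfl fun m hm => by rw [h m (Finset.mem_range.mp hm)]]

theorem dependsOnFirst_letter (F : Leg → ℂ) (n : ℕ) : DependsOnFirst n (letter F n) :=
  fun a b h => by
    rw [letter, letter]
    split_ifs with hn
    · rw [h 0 (by omega)]
    · rfl

/-- The signs in the expansion of the inverse metric. -/
def altSign (n : ℕ) : ℂ := (-1) ^ n

/-- The coefficients in the expansion of the vielbein. -/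
noncomputable def binHalf (n : ℕ) : ℂ := Ring.choose (1 / 2 : ℂ) n

/-- The coefficients in the expansion of the inverse vielbein. -/
noncomputable def binNegHalf (n : ℕ) : ℂ := Ring.choose (-1 / 2 : ℂ) n

/-- This and its analogues for the other rules move the signs and binomial coefficients into the
individual blocks, so that generating series become products factor by factor. -/
theorem rule2_eq (ϰ : ℝ) (T : Fin 4 → Fin 4 → ℂ) : rule2 ϰ T = fun n a => ∑ μ, ∑ ν,
    T μ ν * concat (hWord ϰ altSign μ ν) (vBlock ϰ) n a := by
  funext n a
  simp only [rule2, concat_two, hWord, altSign]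

theorem rule3_eq (ϰ : ℝ) (T : Fin 4 → Fin 4 → Fin 4 → Fin 4 → ℂ) : rule3 ϰ T = fun n a =>
    ∑ μ, ∑ ν, ∑ ρ, ∑ σ, T μ ν ρ σ *
      concat (hWord ϰ altSign μ ν) (concat (hWord ϰ altSign ρ σ) (vBlock ϰ)) n a := by
  funext n a
  simp only [rule3, concat_three, hWord, altSign, pow_add]
  iterate 4 refine Finset.sum_congr rfl fun _ _ => ?_
  rw [Finset.mul_sum, Finset.mul_sum]
  refine Finset.sum_congr rfl fun _ _ => ?_
  ring

theorem rule4_eq (ϰ : ℝ) (T : Fin 4 → ℂ) : rule4 ϰ T = fun n a =>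
    ∑ μ, ∑ ν, ∑ ρ, ∑ σ, T ρ * concat (letter (ΓBlock ϰ μ ν σ))
      (concat (hWord ϰ altSign μ ν) (concat (hWord ϰ altSign ρ σ) (vBlock ϰ))) n a := by
  funext n a
  obtain _ | n := n
  · simp [rule4, concat_letter_zero]
  · simp only [rule4, concat_letter_succ]
    simp only [concat_three, hWord, altSign, pow_add, skip_skip]
    iterate 4 refine Finset.sum_congr rfl fun _ _ => ?_
    simp only [Finset.mul_sum, add_comm 1]
    refine Finset.sum_congr rfl fun _ _ => ?_
    ring

theorem rule5_eq (ϰ : ℝ) (T : Fin 4 → Fin 4 → Fin 4 → ℂ) : rule5 ϰ T = fun n a =>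
    ∑ μ, ∑ ν, ∑ ρ, ∑ σ, ∑ κ, ∑ l, T ρ σ κ * concat (letter (ΓBlock ϰ μ ν l))
      (concat (hWord ϰ altSign μ ν) (concat (hWord ϰ altSign ρ σ)
        (concat (hWord ϰ altSign κ l) (vBlock ϰ)))) n a := by
  funext n a
  obtain _ | n := n
  · simp [rule5, concat_letter_zero]
  · simp only [rule5, concat_letter_succ]
    simp only [concat_four, hWord, altSign, pow_add, skip_skip]
    iterate 6 refine Finset.sum_congr rfl fun _ _ => ?_
    simp only [Finset.mul_sum, add_comm 1]
    refine Finset.sum_congr rfl fun _ _ => ?_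
    ring

theorem rule6_eq (ϰ : ℝ) (T : Fin 4 → Fin 4 → ℂ) : rule6 ϰ T = fun n a =>
    ∑ μ, ∑ ν, ∑ l, ∑ ρ, ∑ σ, ∑ τ, ∑ κ, ∑ ι, T κ ι * concat (letter (ΓBlock ϰ μ ν l))
      (concat (letter (ΓBlock ϰ ρ σ τ)) (concat (hWord ϰ altSign μ ν)
        (concat (hWord ϰ altSign ρ σ) (concat (hWord ϰ altSign κ l)
          (concat (hWord ϰ altSign ι τ) (vBlock ϰ)))))) n a := by
  funext n a
  obtain _ | _ | n := n
  · simp [rule6, concat_letter_zero]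
  · simp [rule6, concat_letter_succ, concat_letter_zero]
  · simp only [rule6, concat_letter_succ]
    simp only [concat_five, hWord, altSign, pow_add, skip_skip]
    iterate 8 refine Finset.sum_congr rfl fun _ _ => ?_
    simp only [Finset.mul_sum, add_comm (1 + 1)]
    refine Finset.sum_congr rfl fun _ _ => ?_
    rw [show skip 1 a 0 = a 1 from rfl]
    ring

theorem rule7_eq (ϰ : ℝ) (T : Fin 4 → ℂ) : rule7 ϰ T = fun n a => ∑ o, ∑ υ,
    T o * η 0 υ * concat (hWord ϰ binHalf υ o) (vBlock ϰ) n a := by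
  funext n a
  simp only [rule7, concat_two, hWord, binHalf]
  iterate 2 refine Finset.sum_congr rfl fun _ _ => ?_
  rw [Finset.mul_sum, Finset.mul_sum]
  refine Finset.sum_congr rfl fun _ _ => ?_
  ring

theorem rule8_eq (ϰ : ℝ) (T : Fin 4 → Fin 4 → Fin 4 → ℂ) : rule8 ϰ T = fun n a =>
    ∑ o, ∑ ρ, ∑ r, ∑ υ, T o ρ r * η 0 υ *
      concat (hWord ϰ binHalf υ o) (concat (hWord ϰ binNegHalf ρ r) (vBlock ϰ)) n a := by
  funext n a
  simp only [rule8, concat_three, hWord, binHalf, binNegHalf]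
  iterate 4 refine Finset.sum_congr rfl fun _ _ => ?_
  rw [Finset.mul_sum, Finset.mul_sum]
  refine Finset.sum_congr rfl fun _ _ => ?_
  ring

theorem rule9_eq (ϰ : ℝ) (T : Fin 4 → Fin 4 → Fin 4 → Fin 4 → ℂ) : rule9 ϰ T = fun n a =>
    ∑ o, ∑ r, ∑ s, ∑ t, ∑ υ, ∑ ρ, ∑ σ, ∑ τ, T o r s t * (η 0 υ * η σ τ) *
      concat (hWord ϰ binHalf υ o) (concat (hWord ϰ binNegHalf ρ r)
        (concat (hWord ϰ binNegHalf σ s) (concat (hWord' ϰ binHalf ρ τ t) (vBlock ϰ)))) n a := by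
  funext n a
  simp only [rule9, concat_five, hWord, hWord', binHalf, binNegHalf]
  iterate 8 refine Finset.sum_congr rfl fun _ _ => ?_
  rw [Finset.mul_sum, Finset.mul_sum]
  refine Finset.sum_congr rfl fun _ _ => ?_
  ring

theorem rule10_eq (ϰ : ℝ) (T : Fin 4 → Fin 4 → Fin 4 → Fin 4 → ℂ) : rule10 ϰ T = fun n a =>
    ∑ o, ∑ r, ∑ s, ∑ t, ∑ υ, ∑ ρ, ∑ σ, ∑ τ, T o r s t * η 0 υ *
      concat (letter (ΓBlock ϰ ρ σ τ)) (concat (hWord ϰ binHalf υ o)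
        (concat (hWord ϰ binNegHalf ρ r) (concat (hWord ϰ binNegHalf σ s)
          (concat (hWord ϰ binNegHalf τ t) (vBlock ϰ))))) n a := by
  funext n a
  obtain _ | n := n
  · simp [rule10, concat_letter_zero]
  · simp only [rule10, concat_letter_succ]
    simp only [concat_five, hWord, binHalf, binNegHalf, skip_skip]
    iterate 8 refine Finset.sum_congr rfl fun _ _ => ?_
    simp only [Finset.mul_sum, add_comm 1]
    refine Finset.sum_congr rfl fun _ _ => ?_
    ring

end GravitonMatter

namespace GravitonMatter

open PowerSeries Filter Topology

/-! ### Expansions of the geometric objects -/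

section Expansions

attribute [local instance] Matrix.linftyOpNormedRing Matrix.linftyOpNormedAlgebra

/-- The product `η H η ⋯ H η` of symmetric matrices is a palindrome. -/
theorem transpose_pow_mul_η {H : Tensor2} (hH : H.IsSymm) (n : ℕ) :
    ((η * H) ^ n * η)ᵀ = (η * H) ^ n * η := by
  induction n with
  | zero => rw [pow_zero, one_mul, η_transpose]
  | succ n ih =>
    rw [pow_succ', mul_assoc, Matrix.transpose_mul, ih, Matrix.transpose_mul, η_transpose, hH.eq,
      ← mul_assoc _ H, mul_assoc _ η H, ← pow_succ, ← mul_assoc (η * H), ← pow_succ']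

/-- Lowering with `η` undoes the final `η`, and the palindrome symmetry lets the lowered index come
first. This is the form `η_{συ} 𝔥^{υ t}` in which the rules write the vielbein. -/
theorem pow_apply_eq_sum {H : Tensor2} (hH : H.IsSymm) (n : ℕ) (t σ : Fin 4) :
    ((η * H) ^ n) t σ = ∑ τ, η σ τ * ((η * H) ^ n * η) τ t := by
  rw [← Matrix.mul_apply, ← transpose_pow_mul_η hH n, ← η_transpose, ← Matrix.transpose_mul,
    η_transpose, mul_assoc, η_mul_η, mul_one, Matrix.transpose_apply]

variable (h : Field2) (x : Spacetime)

/-- The expansion of the inverse metric. -/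
noncomputable def inverseMetricSeries (μ ν : Fin 4) : ℂ⟦X⟧ := blockSeries altSign (η * h x) μ ν

/-- The expansion of the vielbein with the lower index raised by the Minkowski metric. -/
noncomputable def vielbeinSeries (μ ν : Fin 4) : ℂ⟦X⟧ := blockSeries binHalf (η * h x) μ ν

/-- The expansion of the inverse vielbein with raised flat index. -/
noncomputable def inverseVielbeinSeries (μ ν : Fin 4) : ℂ⟦X⟧ :=
  blockSeries binNegHalf (η * h x) μ ν

/-- The expansion of the derivative of the vielbein with the lower index raised by the Minkowski
metric. -/
noncomputable def vielbeinDerivSeries (ρ μ ν : Fin 4) : ℂ⟦X⟧ :=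
  PowerSeries.mk fun n => binHalf n * pd ρ (fun y => ((η * h y) ^ n * η) μ ν) x

/-- The expansion of the Christoffel symbol with the first index lowered. -/
noncomputable def christoffelSeries (κ μ ν : Fin 4) : ℂ⟦X⟧ :=
  X * C (1 / 2 * lowerChristoffel h x κ μ ν)

/-- The expansion of the volume density. -/
noncomputable def volumeSeries : ℂ⟦X⟧ := volSeriesMat (η * h x)

variable {h}

theorem hasTaylor_volume : HasTaylor (fun s : ℝ => volDensity (η + (s : ℂ) • h x))
    (volumeSeries h x) :=
  hasTaylor_volDensity (h x)

theorem matSeries_powSeries_mul (c : ℕ → ℂ) (Y : Tensor2) (i j : Fin 4) :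
    matSeries (fun n => coeff n (powSeries c Y * C η)) i j = blockSeries c Y i j := by
  ext n
  simp only [matSeries, blockSeries, coeff_mk, coeff_mul_C, coeff_powSeries, smul_mul_assoc,
    Matrix.smul_apply, smul_eq_mul]

theorem hasTaylor_inverseMetric (μ ν : Fin 4) :
    HasTaylor (fun s : ℝ => (η + (s : ℂ) • h x)⁻¹ μ ν) (inverseMetricSeries h x μ ν) := by
  have H := (hasTaylor_inv (h x)).entry μ ν
  rw [matSeries_powSeries_mul] at H
  exact H

namespace IsGraviton

theorem hasTaylor_inverseVielbein (hh : IsGraviton h) (μ ν : Fin 4) :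
    HasTaylor (fun s : ℝ => invVielbeinUp (η + (s : ℂ) • h x) μ ν)
      (inverseVielbeinSeries h x μ ν) := by
  have H := (hasTaylor_invVielbeinUp (hh.symm x)).entry μ ν
  rw [matSeries_powSeries_mul] at H
  exact H

theorem hasTaylor_vielbein (hh : IsGraviton h) (t σ : Fin 4) :
    HasTaylor (fun s : ℝ => vielbein (η + (s : ℂ) • h x) t σ)
      (∑ τ, C (η σ τ) * vielbeinSeries h x τ t) := by
  have H := (GravitonMatter.hasTaylor_vielbein (hh.symm x)).entry t σ
  have e : matSeries (fun n => coeff n (powSeries (Ring.choose (1 / 2)) (η * h x))) t σ =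
      ∑ τ, C (η σ τ) * vielbeinSeries h x τ t := by
    ext n
    simp only [matSeries, vielbeinSeries, blockSeries, coeff_mk, coeff_powSeries, map_sum,
      coeff_C_mul, Matrix.smul_apply, smul_eq_mul, pow_apply_eq_sum (hh.symm x), Finset.mul_sum,
      binHalf]
    exact Finset.sum_congr rfl fun _ _ => by ring
  rwa [e] at H

theorem hasTaylor_vielbeinDeriv (hh : IsGraviton h) (ρ t σ : Fin 4) :
    HasTaylor (fun s : ℝ => pd ρ (fun y => vielbein (η + (s : ℂ) • h y) t σ) x)
      (∑ τ, C (η σ τ) * vielbeinDerivSeries h x ρ τ t) := by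
  have H := hh.hasTaylor_pd_vielbein x ρ t σ
  have e : (PowerSeries.mk fun n =>
        Ring.choose (1 / 2 : ℂ) n * pd ρ (fun y => ((η * h y) ^ n) t σ) x) =
      ∑ τ, C (η σ τ) * vielbeinDerivSeries h x ρ τ t := by
    ext n
    have hM : DifferentiableAt ℝ (fun y => (η * h y) ^ n * η) x :=
      ((hh.differentiableAt_endo x).fun_pow n).mul (differentiableAt_const η)
    have hd : ∀ τ, DifferentiableAt ℝ (fun y => ((η * h y) ^ n * η) τ t) x := fun τ =>
      DifferentiableAt.comp (g := entryCLM τ t) x (entryCLM τ t).differentiableAt hM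
    simp only [vielbeinDerivSeries, coeff_mk, map_sum, coeff_C_mul]
    simp only [pow_apply_eq_sum (hh.symm _)]
    rw [pd_sum _ _ _ _ fun τ _ => (hd τ).const_mul (η σ τ), Finset.mul_sum]
    refine Finset.sum_congr rfl fun τ _ => ?_
    rw [pd, fderiv_const_mul (hd τ), binHalf, pd]
    simp only [smul_apply, smul_eq_mul]
    ring
  rwa [e] at H

theorem hasTaylor_christoffel (hh : IsGraviton h) (τ μ ν : Fin 4) :
    HasTaylor (fun s : ℝ => christoffel (fun y => η + (s : ℂ) • h y) x τ μ ν)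
      (∑ κ, inverseMetricSeries h x τ κ * christoffelSeries h x κ μ ν) := by
  simp only [hh.christoffel_line]
  exact HasTaylor.sum _ fun κ _ => (hasTaylor_inverseMetric x τ κ).mul
    (hasTaylor_ofReal.mul (HasTaylor.const _))

/-- The Christoffel symbol with the upper index made flat. -/
theorem hasTaylor_flatChristoffel (hh : IsGraviton h) (t μ ν : Fin 4) :
    HasTaylor (fun s : ℝ => ∑ τ, vielbein (η + (s : ℂ) • h x) t τ *
        christoffel (fun y => η + (s : ℂ) • h y) x τ μ ν)
      (∑ κ, inverseVielbeinSeries h x κ t * christoffelSeries h x κ μ ν) := by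
  have e : (fun s : ℝ => ∑ τ, vielbein (η + (s : ℂ) • h x) t τ *
        christoffel (fun y => η + (s : ℂ) • h y) x τ μ ν) = fun s : ℝ =>
      ∑ κ, invVielbeinUp (η + (s : ℂ) • h x) κ t *
        (s * (1 / 2 * lowerChristoffel h x κ μ ν)) := by
    funext s
    simp only [hh.christoffel_line, Finset.mul_sum, ← vielbein_mul_inv (isSymm_line (hh.symm x) s),
      Finset.sum_mul]
    rw [Finset.sum_comm]
    exact Finset.sum_congr rfl fun _ _ => Finset.sum_congr rfl fun _ _ => by ring
  rw [e]
  exact HasTaylor.sum _ fun κ _ => (hh.hasTaylor_inverseVielbein x κ t).mul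
    (hasTaylor_ofReal.mul (HasTaylor.const _))

end IsGraviton

end Expansions

/-! ### Generating series of the blocks -/

theorem rescale_C (a b : ℂ) : rescale a (C b) = C b := by
  ext n
  rw [coeff_rescale, coeff_C]
  split_ifs with h <;> simp [h]

section Generating

variable {ι : Type} [Fintype ι] {l : ι → Leg} {τ : ι → ℂ}

theorem genSeries_concat_hWord (w : ι → ℂ) (ϰ : ℝ) (c : ℕ → ℂ) (μ ν : Fin 4)
    (R : ℕ → (ℕ → Leg) → ℂ) : genSeries l w (concat (hWord ϰ c μ ν) R) =
      genSeries l w (hWord ϰ c μ ν) * genSeries l w R :=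
  genSeries_concat l w (dependsOnFirst_hWord ϰ c μ ν) R

theorem genSeries_concat_hWord' (w : ι → ℂ) (ϰ : ℝ) (c : ℕ → ℂ) (ρ μ ν : Fin 4)
    (R : ℕ → (ℕ → Leg) → ℂ) : genSeries l w (concat (hWord' ϰ c ρ μ ν) R) =
      genSeries l w (hWord' ϰ c ρ μ ν) * genSeries l w R :=
  genSeries_concat l w (dependsOnFirst_hWord' ϰ c ρ μ ν) R

theorem genSeries_concat_letter (w : ι → ℂ) (F : Leg → ℂ) (R : ℕ → (ℕ → Leg) → ℂ) :
    genSeries l w (concat (letter F) R) = genSeries l w (letter F) * genSeries l w R :=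
  genSeries_concat l w (dependsOnFirst_letter F) R

theorem genSeries_altSign (hs : ∀ y, (waveField l τ y).IsSymm) (ϰ : ℝ)
    (x : Spacetime) (μ ν : Fin 4) :
    genSeries l (waveWeight l τ x) (hWord ϰ altSign μ ν) =
      rescale (ϰ : ℂ) (inverseMetricSeries (waveField l τ) x μ ν) :=
  genSeries_hBlock _ _ (hs x).eq _ _ _ _

theorem genSeries_binHalf (hs : ∀ y, (waveField l τ y).IsSymm) (ϰ : ℝ)
    (x : Spacetime) (μ ν : Fin 4) :
    genSeries l (waveWeight l τ x) (hWord ϰ binHalf μ ν) =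
      rescale (ϰ : ℂ) (vielbeinSeries (waveField l τ) x μ ν) :=
  genSeries_hBlock _ _ (hs x).eq _ _ _ _

theorem genSeries_binNegHalf (hs : ∀ y, (waveField l τ y).IsSymm) (ϰ : ℝ)
    (x : Spacetime) (μ ν : Fin 4) :
    genSeries l (waveWeight l τ x) (hWord ϰ binNegHalf μ ν) =
      rescale (ϰ : ℂ) (inverseVielbeinSeries (waveField l τ) x μ ν) :=
  genSeries_hBlock _ _ (hs x).eq _ _ _ _

theorem genSeries_hWord' (hs : ∀ y, (waveField l τ y).IsSymm) (ϰ : ℝ)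
    (x : Spacetime) (ρ μ ν : Fin 4) :
    genSeries l (waveWeight l τ x) (hWord' ϰ binHalf ρ μ ν) =
      rescale (ϰ : ℂ) (vielbeinDerivSeries (waveField l τ) x ρ μ ν) :=
  genSeries_hBlock' hs _ _ _ _ _ _

theorem genSeries_letter_ΓBlock (hs : ∀ y, (waveField l τ y).IsSymm) (ϰ : ℝ)
    (x : Spacetime) (μ ν κ : Fin 4) :
    genSeries l (waveWeight l τ x) (letter (ΓBlock ϰ μ ν κ)) =
      rescale (ϰ : ℂ) (christoffelSeries (waveField l τ) x κ μ ν) :=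
  genSeries_ΓBlock hs _ _ _ _ _

theorem genSeries_volume (hs : ∀ y, (waveField l τ y).IsSymm) (ϰ : ℝ)
    (x : Spacetime) :
    genSeries l (waveWeight l τ x) (vBlock ϰ) =
      rescale (ϰ : ℂ) (volumeSeries (waveField l τ) x) :=
  genSeries_vBlock _ _ rfl (hs x) _

end Generating

/-! ### The vertex rules -/

/-- The sum over `τ` is isolated so that the vielbein and the Christoffel symbol can be expanded
together. -/
theorem lagrangian10_eq (T : Spacetime → Fin 4 → Fin 4 → Fin 4 → Fin 4 → ℂ) (g : Field2)
    (x : Spacetime) : lagrangian10 T g x = (∑ o, ∑ ρ, ∑ r, ∑ σ, ∑ s, ∑ t,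
      vielbein (g x) o 0 * invVielbeinUp (g x) ρ r * invVielbeinUp (g x) σ s *
        (∑ τ, vielbein (g x) t τ * christoffel g x τ ρ σ) * T x o r s t) * volDensity (g x) := by
  rw [lagrangian10]
  refine congrArg (· * volDensity (g x)) ?_
  iterate 5 refine Finset.sum_congr rfl fun _ _ => ?_
  rw [Finset.sum_comm]
  refine Finset.sum_congr rfl fun _ _ => ?_
  rw [Finset.mul_sum, Finset.sum_mul]
  exact Finset.sum_congr rfl fun _ _ => by ring

section Rules

variable (ϰ : ℝ) {n : ℕ} (leg : Fin n → Leg) (q : Fin 4 → ℂ)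

/-- Here, and for the other nine types, one explicit product series serves twice: as the Taylor
series of the density without the matter wave, and, rescaled, as the generating series of the rule.
-/
theorem hasVertexRule1 (T : ℂ) :
    HasVertexRule ϰ (lagrangian1 (matterWave q T)) leg q
    (symmetrized (rule1 ϰ T) leg) := by
  refine hasVertexRule_of_taylor leg (fun h x => C (T) * volumeSeries h x) (fun h hh x => ?_)
      fun ι _ l τ hs x => ?_
  · have H := (HasTaylor.const (matterWave q T x)).mul (hasTaylor_volume (h := h) x)
    refine Eq.subst (motive := HasTaylor _) ?_ H
    simp only [matterWave, smul_eq_mul, map_mul]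
    ring
  · change genSeries l _ (fun n a => T * vBlock ϰ n a) = _
    simp only [genSeries_const_mul, genSeries_volume hs, map_mul, rescale_C]

theorem hasVertexRule2 (T : Fin 4 → Fin 4 → ℂ) :
    HasVertexRule ϰ (lagrangian2 (matterWave q T)) leg q
    (symmetrized (rule2 ϰ T) leg) := by
  refine hasVertexRule_of_taylor leg (fun h x => ∑ μ, ∑ ν, C (T μ ν) * (inverseMetricSeries h x μ
      ν * volumeSeries h x)) (fun h hh x => ?_) fun ι _ l τ hs x => ?_
  · have H := (HasTaylor.sum .univ fun μ _ => HasTaylor.sum .univ fun ν _ =>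
      (hasTaylor_inverseMetric (h := h) x μ ν).mul (HasTaylor.const (matterWave q T x μ ν))).mul
      (hasTaylor_volume (h := h) x)
    refine Eq.subst (motive := HasTaylor _) ?_ H
    simp only [matterWave, Pi.smul_apply, smul_eq_mul, map_mul, Finset.mul_sum, Finset.sum_mul]
    iterate 2 refine Finset.sum_congr rfl fun _ _ => ?_
    ring
  · rw [rule2_eq]
    simp only [genSeries_sum, genSeries_const_mul, genSeries_concat_hWord, genSeries_altSign hs,
      genSeries_volume hs, map_sum, map_mul, rescale_C]

theorem hasVertexRule3 (T : Fin 4 → Fin 4 → Fin 4 → Fin 4 → ℂ) :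
    HasVertexRule ϰ (lagrangian3 (matterWave q T)) leg q
    (symmetrized (rule3 ϰ T) leg) := by
  refine hasVertexRule_of_taylor leg (fun h x => ∑ μ, ∑ ν, ∑ ρ, ∑ σ, C (T μ ν ρ σ) *
      (inverseMetricSeries h x μ ν * (inverseMetricSeries h x ρ σ * volumeSeries h x))) (fun h
      hh x => ?_) fun ι _ l τ hs x => ?_
  · have H := (HasTaylor.sum .univ fun μ _ => HasTaylor.sum .univ fun ν _ => HasTaylor.sum .univ
      fun ρ _ => HasTaylor.sum .univ fun σ _ => ((hasTaylor_inverseMetric (h := h) x μ ν).mul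
      (hasTaylor_inverseMetric (h := h) x ρ σ)).mul (HasTaylor.const (matterWave q T x μ ν ρ
      σ))).mul (hasTaylor_volume (h := h) x)
    refine Eq.subst (motive := HasTaylor _) ?_ H
    simp only [matterWave, Pi.smul_apply, smul_eq_mul, map_mul, Finset.mul_sum, Finset.sum_mul]
    iterate 4 refine Finset.sum_congr rfl fun _ _ => ?_
    ring
  · rw [rule3_eq]
    simp only [genSeries_sum, genSeries_const_mul, genSeries_concat_hWord, genSeries_altSign hs,
      genSeries_volume hs, map_sum, map_mul, rescale_C]

theorem hasVertexRule4 (T : Fin 4 → ℂ) :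
    HasVertexRule ϰ (lagrangian4 (matterWave q T)) leg q
    (symmetrized (rule4 ϰ T) leg) := by
  refine hasVertexRule_of_taylor leg (fun h x => ∑ μ, ∑ ν, ∑ ρ, ∑ σ, C (T ρ) * (christoffelSeries
      h x σ μ ν * (inverseMetricSeries h x μ ν * (inverseMetricSeries h x ρ σ * volumeSeries h
      x)))) (fun h hh x => ?_) fun ι _ l τ hs x => ?_
  · have H := (HasTaylor.sum .univ fun μ _ => HasTaylor.sum .univ fun ν _ => HasTaylor.sum .univ
      fun τ _ => ((hasTaylor_inverseMetric (h := h) x μ ν).mul (hh.hasTaylor_christoffel x τ μ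
      ν)).mul (HasTaylor.const (matterWave q T x τ))).mul (hasTaylor_volume (h := h) x)
    refine Eq.subst (motive := HasTaylor _) ?_ H
    simp only [matterWave, Pi.smul_apply, smul_eq_mul, map_mul, Finset.mul_sum, Finset.sum_mul]
    iterate 4 refine Finset.sum_congr rfl fun _ _ => ?_
    ring
  · rw [rule4_eq]
    simp only [genSeries_sum, genSeries_const_mul, genSeries_concat_hWord,
      genSeries_concat_letter, genSeries_letter_ΓBlock hs, genSeries_altSign hs,
      genSeries_volume hs, map_sum, map_mul, rescale_C]

theorem hasVertexRule5 (T : Fin 4 → Fin 4 → Fin 4 → ℂ) :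
    HasVertexRule ϰ (lagrangian5 (matterWave q T)) leg q
    (symmetrized (rule5 ϰ T) leg) := by
  refine hasVertexRule_of_taylor leg (fun h x => ∑ μ, ∑ ν, ∑ ρ, ∑ σ, ∑ κ, ∑ l, C (T ρ σ κ) *
      (christoffelSeries h x l μ ν * (inverseMetricSeries h x μ ν * (inverseMetricSeries h x ρ σ
      * (inverseMetricSeries h x κ l * volumeSeries h x))))) (fun h hh x => ?_) fun ι _ l τ hs
      x => ?_
  · have H := (HasTaylor.sum .univ fun μ _ => HasTaylor.sum .univ fun ν _ => HasTaylor.sum .univ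
      fun ρ _ => HasTaylor.sum .univ fun σ _ => HasTaylor.sum .univ fun τ _ =>
      (((hasTaylor_inverseMetric (h := h) x μ ν).mul (hasTaylor_inverseMetric (h := h) x ρ
      σ)).mul (hh.hasTaylor_christoffel x τ μ ν)).mul (HasTaylor.const (matterWave q T x ρ σ
      τ))).mul (hasTaylor_volume (h := h) x)
    refine Eq.subst (motive := HasTaylor _) ?_ H
    simp only [matterWave, Pi.smul_apply, smul_eq_mul, map_mul, Finset.mul_sum, Finset.sum_mul]
    iterate 6 refine Finset.sum_congr rfl fun _ _ => ?_
    ring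
  · rw [rule5_eq]
    simp only [genSeries_sum, genSeries_const_mul, genSeries_concat_hWord,
      genSeries_concat_letter, genSeries_letter_ΓBlock hs, genSeries_altSign hs,
      genSeries_volume hs, map_sum, map_mul, rescale_C]

theorem hasVertexRule6 (T : Fin 4 → Fin 4 → ℂ) :
    HasVertexRule ϰ (lagrangian6 (matterWave q T)) leg q
    (symmetrized (rule6 ϰ T) leg) := by
  refine hasVertexRule_of_taylor leg (fun h x => ∑ μ, ∑ ν, ∑ l, ∑ ρ, ∑ σ, ∑ τ, ∑ κ, ∑ ι, C (T κ
      ι) * (christoffelSeries h x l μ ν * (christoffelSeries h x τ ρ σ * (inverseMetricSeries h x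
      μ ν * (inverseMetricSeries h x ρ σ * (inverseMetricSeries h x κ l * (inverseMetricSeries h
      x ι τ * volumeSeries h x))))))) (fun h hh x => ?_) fun ι _ l τ hs x => ?_
  · have H := (HasTaylor.sum .univ fun μ _ => HasTaylor.sum .univ fun ν _ => HasTaylor.sum .univ
      fun ρ _ => HasTaylor.sum .univ fun σ _ => HasTaylor.sum .univ fun κ _ => HasTaylor.sum
      .univ fun l _ => ((((hasTaylor_inverseMetric (h := h) x μ ν).mul (hasTaylor_inverseMetric
      (h := h) x ρ σ)).mul (hh.hasTaylor_christoffel x κ μ ν)).mul (hh.hasTaylor_christoffel x l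
      ρ σ)).mul (HasTaylor.const (matterWave q T x κ l))).mul (hasTaylor_volume (h := h) x)
    refine Eq.subst (motive := HasTaylor _) ?_ H
    simp only [matterWave, Pi.smul_apply, smul_eq_mul, map_mul, Finset.mul_sum, Finset.sum_mul]
    -- Only the order of the dummy indices differs. The last two, `b` and `a`, are the lowered
    -- indices that arise from expanding the second and the first Christoffel symbol.
    simp only [← Fintype.sum_prod_type']
    exact Fintype.sum_equiv ⟨fun (μ, ν, ρ, σ, κ, l, b, a) => (μ, ν, a, ρ, σ, b, κ, l),
      fun (μ, ν, a, ρ, σ, b, κ, l) => (μ, ν, ρ, σ, κ, l, b, a), fun _ => rfl, fun _ => rfl⟩ _ _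
      fun _ => by simp only [Equiv.coe_fn_mk]; ring
  · rw [rule6_eq]
    simp only [genSeries_sum, genSeries_const_mul, genSeries_concat_hWord,
      genSeries_concat_letter, genSeries_letter_ΓBlock hs, genSeries_altSign hs,
      genSeries_volume hs, map_sum, map_mul, rescale_C]

theorem hasVertexRule7 (T : Fin 4 → ℂ) :
    HasVertexRule ϰ (lagrangian7 (matterWave q T)) leg q
    (symmetrized (rule7 ϰ T) leg) := by
  refine hasVertexRule_of_taylor leg (fun h x => ∑ o, ∑ υ, C (T o * η 0 υ) * (vielbeinSeries h x
      υ o * volumeSeries h x)) (fun h hh x => ?_) fun ι _ l τ hs x => ?_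
  · have H := (HasTaylor.sum .univ fun o _ => (hh.hasTaylor_vielbein x o 0).mul (HasTaylor.const
      (matterWave q T x o))).mul (hasTaylor_volume (h := h) x)
    refine Eq.subst (motive := HasTaylor _) ?_ H
    simp only [matterWave, Pi.smul_apply, smul_eq_mul, map_mul, Finset.mul_sum, Finset.sum_mul]
    iterate 2 refine Finset.sum_congr rfl fun _ _ => ?_
    ring
  · rw [rule7_eq]
    simp only [genSeries_sum, genSeries_const_mul, genSeries_concat_hWord, genSeries_binHalf hs,
      genSeries_volume hs, map_sum, map_mul, rescale_C]

theorem hasVertexRule8 (T : Fin 4 → Fin 4 → Fin 4 → ℂ) :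
    HasVertexRule ϰ (lagrangian8 (matterWave q T)) leg q
    (symmetrized (rule8 ϰ T) leg) := by
  refine hasVertexRule_of_taylor leg (fun h x => ∑ o, ∑ ρ, ∑ r, ∑ υ, C (T o ρ r * η 0 υ) *
      (vielbeinSeries h x υ o * (inverseVielbeinSeries h x ρ r * volumeSeries h x))) (fun h hh
      x => ?_) fun ι _ l τ hs x => ?_
  · have H := (HasTaylor.sum .univ fun o _ => HasTaylor.sum .univ fun ρ _ => HasTaylor.sum .univ
      fun r _ => ((hh.hasTaylor_vielbein x o 0).mul (hh.hasTaylor_inverseVielbein x ρ r)).mul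
      (HasTaylor.const (matterWave q T x o ρ r))).mul (hasTaylor_volume (h := h) x)
    refine Eq.subst (motive := HasTaylor _) ?_ H
    simp only [matterWave, Pi.smul_apply, smul_eq_mul, map_mul, Finset.mul_sum, Finset.sum_mul]
    iterate 4 refine Finset.sum_congr rfl fun _ _ => ?_
    ring
  · rw [rule8_eq]
    simp only [genSeries_sum, genSeries_const_mul, genSeries_concat_hWord, genSeries_binHalf hs,
      genSeries_binNegHalf hs, genSeries_volume hs, map_sum, map_mul, rescale_C]

theorem hasVertexRule9 (T : Fin 4 → Fin 4 → Fin 4 → Fin 4 → ℂ) :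
    HasVertexRule ϰ (lagrangian9 (matterWave q T)) leg q
    (symmetrized (rule9 ϰ T) leg) := by
  refine hasVertexRule_of_taylor leg (fun h x => ∑ o, ∑ r, ∑ s, ∑ t, ∑ υ, ∑ ρ, ∑ σ, ∑ τ, C (T o r
      s t * (η 0 υ * η σ τ)) * (vielbeinSeries h x υ o * (inverseVielbeinSeries h x ρ r *
      (inverseVielbeinSeries h x σ s * (vielbeinDerivSeries h x ρ τ t * volumeSeries h x)))))
      (fun h hh x => ?_) fun ι _ l τ hs x => ?_
  · have H := (HasTaylor.sum .univ fun o _ => HasTaylor.sum .univ fun ρ _ => HasTaylor.sum .univ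
      fun r _ => HasTaylor.sum .univ fun σ _ => HasTaylor.sum .univ fun s _ => HasTaylor.sum
      .univ fun t _ => ((((hh.hasTaylor_vielbein x o 0).mul (hh.hasTaylor_inverseVielbein x ρ
      r)).mul (hh.hasTaylor_inverseVielbein x σ s)).mul (hh.hasTaylor_vielbeinDeriv x ρ t σ)).mul
      (HasTaylor.const (matterWave q T x o r s t))).mul (hasTaylor_volume (h := h) x)
    refine Eq.subst (motive := HasTaylor _) ?_ H
    simp only [matterWave, Pi.smul_apply, smul_eq_mul, map_mul, Finset.mul_sum, Finset.sum_mul]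
    -- The trailing `τ` and `υ` come from lowering the indices of the differentiated vielbein and of
    -- `e^o_0`; the bijection moves them to their places in the rule.
    simp only [← Fintype.sum_prod_type']
    exact Fintype.sum_equiv ⟨fun (o, ρ, r, σ, s, t, τ, υ) => (o, r, s, t, υ, ρ, σ, τ),
      fun (o, r, s, t, υ, ρ, σ, τ) => (o, ρ, r, σ, s, t, τ, υ), fun _ => rfl, fun _ => rfl⟩ _ _
      fun _ => by simp only [Equiv.coe_fn_mk]; ring
  · rw [rule9_eq]
    simp only [genSeries_sum, genSeries_const_mul, genSeries_concat_hWord,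
      genSeries_concat_hWord', genSeries_hWord' hs, genSeries_binHalf hs,
      genSeries_binNegHalf hs, genSeries_volume hs, map_sum, map_mul, rescale_C]

theorem hasVertexRule10 (T : Fin 4 → Fin 4 → Fin 4 → Fin 4 → ℂ) :
    HasVertexRule ϰ (lagrangian10 (matterWave q T)) leg q
    (symmetrized (rule10 ϰ T) leg) := by
  refine hasVertexRule_of_taylor leg (fun h x => ∑ o, ∑ r, ∑ s, ∑ t, ∑ υ, ∑ ρ, ∑ σ, ∑ τ, C (T o r
      s t * η 0 υ) * (christoffelSeries h x τ ρ σ * (vielbeinSeries h x υ o *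
      (inverseVielbeinSeries h x ρ r * (inverseVielbeinSeries h x σ s * (inverseVielbeinSeries h
      x τ t * volumeSeries h x)))))) (fun h hh x => ?_) fun ι _ l τ hs x => ?_
  · have H := (HasTaylor.sum .univ fun o _ => HasTaylor.sum .univ fun ρ _ => HasTaylor.sum .univ
      fun r _ => HasTaylor.sum .univ fun σ _ => HasTaylor.sum .univ fun s _ => HasTaylor.sum
      .univ fun t _ => ((((hh.hasTaylor_vielbein x o 0).mul (hh.hasTaylor_inverseVielbein x ρ
      r)).mul (hh.hasTaylor_inverseVielbein x σ s)).mul (hh.hasTaylor_flatChristoffel x t ρ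
      σ)).mul (HasTaylor.const (matterWave q T x o r s t))).mul (hasTaylor_volume (h := h) x)
    simp only [lagrangian10_eq]
    refine Eq.subst (motive := HasTaylor _) ?_ H
    simp only [matterWave, Pi.smul_apply, smul_eq_mul, map_mul, Finset.mul_sum, Finset.sum_mul]
    simp only [← Fintype.sum_prod_type']
    exact Fintype.sum_equiv ⟨fun (o, ρ, r, σ, s, t, τ, υ) => (o, r, s, t, υ, ρ, σ, τ),
      fun (o, r, s, t, υ, ρ, σ, τ) => (o, ρ, r, σ, s, t, τ, υ), fun _ => rfl, fun _ => rfl⟩ _ _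
      fun _ => by simp only [Equiv.coe_fn_mk]; ring
  · rw [rule10_eq]
    simp only [genSeries_sum, genSeries_const_mul, genSeries_concat_hWord,
      genSeries_concat_letter, genSeries_letter_ΓBlock hs, genSeries_binHalf hs,
      genSeries_binNegHalf hs, genSeries_volume hs, map_sum, map_mul, rescale_C]

end Rules

end GravitonMatter

theorem mainTheorem9 (ϰ : ℝ) (n : ℕ) (leg : Fin n → Leg) (q : Fin 4 → ℂ) :
    (∀ T : ℂ, HasVertexRule ϰ (lagrangian1 (matterWave q T)) leg q
      (symmetrized (rule1 ϰ T) leg)) ∧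
    (∀ T : Fin 4 → Fin 4 → ℂ, HasVertexRule ϰ (lagrangian2 (matterWave q T)) leg q
      (symmetrized (rule2 ϰ T) leg)) ∧
    (∀ T : Fin 4 → Fin 4 → Fin 4 → Fin 4 → ℂ, HasVertexRule ϰ (lagrangian3 (matterWave q T)) leg q
      (symmetrized (rule3 ϰ T) leg)) ∧
    (∀ T : Fin 4 → ℂ, HasVertexRule ϰ (lagrangian4 (matterWave q T)) leg q
      (symmetrized (rule4 ϰ T) leg)) ∧
    (∀ T : Fin 4 → Fin 4 → Fin 4 → ℂ, HasVertexRule ϰ (lagrangian5 (matterWave q T)) leg q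
      (symmetrized (rule5 ϰ T) leg)) ∧
    (∀ T : Fin 4 → Fin 4 → ℂ, HasVertexRule ϰ (lagrangian6 (matterWave q T)) leg q
      (symmetrized (rule6 ϰ T) leg)) ∧
    (∀ T : Fin 4 → ℂ, HasVertexRule ϰ (lagrangian7 (matterWave q T)) leg q
      (symmetrized (rule7 ϰ T) leg)) ∧
    (∀ T : Fin 4 → Fin 4 → Fin 4 → ℂ, HasVertexRule ϰ (lagrangian8 (matterWave q T)) leg q
      (symmetrized (rule8 ϰ T) leg)) ∧
    (∀ T : Fin 4 → Fin 4 → Fin 4 → Fin 4 → ℂ, HasVertexRule ϰ (lagrangian9 (matterWave q T)) leg q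
      (symmetrized (rule9 ϰ T) leg)) ∧
    (∀ T : Fin 4 → Fin 4 → Fin 4 → Fin 4 → ℂ, HasVertexRule ϰ (lagrangian10 (matterWave q T)) leg q
      (symmetrized (rule10 ϰ T) leg)) :=
  ⟨hasVertexRule1 ϰ leg q, hasVertexRule2 ϰ leg q, hasVertexRule3 ϰ leg q,
    hasVertexRule4 ϰ leg q, hasVertexRule5 ϰ leg q, hasVertexRule6 ϰ leg q,
    hasVertexRule7 ϰ leg q, hasVertexRule8 ϰ leg q, hasVertexRule9 ϰ leg q,
    hasVertexRule10 ϰ leg q⟩
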